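/- Let $V\in C^\infty(\mathbb R)$ be real-valued with $V=V_{\rm per}+V_{\rm def}$, where $V_{\rm per}(x+1)=V_{\rm per}(x)$ for all $x$ and $V_{\rm def}(x)=0$ for $|x|>\rho$, for some $\rho\ge 0$; no parity of $V$ is assumed. Let $E>0$ and let $0\neq\Phi\in L^2(\mathbb R)$ satisfy $-\Phi''+V\Phi=E\Phi$. Normalize $\Phi$ so that $\Phi(0)=1$ if $\Phi(0)\ne0$, and $\Phi'(0)=1$ if $\Phi(0)=0$. For $\zeta=(w,z)\in\mathbb C^2$ let $u_\zeta$ be the solution of $-u''+Vu=zu$ with $(u,u')(0)=(1,w)$ if $\Phi(0)\neq0$, and $(u,u')(0)=(-w,1)$ if $\Phi(0)=0$. Let $\eta=(\Phi'(0),E)$ if $\Phi(0)\ne0$ and $\eta=(0,E)$ if $\Phi(0)=0$. For $M>0$ put $$\Theta^\pm(\zeta)=u_\zeta'(\pm M)\mp i\sqrt z\,u_\zeta(\pm M),\qquad \vec\Theta=(\Theta^+,\Theta^-),$$ with the principal square root; the equations $\Theta^\pm(\zeta)=0$ are the outgoing conditions at $\pm M$. Let $\mathcal N=\partial_w\Theta^+\partial_z\Theta^--\partial_z\Theta^+\partial_w\Theta^-$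 and $$\Xi=\frac1{\mathcal N(\eta)}\begin{pmatrix}\partial_z\Theta^-(\eta)&-\partial_z\Theta^+(\eta)\\-\partial_w\Theta^-(\eta)&\partial_w\Theta^+(\eta)\end{pmatrix},$$ the inverse of the Jacobian matrix of $\vec\Theta$ at $\eta$. Let $H_{\rm trunc}=-\frac{d^2}{dx^2}+V_{\rm trunc}$ with $V_{\rm trunc}=V$ on $[-M,M]$ and $V_{\rm trunc}=0$ elsewhere. A number $z$ with $\operatorname{Re}z>0$, $\operatorname{Im}z<0$ is called a resonance of $H_{\rm trunc}$ if $-\psi''+V_{\rm trunc}\psi=z\psi$ has a nonzero $C^1$ solution $\psi$ (equation in the integrated, equivalently almost everywhere, sense) that is a multiple of $e^{i\sqrt z\,x}$ for all large $x$ and a multiple of $e^{-i\sqrt z\,x}$ for all large $-x$. Then the equation $-\psi''+V_{\rm per}\psi=E\psi$ has a real characteristic multiplier $\lambda$ with $|\lambda|=e^{\kappa}$, $\kappa>0$, and for every $k\in(0,\kappa]$ there are $M_0>\rho$ and $C>0$ such that for all $M\ge M_0$: 1. $\vec\Theta$ is differentiable at $\eta$, $\mathcal N(\eta)\neq0$,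 and $\vec\Theta$ has a unique root $\zeta^*=(w^*,z^*)$ in the ball $\Omega_M=\{\zeta\in\mathbb C^2: |\zeta-\eta|\le M^{-2}e^{-kM}\}$; 2. if $k<\kappa$, then $|\zeta^*-(\eta-\Xi\,\vec\Theta(\eta))|\le C e^{-4kM}$; moreover, for every $k\in(0,\kappa]$, $|\zeta^*-(\eta-\Xi\,\vec\Theta(\eta))|\le C M e^{-4\kappa M}$; 3. $z^*$ is a resonance of $H_{\rm trunc}$ (in particular $\operatorname{Re}z^*>0$ and $\operatorname{Im}z^*<0$). -/

import Mathlib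

open MeasureTheory

noncomputable section

namespace TruncatedDefect

/-- Points `ζ = (w, z)` of `ℂ²`, with the Euclidean norm: `ζ 0 = w`, `ζ 1 = z`. -/
abbrev C2 : Type := EuclideanSpace ℂ (Fin 2)

/-- Eventually periodic potentials: `V` is smooth, `V = Vper + Vdef`, `Vper` has period `1`
and `Vdef` vanishes for `|x| > ρ`. -/
structure IsEventuallyPeriodic (V Vper Vdef : ℝ → ℝ) (ρ : ℝ) : Prop where
  smooth : ContDiff ℝ ((⊤ : ℕ∞) : WithTop ℕ∞) V
  decomp : ∀ x, V x = Vper x + Vdef x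
  periodic : ∀ x, Vper (x + 1) = Vper x
  supp : ∀ x, ρ < |x| → Vdef x = 0

/-- `u` is a (classical, complex-valued) solution on `ℝ` of `-u'' + V u = z u`. -/
def IsSolution (V : ℝ → ℝ) (z : ℂ) (u : ℝ → ℂ) : Prop :=
  ContDiff ℝ 2 u ∧ ∀ x, -deriv (deriv u) x + (V x : ℂ) * u x = z * u x

/-- A bound state of `H = -d²/dx² + V` with eigenvalue `E`: a nonzero square integrable
solution of `H Φ = E Φ`. -/
structure IsBoundState (V : ℝ → ℝ) (E : ℝ) (Φ : ℝ → ℂ) : Prop where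
  sol : IsSolution V (E : ℂ) Φ
  memLp : MemLp Φ 2 volume
  ne_zero : Φ ≠ 0

/-- The solution of `-u'' + V u = z u`, `u 0 = a`, `u' 0 = b`
(for continuous `V` it exists on all of `ℝ` and is unique). -/
def ivp (V : ℝ → ℝ) (z a b : ℂ) : ℝ → ℂ :=
  Classical.epsilon fun u : ℝ → ℂ => IsSolution V z u ∧ u 0 = a ∧ deriv u 0 = b

open scoped Classical in
/-- The solution `u_ζ`, `ζ = (w, z)`, of `-u'' + V u = z u` with initial data
`(u, u')(0) = (1, w)` if `Φ 0 ≠ 0` and `(u, u')(0) = (-w, 1)` if `Φ 0 = 0`. -/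
def uSol (V : ℝ → ℝ) (Φ : ℝ → ℂ) (ζ : C2) : ℝ → ℂ :=
  if Φ 0 ≠ 0 then ivp V (ζ 1) 1 (ζ 0) else ivp V (ζ 1) (-(ζ 0)) 1

open scoped Classical in
/-- The base point `η = (w₀, E)`. If `Φ 0 ≠ 0` then `w₀ = Φ'(0) / Φ(0)`, which is `Φ'(0)` after
normalizing `Φ 0 = 1`; if `Φ 0 = 0` then `w₀ = 0`. -/
def eta (Φ : ℝ → ℂ) (E : ℝ) : C2 :=
  !₂[if Φ 0 ≠ 0 then deriv Φ 0 / Φ 0 else 0, (E : ℂ)]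

/-- `Θ⁺(ζ) = u_ζ'(M) - i √z u_ζ(M)`; `Complex.sqrt` is the principal branch. -/
def ThetaPlus (V : ℝ → ℝ) (Φ : ℝ → ℂ) (M : ℝ) (ζ : C2) : ℂ :=
  deriv (uSol V Φ ζ) M - Complex.I * Complex.sqrt (ζ 1) * uSol V Φ ζ M

/-- `Θ⁻(ζ) = u_ζ'(-M) + i √z u_ζ(-M)`. -/
def ThetaMinus (V : ℝ → ℝ) (Φ : ℝ → ℂ) (M : ℝ) (ζ : C2) : ℂ :=
  deriv (uSol V Φ ζ) (-M) + Complex.I * Complex.sqrt (ζ 1) * uSol V Φ ζ (-M)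

/-- `Θ = (Θ⁺, Θ⁻) : ℂ² → ℂ²`. -/
def Theta (V : ℝ → ℝ) (Φ : ℝ → ℂ) (M : ℝ) (ζ : C2) : C2 :=
  !₂[ThetaPlus V Φ M ζ, ThetaMinus V Φ M ζ]

/-- The partial derivative `∂_w F` at `ζ`. -/
def dw (F : C2 → ℂ) (ζ : C2) : ℂ := deriv (fun w : ℂ => F !₂[w, ζ 1]) (ζ 0)

/-- The partial derivative `∂_z F` at `ζ`. -/
def dz (F : C2 → ℂ) (ζ : C2) : ℂ := deriv (fun z : ℂ => F !₂[ζ 0, z]) (ζ 1)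

/-- The Jacobian determinant `𝒩(ζ) = ∂_w Θ⁺ ∂_z Θ⁻ - ∂_z Θ⁺ ∂_w Θ⁻`. -/
def jacDet (V : ℝ → ℝ) (Φ : ℝ → ℂ) (M : ℝ) (ζ : C2) : ℂ :=
  dw (ThetaPlus V Φ M) ζ * dz (ThetaMinus V Φ M) ζ -
    dz (ThetaPlus V Φ M) ζ * dw (ThetaMinus V Φ M) ζ

/-- The matrix `Ξ`, the inverse of the Jacobian matrix of `Θ` at `ζ`. -/
def Xi (V : ℝ → ℝ) (Φ : ℝ → ℂ) (M : ℝ) (ζ : C2) : Matrix (Fin 2) (Fin 2) ℂ :=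
  (jacDet V Φ M ζ)⁻¹ •
    !![dz (ThetaMinus V Φ M) ζ, -dz (ThetaPlus V Φ M) ζ;
       -dw (ThetaMinus V Φ M) ζ, dw (ThetaPlus V Φ M) ζ]

/-- The first approximation `η - Ξ Θ(η)` of the root. -/
def newtonPoint (V : ℝ → ℝ) (Φ : ℝ → ℂ) (M : ℝ) (η : C2) : C2 :=
  η - WithLp.toLp 2 ((Xi V Φ M η).mulVec (WithLp.ofLp (Theta V Φ M η)))

/-- The closed ball `Ω_M` of radius `M⁻² e^{-k M}` about `η`. -/
def Omega (k M : ℝ) (η : C2) : Set C2 :=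
  Metric.closedBall η (1 / M ^ 2 * Real.exp (-(k * M)))

/-- `l` is a characteristic (Floquet) multiplier of `-ψ'' + Vper ψ = E ψ`. -/
def IsCharacteristicMultiplier (Vper : ℝ → ℝ) (E : ℝ) (l : ℝ) : Prop :=
  ∃ ψ : ℝ → ℂ, IsSolution Vper (E : ℂ) ψ ∧ ψ ≠ 0 ∧ ∀ x, ψ (x + 1) = (l : ℂ) * ψ x

/-- `κ` is positive and is the logarithm of the modulus of a real characteristic multiplier; the
product of the two multipliers is `1`, so this is the larger of the two moduli. -/
def IsFloquetExponent (Vper : ℝ → ℝ) (E κ : ℝ) : Prop :=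
  0 < κ ∧ ∃ l : ℝ, IsCharacteristicMultiplier Vper E l ∧ |l| = Real.exp κ

open scoped Classical in
/-- The truncated potential. -/
def Vtrunc (V : ℝ → ℝ) (M : ℝ) (x : ℝ) : ℝ := if |x| ≤ M then V x else 0

/-- `z` (with `Re z > 0`, `Im z < 0`) is a resonance of `-d²/dx² + W`, where `W` is bounded,
measurable and compactly supported: there is a resonant state, i.e. a nonzero outgoing solution
`ψ` of `-ψ'' + W ψ = z ψ`. As `W` may jump, `ψ` is `C¹` and the equation is written in integrated
form (equivalently, `ψ'` is locally absolutely continuous and the equation holds almost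
everywhere). -/
def IsResonance (W : ℝ → ℝ) (z : ℂ) : Prop :=
  0 < z.re ∧ z.im < 0 ∧
    ∃ ψ : ℝ → ℂ, ContDiff ℝ 1 ψ ∧ ψ ≠ 0 ∧
      (∀ x, deriv ψ x = deriv ψ 0 + ∫ t in (0 : ℝ)..x, ((W t : ℂ) - z) * ψ t) ∧
      ∃ (R : ℝ) (a b : ℂ),
        (∀ x, R < x → ψ x = a * Complex.exp (Complex.I * Complex.sqrt z * x)) ∧
        (∀ x, x < -R → ψ x = b * Complex.exp (-(Complex.I * Complex.sqrt z * x)))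

end TruncatedDefect

end

/-! Square integrable solutions on a half line where the potential is periodic have vanishing
Wronskian, so there they are collinear. Hence the bound state is a multiple of a real solution `φ`,
translation by the period multiplies `φ` by some `l` with `|l| < 1` far to the right, and likewise
far to the left. A real `ψ` with Wronskian 1 against `φ` grows at most at the inverse rate. The rate
`κ` is the same on both sides, because both multipliers belong to the one equation with potential
`Vper` (`IsBoundState.exists_dichotomy`).

Put `s = w - w₀` and `ε = z - E`. The solution `u_ζ` has the initial data of `φ + s ψ`, and
variation of parameters expands it in powers of `ε`. Divide `Θ⁺` by `θ`, the value of the boundary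
functional on `ψ` at energy `E`; the Wronskian forces `|θ|` to be at least a constant times
`e^{κM}`. This gives `g₀(ε) + s g₁(ε)`, analytic for `|ε| < δ/M`, with `g₁(0) = 1`, `g₀(0) =
O(e^{-2κM})` and `g₀'(0) = -∫₀^M φ² + O(M e^{-2κM})` (`IsDichotomy.exists_expansion`). By reflection
`Θ⁻` has the same form, with derivative close to `+∫_{-M}^0 φ²`. The normalized Jacobian has rows
`(1, p)` and `(1, q)`, and its determinant `q - p` is close to `∫_{-M}^M φ²`, hence bounded away
from zero.

Cauchy estimates on the disc of radius `δ/M` bound the second order remainder by a constant times `M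
|(s, ε)|²`, while the Newton step is `O(e^{-2κM})`. A contraction argument
(`IsExpansion.exists_root`) then gives a unique root in the ball of radius `M⁻² e^{-kM}`, at
distance `O(M e^{-4κM})` from the Newton point. Dividing the two equations by `θ` and `θ'` does not
change that point.

At the root, `u_ζ` continues outside `[-M, M]` by outgoing exponentials to a `C¹` resonant state.
The flux `Im(u' ū)` forces `Im z < 0` (`im_neg_of_outgoing`). -/

open MeasureTheory

noncomputable section

namespace TruncatedDefect

/-! ### Volterra series for planar linear systems with a complex parameter. -/

/-- Iterated integrals (`n`-th order coefficients in `ε`) of the linear system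
`a' = ε (p a + q b)`, `b' = ε (r a + s b)` with initial data `(a₀, b₀)` at `0`. -/
def volterraIter (p q r s : ℝ → ℂ) (a₀ b₀ : ℂ) : ℕ → (ℝ → ℂ) × (ℝ → ℂ)
  | 0 => (fun _ => a₀, fun _ => b₀)
  | n + 1 =>
    (fun x => ∫ t in (0 : ℝ)..x,
        (p t * (volterraIter p q r s a₀ b₀ n).1 t + q t * (volterraIter p q r s a₀ b₀ n).2 t),
      fun x => ∫ t in (0 : ℝ)..x,
        (r t * (volterraIter p q r s a₀ b₀ n).1 t + s t * (volterraIter p q r s a₀ b₀ n).2 t))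

/-- First component of the solution of `a' = ε (p a + q b)`, `b' = ε (r a + s b)`. -/
def volterraFst (p q r s : ℝ → ℂ) (a₀ b₀ ε : ℂ) (x : ℝ) : ℂ :=
  ∑' n : ℕ, ε ^ n * (volterraIter p q r s a₀ b₀ n).1 x

/-- Second component of the solution of `a' = ε (p a + q b)`, `b' = ε (r a + s b)`. -/
def volterraSnd (p q r s : ℝ → ℂ) (a₀ b₀ ε : ℂ) (x : ℝ) : ℂ :=
  ∑' n : ℕ, ε ^ n * (volterraIter p q r s a₀ b₀ n).2 x

theorem hasDerivAt_primitive {f : ℝ → ℂ} (hf : Continuous f) (x : ℝ) :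
    HasDerivAt (fun x => ∫ t in (0 : ℝ)..x, f t) (f x) x :=
  intervalIntegral.integral_hasDerivAt_right (hf.intervalIntegrable _ _)
    hf.aestronglyMeasurable.stronglyMeasurableAtFilter hf.continuousAt

theorem norm_primitive_le_pow {f : ℝ → ℂ} {C : ℝ} {n : ℕ} {x : ℝ}
    (h : ∀ t, |t| ≤ |x| → ‖f t‖ ≤ C * |t| ^ n) :
    ‖∫ t in (0 : ℝ)..x, f t‖ ≤ C * (|x| ^ (n + 1) / (n + 1)) := by
  rw [intervalIntegral.norm_intervalIntegral_eq]
  have h1 : ∫ t in Set.uIoc 0 x, C * |t| ^ n = C * (|x| ^ (n + 1) / (n + 1)) := by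
    have := integral_pow_abs_sub_uIoc (a := (0 : ℝ)) (b := x) n
    simp only [sub_zero] at this
    rw [integral_const_mul, this]
  rw [← h1]
  refine norm_integral_le_of_norm_le ?_ ?_
  · have : Continuous fun t : ℝ => C * |t| ^ n := by fun_prop
    exact (this.integrableOn_uIcc).mono_set Set.uIoc_subset_uIcc
  · refine (ae_restrict_iff' measurableSet_uIoc).2 (Filter.Eventually.of_forall fun t ht => h t ?_)
    rcases le_total 0 x with hx | hx
    · rw [Set.uIoc_of_le hx] at ht
      rw [abs_of_pos ht.1, abs_of_nonneg hx]; exact ht.2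
    · rw [Set.uIoc_of_ge hx] at ht
      rw [abs_of_nonpos ht.2, abs_of_nonpos hx]; linarith [ht.1]

section Volterra

variable {p q r s : ℝ → ℂ}

theorem continuous_volterraIter (hp : Continuous p) (hq : Continuous q) (hr : Continuous r)
    (hs : Continuous s) (a₀ b₀ : ℂ) (n : ℕ) :
    Continuous (volterraIter p q r s a₀ b₀ n).1 ∧ Continuous (volterraIter p q r s a₀ b₀ n).2 := by
  induction n with
  | zero => exact ⟨continuous_const, continuous_const⟩
  | succ n ih =>
    obtain ⟨h1, h2⟩ := ih
    exact ⟨continuous_iff_continuousAt.2 fun x =>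
        (hasDerivAt_primitive ((hp.mul h1).add (hq.mul h2)) x).continuousAt,
      continuous_iff_continuousAt.2 fun x =>
        (hasDerivAt_primitive ((hr.mul h1).add (hs.mul h2)) x).continuousAt⟩

/-- Each iteration integrates two terms with coefficients at most `L`, whence the factor `2L`;
integrating `|t|^n` supplies the factorial. The series in `ε` is therefore entire. -/
theorem norm_volterraIter_le {R L K : ℝ} {a₀ b₀ : ℂ}
    (hL : ∀ t, |t| ≤ R → ‖p t‖ ≤ L ∧ ‖q t‖ ≤ L ∧ ‖r t‖ ≤ L ∧ ‖s t‖ ≤ L)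
    (ha : ‖a₀‖ ≤ K) (hb : ‖b₀‖ ≤ K) (n : ℕ) {x : ℝ} (hx : |x| ≤ R) :
    ‖(volterraIter p q r s a₀ b₀ n).1 x‖ ≤ K * ((2 * L * |x|) ^ n / n.factorial) ∧
    ‖(volterraIter p q r s a₀ b₀ n).2 x‖ ≤ K * ((2 * L * |x|) ^ n / n.factorial) := by
  induction n generalizing x with
  | zero => simpa [volterraIter] using ⟨ha, hb⟩
  | succ n ih =>
    have key : ∀ c d : ℝ → ℂ, (∀ t, |t| ≤ R → ‖c t‖ ≤ L ∧ ‖d t‖ ≤ L) →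
        ‖∫ t in (0 : ℝ)..x, (c t * (volterraIter p q r s a₀ b₀ n).1 t +
          d t * (volterraIter p q r s a₀ b₀ n).2 t)‖
          ≤ K * ((2 * L * |x|) ^ (n + 1) / (n + 1).factorial) := by
      intro c d hcd
      have : K * ((2 * L * |x|) ^ (n + 1) / (n + 1).factorial) =
          (2 * L * K * ((2 * L) ^ n / n.factorial)) * (|x| ^ (n + 1) / (n + 1)) := by
        rw [Nat.factorial_succ]; push_cast
        field_simp; ring
      rw [this]
      refine norm_primitive_le_pow fun t ht => ?_
      obtain ⟨h1, h2⟩ := ih (ht.trans hx)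
      obtain ⟨h3, h4⟩ := hcd t (ht.trans hx)
      have hL0 : 0 ≤ L := (norm_nonneg _).trans h3
      calc _ ≤ ‖c t‖ * ‖(volterraIter p q r s a₀ b₀ n).1 t‖ +
            ‖d t‖ * ‖(volterraIter p q r s a₀ b₀ n).2 t‖ :=
            (norm_add_le _ _).trans_eq (by rw [norm_mul, norm_mul])
        _ ≤ L * (K * ((2 * L * |t|) ^ n / n.factorial)) +
            L * (K * ((2 * L * |t|) ^ n / n.factorial)) := by gcongr
        _ = _ := by rw [mul_pow (2 * L)]; ring
    exact ⟨key p q fun t ht => ⟨(hL t ht).1, (hL t ht).2.1⟩,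
      key r s fun t ht => (hL t ht).2.2⟩

theorem exists_bound_of_continuous (hp : Continuous p) (hq : Continuous q) (hr : Continuous r)
    (hs : Continuous s) (R : ℝ) :
    ∃ L : ℝ, 0 ≤ L ∧ ∀ t, |t| ≤ R → ‖p t‖ ≤ L ∧ ‖q t‖ ≤ L ∧ ‖r t‖ ≤ L ∧ ‖s t‖ ≤ L := by
  have hc : Continuous fun t => ‖p t‖ + ‖q t‖ + ‖r t‖ + ‖s t‖ := by fun_prop
  obtain ⟨L, hL⟩ := (isCompact_Icc (a := -R) (b := R)).bddAbove_image hc.continuousOn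
  refine ⟨max L 0, le_max_right _ _, fun t ht => ?_⟩
  have h : ‖p t‖ + ‖q t‖ + ‖r t‖ + ‖s t‖ ≤ max L 0 :=
    (hL (Set.mem_image_of_mem _ (abs_le.1 ht))).trans (le_max_left L 0)
  have := norm_nonneg (p t)
  have := norm_nonneg (q t)
  have := norm_nonneg (r t)
  have := norm_nonneg (s t)
  exact ⟨by linarith, by linarith, by linarith, by linarith⟩

theorem exists_summable_bound (hp : Continuous p) (hq : Continuous q) (hr : Continuous r)
    (hs : Continuous s) (a₀ b₀ : ℂ) (R ρ : ℝ) (hρ : 0 ≤ ρ) :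
    ∃ u : ℕ → ℝ, Summable u ∧ ∀ n x, |x| ≤ R → ∀ ε : ℂ, ‖ε‖ ≤ ρ →
      ‖ε ^ n * (volterraIter p q r s a₀ b₀ n).1 x‖ ≤ u n ∧
      ‖ε ^ n * (volterraIter p q r s a₀ b₀ n).2 x‖ ≤ u n := by
  obtain ⟨L, hL0, hL⟩ := exists_bound_of_continuous hp hq hr hs R
  refine ⟨fun n => max ‖a₀‖ ‖b₀‖ * ((ρ * (2 * L * R)) ^ n / n.factorial),
    (Real.summable_pow_div_factorial _).mul_left _, fun n x hx ε hε => ?_⟩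
  have h := norm_volterraIter_le hL (le_max_left ‖a₀‖ ‖b₀‖) (le_max_right ‖a₀‖ ‖b₀‖) n hx
  have h2 : ‖ε‖ ^ n * (max ‖a₀‖ ‖b₀‖ * ((2 * L * |x|) ^ n / n.factorial)) ≤
      max ‖a₀‖ ‖b₀‖ * ((ρ * (2 * L * R)) ^ n / n.factorial) := by
    calc _ ≤ ρ ^ n * (max ‖a₀‖ ‖b₀‖ * ((2 * L * R) ^ n / n.factorial)) := by gcongr
      _ = _ := by rw [mul_pow ρ]; ring
  simp only [norm_mul, norm_pow]
  exact ⟨(mul_le_mul_of_nonneg_left h.1 (by positivity)).trans h2,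
    (mul_le_mul_of_nonneg_left h.2 (by positivity)).trans h2⟩

theorem summable_volterra (hp : Continuous p) (hq : Continuous q) (hr : Continuous r)
    (hs : Continuous s) (a₀ b₀ ε : ℂ) (x : ℝ) :
    Summable (fun n => ε ^ n * (volterraIter p q r s a₀ b₀ n).1 x) ∧
    Summable (fun n => ε ^ n * (volterraIter p q r s a₀ b₀ n).2 x) := by
  obtain ⟨u, hu, h⟩ := exists_summable_bound hp hq hr hs a₀ b₀ |x| ‖ε‖ (norm_nonneg _)
  exact ⟨Summable.of_norm_bounded hu fun n => (h n x le_rfl ε le_rfl).1,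
    Summable.of_norm_bounded hu fun n => (h n x le_rfl ε le_rfl).2⟩

theorem volterra_zero (a₀ b₀ ε : ℂ) :
    volterraFst p q r s a₀ b₀ ε 0 = a₀ ∧ volterraSnd p q r s a₀ b₀ ε 0 = b₀ := by
  constructor
  · rw [volterraFst, tsum_eq_single 0]
    · simp [volterraIter]
    · rintro (_ | n) hn
      · exact absurd rfl hn
      · simp [volterraIter]
  · rw [volterraSnd, tsum_eq_single 0]
    · simp [volterraIter]
    · rintro (_ | n) hn
      · exact absurd rfl hn
      · simp [volterraIter]

theorem differentiable_volterra (hp : Continuous p) (hq : Continuous q) (hr : Continuous r)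
    (hs : Continuous s) (a₀ b₀ : ℂ) (x : ℝ) :
    Differentiable ℂ (fun ε => volterraFst p q r s a₀ b₀ ε x) ∧
    Differentiable ℂ (fun ε => volterraSnd p q r s a₀ b₀ ε x) := by
  have key : ∀ ε₀ : ℂ, ∃ u : ℕ → ℝ, Summable u ∧ ∀ n, ∀ ε ∈ Metric.ball (0 : ℂ) (‖ε₀‖ + 1),
      ‖ε ^ n * (volterraIter p q r s a₀ b₀ n).1 x‖ ≤ u n ∧
      ‖ε ^ n * (volterraIter p q r s a₀ b₀ n).2 x‖ ≤ u n := fun ε₀ => by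
    obtain ⟨u, hu, h⟩ := exists_summable_bound hp hq hr hs a₀ b₀ |x| (‖ε₀‖ + 1)
      (by positivity)
    exact ⟨u, hu, fun n ε hε => h n x le_rfl ε (by simpa using (Metric.mem_ball.1 hε).le)⟩
  constructor <;> intro ε₀ <;> obtain ⟨u, hu, h⟩ := key ε₀ <;>
    have hmem : Metric.ball (0 : ℂ) (‖ε₀‖ + 1) ∈ nhds ε₀ :=
      Metric.isOpen_ball.mem_nhds (by simp)
  · exact (Complex.differentiableOn_tsum_of_summable_norm hu (fun n => by fun_prop)
      Metric.isOpen_ball fun n ε hε => (h n ε hε).1).differentiableAt hmem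
  · exact (Complex.differentiableOn_tsum_of_summable_norm hu (fun n => by fun_prop)
      Metric.isOpen_ball fun n ε hε => (h n ε hε).2).differentiableAt hmem

/-- Stated for an arbitrary row `(c, d)` of the system, so that one termwise differentiation serves
both components. -/
theorem hasDerivAt_tsum_primitive {c d : ℝ → ℂ} (hp : Continuous p) (hq : Continuous q)
    (hr : Continuous r) (hs : Continuous s) (hc : Continuous c) (hd : Continuous d)
    (a₀ b₀ ε : ℂ) (f : ℕ → ℝ → ℂ) (f₀ : ℂ) (hf0 : f 0 = fun _ => f₀)
    (hf : ∀ n x, f (n + 1) x = ∫ t in (0 : ℝ)..x, (c t * (volterraIter p q r s a₀ b₀ n).1 t +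
          d t * (volterraIter p q r s a₀ b₀ n).2 t)) (x : ℝ) :
    HasDerivAt (fun x => ∑' n, ε ^ n * f n x)
      (ε * (c x * volterraFst p q r s a₀ b₀ ε x + d x * volterraSnd p q r s a₀ b₀ ε x)) x := by
  obtain ⟨L, hL0, hL⟩ := exists_bound_of_continuous hc hd hc hd (|x| + 1)
  obtain ⟨u, hu, h⟩ := exists_summable_bound hp hq hr hs a₀ b₀ (|x| + 1) ‖ε‖
    (norm_nonneg _)
  -- The zeroth iterate is constant, so the differentiated series starts at index 1 and a factor `ε`
  -- comes out.
  set f' : ℕ → ℝ → ℂ := fun n x => match n with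
    | 0 => 0
    | n + 1 => ε ^ (n + 1) * (c x * (volterraIter p q r s a₀ b₀ n).1 x +
          d x * (volterraIter p q r s a₀ b₀ n).2 x) with hf'
  set w : ℕ → ℝ := fun n => match n with
    | 0 => 0
    | n + 1 => ‖ε‖ * (L * u n + L * u n) with hw
  have hwsum : Summable w := by
    rw [← summable_nat_add_iff 1]
    exact (((hu.mul_left L).add (hu.mul_left L)).mul_left _)
  have hcont := continuous_volterraIter hp hq hr hs a₀ b₀
  have hder : ∀ n, ∀ y, HasDerivAt (fun x => ε ^ n * f n x) (f' n y) y := by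
    rintro (_ | n) y
    · simp only [hf0, hf']
      exact hasDerivAt_const _ _
    · have e : f (n + 1) = _ := funext (hf n)
      rw [e]
      exact (hasDerivAt_primitive ((hc.mul (hcont n).1).add (hd.mul (hcont n).2)) y).const_mul _
  have hmain := hasDerivAt_tsum_of_isPreconnected (t := Metric.ball (0 : ℝ) (|x| + 1)) (y₀ := 0)
    (y := x) hwsum Metric.isOpen_ball (convex_ball _ _).isPreconnected
    (fun n y _ => hder n y) ?_ (by simp; positivity) ?_ (by simp)
  · refine hmain.congr_deriv ?_
    have hs1 := summable_volterra hp hq hr hs a₀ b₀ ε x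
    rw [Summable.tsum_eq_zero_add]
    · symm
      simp only [hf', volterraFst, volterraSnd]
      rw [← tsum_mul_left, ← tsum_mul_left,
        ← (hs1.1.mul_left (c x)).tsum_add (hs1.2.mul_left (d x)), ← tsum_mul_left, zero_add]
      congr 1; ext n; ring
    · rw [← summable_nat_add_iff 1]
      refine (((hs1.1.mul_left (c x)).add (hs1.2.mul_left (d x))).mul_left ε).congr fun n => ?_
      simp only [hf']; ring
  · rintro (_ | n) y hy
    · simp [hf', hw]
    · have hy' : |y| ≤ |x| + 1 := by simpa using (Metric.mem_ball.1 hy).le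
      obtain ⟨h1, h2⟩ := h n y hy' ε le_rfl
      obtain ⟨h3, h4, -⟩ := hL y hy'
      have e : f' (n + 1) y = ε * (c y * (ε ^ n * (volterraIter p q r s a₀ b₀ n).1 y) +
          d y * (ε ^ n * (volterraIter p q r s a₀ b₀ n).2 y)) := by
        simp only [hf']; ring
      rw [e, norm_mul]
      refine mul_le_mul_of_nonneg_left ((norm_add_le _ _).trans ?_) (norm_nonneg _)
      rw [norm_mul, norm_mul (d y)]
      gcongr
  · refine summable_of_ne_finset_zero (s := {0}) ?_
    rintro (_ | n) hn
    · simp at hn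
    · simp [hf]

theorem hasDerivAt_volterra (hp : Continuous p) (hq : Continuous q) (hr : Continuous r)
    (hs : Continuous s) (a₀ b₀ ε : ℂ) (x : ℝ) :
    HasDerivAt (volterraFst p q r s a₀ b₀ ε)
      (ε * (p x * volterraFst p q r s a₀ b₀ ε x + q x * volterraSnd p q r s a₀ b₀ ε x)) x ∧
    HasDerivAt (volterraSnd p q r s a₀ b₀ ε)
      (ε * (r x * volterraFst p q r s a₀ b₀ ε x + s x * volterraSnd p q r s a₀ b₀ ε x)) x :=
  ⟨hasDerivAt_tsum_primitive hp hq hr hs hp hq a₀ b₀ ε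
      (fun n => (volterraIter p q r s a₀ b₀ n).1) a₀ rfl (fun _ _ => rfl) x,
    hasDerivAt_tsum_primitive hp hq hr hs hr hs a₀ b₀ ε
      (fun n => (volterraIter p q r s a₀ b₀ n).2) b₀ rfl (fun _ _ => rfl) x⟩

end Volterra

/-! ### Second order equations in first order form: Wronskians, existence, uniqueness. -/

/-- `u' = v` and `v' = Q u` on the set `S`: the first order form of `u'' = Q u`. -/
def IsSolOn {𝕜 : Type*} [RCLike 𝕜] (S : Set ℝ) (Q u v : ℝ → 𝕜) : Prop :=
  ∀ x ∈ S, HasDerivAt u (v x) x ∧ HasDerivAt v (Q x * u x) x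

section Wronskian

variable {𝕜 : Type*} [RCLike 𝕜] {Q u v f g : ℝ → 𝕜} {S : Set ℝ}

theorem IsSolOn.mono {T : Set ℝ} (h : IsSolOn S Q u v) (hT : T ⊆ S) : IsSolOn T Q u v :=
  fun x hx => h x (hT hx)

theorem IsSolOn.linearCombination (h : IsSolOn S Q u v) (h' : IsSolOn S Q f g) (a b : 𝕜) :
    IsSolOn S Q (fun x => a * u x + b * f x) (fun x => a * v x + b * g x) := fun x hx =>
  ⟨((h x hx).1.const_mul a).add ((h' x hx).1.const_mul b),
    (((h x hx).2.const_mul a).add ((h' x hx).2.const_mul b)).congr_deriv (by ring)⟩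

theorem IsSolOn.const_mul (h : IsSolOn S Q u v) (a : 𝕜) :
    IsSolOn S Q (fun x => a * u x) (fun x => a * v x) := fun x hx =>
  ⟨(h x hx).1.const_mul a, ((h x hx).2.const_mul a).congr_deriv (by ring)⟩

theorem IsSolOn.comp_add_const {T : Set ℝ} {Q' : ℝ → 𝕜} (h : IsSolOn S Q u v) (c : ℝ)
    (hT : ∀ x ∈ T, x + c ∈ S ∧ Q (x + c) = Q' x) :
    IsSolOn T Q' (fun x => u (x + c)) (fun x => v (x + c)) := fun x hx => by
  obtain ⟨h1, h2⟩ := h (x + c) (hT x hx).1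
  exact ⟨h1.comp_add_const x c, by simpa [(hT x hx).2] using h2.comp_add_const x c⟩

theorem IsSolOn.comp_neg {T : Set ℝ} {Q' : ℝ → 𝕜} (h : IsSolOn S Q u v)
    (hT : ∀ x ∈ T, -x ∈ S ∧ Q (-x) = Q' x) :
    IsSolOn T Q' (fun x => u (-x)) (fun x => -v (-x)) := fun x hx => by
  obtain ⟨h1, h2⟩ := h (-x) (hT x hx).1
  have h1' := h1.scomp x (hasDerivAt_neg x)
  have h2' := (h2.scomp x (hasDerivAt_neg x)).neg
  rw [(hT x hx).2] at h2'
  exact ⟨h1'.congr_deriv (by simp), h2'.congr_deriv (by simp)⟩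

theorem IsSolOn.wronskian_eq (h : IsSolOn S Q u v) (h' : IsSolOn S Q f g) (hS : IsOpen S)
    (hS' : IsPreconnected S) {x y : ℝ} (hx : x ∈ S) (hy : y ∈ S) :
    u x * g x - v x * f x = u y * g y - v y * f y := by
  have hd : ∀ x ∈ S, HasDerivAt (fun x => u x * g x - v x * f x) 0 x := fun x hx =>
    (((h x hx).1.mul (h' x hx).2).sub ((h x hx).2.mul (h' x hx).1)).congr_deriv (by ring)
  exact hS.is_const_of_deriv_eq_zero hS'
    (fun x hx => (hd x hx).differentiableAt.differentiableWithinAt)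
    (fun x hx => (hd x hx).deriv) hx hy

theorem IsSolOn.continuous (h : IsSolOn Set.univ Q u v) : Continuous u ∧ Continuous v :=
  ⟨continuous_iff_continuousAt.2 fun x => (h x trivial).1.continuousAt,
    continuous_iff_continuousAt.2 fun x => (h x trivial).2.continuousAt⟩

end Wronskian

theorem exists_isSolOn {Q : ℝ → ℂ} (hQ : Continuous Q) (x₀ : ℝ) (a b : ℂ) :
    ∃ u v : ℝ → ℂ, IsSolOn Set.univ Q u v ∧ u x₀ = a ∧ v x₀ = b := by
  have hQ' : Continuous fun x => Q (x + x₀) := by fun_prop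
  have h := hasDerivAt_volterra (continuous_const (y := (0 : ℂ))) (continuous_const (y := (1 : ℂ)))
    hQ' (continuous_const (y := (0 : ℂ))) a b 1
  have h0 := volterra_zero (p := fun _ => (0 : ℂ)) (q := fun _ => (1 : ℂ))
    (r := fun x => Q (x + x₀)) (s := fun _ => (0 : ℂ)) a b 1
  have hsol : IsSolOn Set.univ (fun x => Q (x + x₀)) (volterraFst (fun _ => 0) (fun _ => 1)
      (fun x => Q (x + x₀)) (fun _ => 0) a b 1) (volterraSnd (fun _ => 0) (fun _ => 1)
      (fun x => Q (x + x₀)) (fun _ => 0) a b 1) := fun x _ =>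
    ⟨by simpa using (h x).1, by simpa using (h x).2⟩
  exact ⟨_, _, hsol.comp_add_const (-x₀) (fun x _ => ⟨trivial, by simp⟩), by simp [h0], by simp [h0]⟩

theorem IsSolOn.re {Q : ℝ → ℝ} {u v : ℝ → ℂ} {S : Set ℝ} (h : IsSolOn S (fun x => (Q x : ℂ)) u v) :
    IsSolOn S Q (fun x => (u x).re) (fun x => (v x).re) := fun x hx =>
  ⟨Complex.reCLM.hasFDerivAt.comp_hasDerivAt x (h x hx).1,
    (Complex.reCLM.hasFDerivAt.comp_hasDerivAt x (h x hx).2).congr_deriv (by simp)⟩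

theorem IsSolOn.im {Q : ℝ → ℝ} {u v : ℝ → ℂ} {S : Set ℝ} (h : IsSolOn S (fun x => (Q x : ℂ)) u v) :
    IsSolOn S Q (fun x => (u x).im) (fun x => (v x).im) := fun x hx =>
  ⟨Complex.imCLM.hasFDerivAt.comp_hasDerivAt x (h x hx).1,
    (Complex.imCLM.hasFDerivAt.comp_hasDerivAt x (h x hx).2).congr_deriv (by simp)⟩

theorem IsSolOn.ofReal {Q u v : ℝ → ℝ} {S : Set ℝ} (h : IsSolOn S Q u v) :
    IsSolOn S (fun x => (Q x : ℂ)) (fun x => (u x : ℂ)) (fun x => (v x : ℂ)) := fun x hx =>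
  ⟨(h x hx).1.ofReal_comp, by simpa using (h x hx).2.ofReal_comp⟩

theorem exists_isSolOn_real {Q : ℝ → ℝ} (hQ : Continuous Q) (x₀ : ℝ) (a b : ℝ) :
    ∃ u v : ℝ → ℝ, IsSolOn Set.univ Q u v ∧ u x₀ = a ∧ v x₀ = b := by
  obtain ⟨u, v, h, ha, hb⟩ := exists_isSolOn (Complex.continuous_ofReal.comp hQ) x₀ a b
  exact ⟨_, _, IsSolOn.re h, by simp [ha], by simp [hb]⟩

/-- The difference of the two solutions has zero Wronskian at `x₀` with every solution, hence also
at `x`. Test solutions with data `(0, 1)` and `(1, 0)` at `x` read off its value and its derivative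
there. -/
theorem IsSolOn.eq_of_eq {Q u v f g : ℝ → ℂ} {S : Set ℝ} (hQ : Continuous Q)
    (h : IsSolOn S Q u v) (h' : IsSolOn S Q f g) (hS : IsOpen S) (hS' : IsPreconnected S)
    {x₀ x : ℝ} (hx₀ : x₀ ∈ S) (hx : x ∈ S) (hu : u x₀ = f x₀) (hv : v x₀ = g x₀) :
    u x = f x ∧ v x = g x := by
  have hw := h.linearCombination h' 1 (-1)
  constructor
  · obtain ⟨c, d, hcd, hc, hd⟩ := exists_isSolOn hQ x 0 1
    have := hw.wronskian_eq (hcd.mono (Set.subset_univ _)) hS hS' hx hx₀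
    simp only [hc, hd, hu, hv] at this
    linear_combination this
  · obtain ⟨c, d, hcd, hc, hd⟩ := exists_isSolOn hQ x 1 0
    have := hw.wronskian_eq (hcd.mono (Set.subset_univ _)) hS hS' hx hx₀
    simp only [hc, hd, hu, hv] at this
    linear_combination -this

theorem IsSolOn.eq_of_eq_real {Q u v f g : ℝ → ℝ} {S : Set ℝ} (hQ : Continuous Q)
    (h : IsSolOn S Q u v) (h' : IsSolOn S Q f g) (hS : IsOpen S) (hS' : IsPreconnected S)
    {x₀ x : ℝ} (hx₀ : x₀ ∈ S) (hx : x ∈ S) (hu : u x₀ = f x₀) (hv : v x₀ = g x₀) :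
    u x = f x ∧ v x = g x := by
  have := h.ofReal.eq_of_eq (Complex.continuous_ofReal.comp hQ) h'.ofReal hS hS' hx₀ hx
    (by rw [hu]) (by rw [hv])
  exact_mod_cast this

theorem IsSolution.isSolOn {V : ℝ → ℝ} {z : ℂ} {u : ℝ → ℂ} (h : IsSolution V z u) :
    IsSolOn Set.univ (fun x => (V x : ℂ) - z) u (deriv u) := fun x _ => by
  obtain ⟨h1, h2⟩ := h
  have h3 : ContDiff ℝ (1 + 1) u := by simpa [one_add_one_eq_two] using h1
  have h4 := (contDiff_succ_iff_deriv.1 h3).2.2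
  refine ⟨(h1.differentiable (by norm_num) x).hasDerivAt, ?_⟩
  exact ((h4.differentiable (by norm_num) x).hasDerivAt).congr_deriv (by linear_combination -h2 x)

theorem IsSolOn.isSolution {V : ℝ → ℝ} {z : ℂ} {u v : ℝ → ℂ} (hV : Continuous V)
    (h : IsSolOn Set.univ (fun x => (V x : ℂ) - z) u v) : IsSolution V z u ∧ deriv u = v := by
  have hd : deriv u = v := funext fun x => (h x trivial).1.deriv
  have hd2 : deriv v = fun x => ((V x : ℂ) - z) * u x := funext fun x => (h x trivial).2.deriv
  have hu := h.continuous.1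
  refine ⟨⟨?_, fun x => by rw [hd, hd2]; ring⟩, hd⟩
  have h1 : ContDiff ℝ 1 v := by
    rw [contDiff_one_iff_deriv, hd2]
    exact ⟨fun x => (h x trivial).2.differentiableAt, by fun_prop⟩
  have h2 : ContDiff ℝ (1 + 1) u := by
    rw [contDiff_succ_iff_deriv, hd]
    exact ⟨fun x => (h x trivial).1.differentiableAt, by simp, h1⟩
  simpa [one_add_one_eq_two] using h2

/-- After division by `|μ|^x` the modulus of `f` is 1-periodic beyond `R`, so its supremum on `[0,
∞)` is attained on a compact interval. -/
theorem exists_bound_of_eventually_quasiperiodic {f : ℝ → ℝ} {μ R : ℝ} (hf : Continuous f)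
    (hμ : μ ≠ 0) (h : ∀ x, R < x → f (x + 1) = μ * f x) :
    ∃ C : ℝ, 0 < C ∧ ∀ x, 0 ≤ x → |f x| ≤ C * Real.exp (x * Real.log |μ|) := by
  set g : ℝ → ℝ := fun x => |f x| * Real.exp (-(x * Real.log |μ|)) with hg
  have hgc : Continuous g := by fun_prop
  obtain ⟨C, hC⟩ := (isCompact_Icc (a := (0 : ℝ)) (b := max R 0 + 1)).bddAbove_image hgc.continuousOn
  have hstep : ∀ x, R < x → g (x + 1) = g x := fun x hx => by
    simp only [hg]
    rw [h x hx, abs_mul, add_mul, one_mul, neg_add, Real.exp_add, Real.exp_neg (Real.log |μ|),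
      Real.exp_log (abs_pos.2 hμ)]
    have := abs_pos.2 hμ
    field_simp
  have hind : ∀ n : ℕ, ∀ x, 0 ≤ x → x ≤ max R 0 + 1 + n → g x ≤ C := by
    intro n
    induction n with
    | zero => exact fun x h0 h1 => hC (Set.mem_image_of_mem _ ⟨h0, by simpa using h1⟩)
    | succ n ih =>
      intro x h0 h1
      rcases le_or_gt x (max R 0 + 1 + n) with h2 | h2
      · exact ih x h0 h2
      · have h3 : max R 0 < x - 1 := by
          have : (0 : ℝ) ≤ n := n.cast_nonneg
          linarith
        have h4 := hstep (x - 1) ((le_max_left _ _).trans_lt h3)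
        rw [sub_add_cancel] at h4
        rw [h4]
        exact ih _ ((le_max_right _ _).trans h3.le) (by push_cast at h1; linarith)
  refine ⟨max C 1, by positivity, fun x hx => ?_⟩
  obtain ⟨n, hn⟩ := exists_nat_ge x
  have h1 : g x ≤ max C 1 :=
    (hind n x hx (by linarith [le_max_right R 0])).trans (le_max_left _ _)
  have h2 : |f x| = g x * Real.exp (x * Real.log |μ|) := by
    simp only [hg]; rw [mul_assoc, ← Real.exp_add]; simp
  rw [h2]
  gcongr

/-! ### Square integrable solutions on a half line and Floquet behaviour. -/

section HalfLine

variable {Q f f' g g' : ℝ → ℝ} {R B : ℝ}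

/-- Taylor's formula with integral remainder between `x` and `x + 1` expresses `f'(x)` through
`f(x)`, `f(x+1)` and an integral of `Q f`, which `|f| ≤ 1 + f²` bounds uniformly in `x`. -/
theorem abs_deriv_le_of_sq_integrable (hQ : Continuous Q)
    (hB : ∀ x, R < x → |Q x| ≤ B) (hf : IsSolOn (Set.Ioi R) Q f f')
    (hi : IntegrableOn (fun x => f x ^ 2) (Set.Ioi R)) :
    ∃ C : ℝ, ∀ x, R < x → |f' x| ≤ |f x| + |f (x + 1)| + C := by
  have hB0 : 0 ≤ B := (abs_nonneg _).trans (hB (R + 1) (by linarith))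
  refine ⟨B + B * ∫ t in Set.Ioi R, f t ^ 2, fun x hx => ?_⟩
  have hmem : ∀ t ∈ Set.uIcc x (x + 1), R < t := fun t ht => by
    rw [Set.uIcc_of_le (by linarith)] at ht; linarith [ht.1]
  have hcf : ContinuousOn f (Set.uIcc x (x + 1)) := fun t ht =>
    (hf t (hmem t ht)).1.continuousAt.continuousWithinAt
  have hint : IntervalIntegrable (fun t => (x + 1 - t) * (Q t * f t)) volume x (x + 1) :=
    ContinuousOn.intervalIntegrable (by fun_prop)
  have hder : ∀ t ∈ Set.uIcc x (x + 1),
      HasDerivAt (fun t => f t + (x + 1 - t) * f' t) ((x + 1 - t) * (Q t * f t)) t := fun t ht => by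
    obtain ⟨h1, h2⟩ := hf t (hmem t ht)
    exact (h1.add (((hasDerivAt_id t).const_sub (x + 1)).mul h2)).congr_deriv (by simp)
  have hFTC := intervalIntegral.integral_eq_sub_of_hasDerivAt hder hint
  have hsq : IntervalIntegrable (fun t => f t ^ 2) volume x (x + 1) :=
    ContinuousOn.intervalIntegrable (by fun_prop)
  have hle : |∫ t in x..(x + 1), (x + 1 - t) * (Q t * f t)| ≤ ∫ t in x..(x + 1), (B + B * f t ^ 2) := by
    rw [← Real.norm_eq_abs]
    refine intervalIntegral.norm_integral_le_of_norm_le (by linarith)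
      (Filter.Eventually.of_forall fun t ht => ?_) (by
        exact (intervalIntegrable_const).add (hsq.const_mul B))
    rw [Real.norm_eq_abs, abs_mul, abs_mul]
    have h1 : |x + 1 - t| ≤ 1 := by rw [abs_le]; constructor <;> linarith [ht.1, ht.2]
    have h2 := hB t (hx.trans ht.1)
    have h3 : |f t| ≤ 1 + f t ^ 2 := by
      rw [← sq_abs (f t)]; nlinarith [sq_nonneg (|f t| - 1), abs_nonneg (f t)]
    calc |x + 1 - t| * (|Q t| * |f t|) ≤ 1 * (B * (1 + f t ^ 2)) := by gcongr
      _ = _ := by ring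
  have hle2 : ∫ t in x..(x + 1), (B + B * f t ^ 2) ≤ B + B * ∫ t in Set.Ioi R, f t ^ 2 := by
    rw [intervalIntegral.integral_add intervalIntegrable_const (hsq.const_mul B),
      intervalIntegral.integral_const_mul, intervalIntegral.integral_const]
    have : ∫ t in x..(x + 1), f t ^ 2 ≤ ∫ t in Set.Ioi R, f t ^ 2 := by
      rw [intervalIntegral.integral_of_le (by linarith)]
      exact setIntegral_mono_set hi (Filter.Eventually.of_forall fun t => sq_nonneg _)
        (LE.le.eventuallyLE fun t ht => hx.trans ht.1)
    simp only [add_sub_cancel_left, one_smul]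
    gcongr
  have heq : f' x = f (x + 1) - f x - ∫ t in x..(x + 1), (x + 1 - t) * (Q t * f t) := by
    rw [hFTC]; ring
  calc |f' x| ≤ |f (x + 1)| + |f x| + |∫ t in x..(x + 1), (x + 1 - t) * (Q t * f t)| := by
        rw [heq]
        refine (abs_sub _ _).trans ?_
        gcongr
        exact abs_sub _ _
    _ ≤ _ := by linarith

theorem exists_lt_of_integrableOn_Ioi {h : ℝ → ℝ} (hi : IntegrableOn h (Set.Ioi R))
    {δ : ℝ} (hδ : 0 < δ) : ∃ x, R < x ∧ h x < δ := by
  by_contra! hcon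
  have : IntegrableOn (fun _ : ℝ => δ) (Set.Ioi R) := by
    refine Integrable.mono' hi aestronglyMeasurable_const ?_
    refine (ae_restrict_iff' measurableSet_Ioi).2 (Filter.Eventually.of_forall fun x hx => ?_)
    rw [Real.norm_of_nonneg hδ.le]
    exact hcon x hx
  rw [integrableOn_const_iff] at this
  simp [hδ.ne'] at this

theorem integrableOn_Ioi_comp_add_one {h : ℝ → ℝ} (hi : IntegrableOn h (Set.Ioi R)) :
    IntegrableOn (fun x => h (x + 1)) (Set.Ioi R) := by
  have : IntegrableOn h (Set.Ioi (R + 1)) := hi.mono_set (Set.Ioi_subset_Ioi (by linarith))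
  have h2 := (measurePreserving_add_right volume (1 : ℝ)).integrableOn_comp_preimage
    (measurableEmbedding_addRight (1 : ℝ)) (f := h) (s := Set.Ioi (R + 1))
  simpa [Function.comp_def] using h2.2 this

/-- The Wronskian is constant. Integrability gives points `y` at which `f` and `g` are small at both
`y` and `y + 1`; the derivatives stay bounded there, so the constant is arbitrarily small. -/
theorem wronskian_eq_zero_of_sq_integrable (hQ : Continuous Q) (hB : ∀ x, R < x → |Q x| ≤ B)
    (hf : IsSolOn (Set.Ioi R) Q f f') (hg : IsSolOn (Set.Ioi R) Q g g')
    (hfi : IntegrableOn (fun x => f x ^ 2) (Set.Ioi R))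
    (hgi : IntegrableOn (fun x => g x ^ 2) (Set.Ioi R)) {x : ℝ} (hx : R < x) :
    f x * g' x - f' x * g x = 0 := by
  obtain ⟨C₁, h1⟩ := abs_deriv_le_of_sq_integrable hQ hB hf hfi
  obtain ⟨C₂, h2⟩ := abs_deriv_le_of_sq_integrable hQ hB hg hgi
  by_contra hne
  set c := |f x * g' x - f' x * g x| with hc
  have hcpos : 0 < c := abs_pos.2 hne
  set D := 4 + |C₁| + |C₂| with hD
  have hDpos : 0 < D := by positivity
  set δ := min 1 (c / (2 * D)) with hδ
  have hδpos : 0 < δ := by positivity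
  obtain ⟨y, hy, hyδ⟩ := exists_lt_of_integrableOn_Ioi (((hfi.add hgi).add
    (integrableOn_Ioi_comp_add_one hfi)).add (integrableOn_Ioi_comp_add_one hgi))
    (δ := δ ^ 2) (by positivity)
  simp only [Pi.add_apply] at hyδ
  have hsmall : ∀ a : ℝ, a ^ 2 < δ ^ 2 → |a| ≤ δ := fun a ha =>
    (abs_lt_of_sq_lt_sq ha hδpos.le).le
  have e1 := hsmall (f y) (by nlinarith [sq_nonneg (g y), sq_nonneg (f (y + 1)), sq_nonneg (g (y + 1))])
  have e2 := hsmall (g y) (by nlinarith [sq_nonneg (f y), sq_nonneg (f (y + 1)), sq_nonneg (g (y + 1))])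
  have e3 := hsmall (f (y + 1)) (by nlinarith [sq_nonneg (g y), sq_nonneg (f y), sq_nonneg (g (y + 1))])
  have e4 := hsmall (g (y + 1)) (by nlinarith [sq_nonneg (g y), sq_nonneg (f (y + 1)), sq_nonneg (f y)])
  have hW : f x * g' x - f' x * g x = f y * g' y - f' y * g y :=
    hf.wronskian_eq hg isOpen_Ioi isPreconnected_Ioi hx hy
  have hδ1 : δ ≤ 1 := min_le_left _ _
  have e5 : |f' y| ≤ 2 + |C₁| := by linarith [h1 y hy, le_abs_self C₁]
  have e6 : |g' y| ≤ 2 + |C₂| := by linarith [h2 y hy, le_abs_self C₂]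
  have : c ≤ δ * D := by
    rw [hc, hW]
    calc _ ≤ |f y| * |g' y| + |f' y| * |g y| := by
          rw [← abs_mul, ← abs_mul]; exact abs_sub _ _
      _ ≤ δ * (2 + |C₂|) + (2 + |C₁|) * δ := by gcongr
      _ = δ * D := by rw [hD]; ring
  have h3 : δ * D ≤ c / (2 * D) * D := by gcongr; exact min_le_right _ _
  have h4 : c / (2 * D) * D = c / 2 := by field_simp
  linarith

end HalfLine

theorem exists_abs_le_of_eventually_periodic {Q : ℝ → ℝ} {ρ : ℝ} (hQ : Continuous Q)
    (hper : ∀ x, ρ < x → Q (x + 1) = Q x) : ∃ B : ℝ, ∀ x, ρ < x → |Q x| ≤ B := by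
  obtain ⟨B, hBpos, hB⟩ := exists_bound_of_eventually_quasiperiodic (f := fun x => Q (x + ρ)) (μ := 1)
    (R := 0) (by fun_prop) one_ne_zero (fun x hx => by
      rw [one_mul, ← hper (x + ρ) (by linarith)]; congr 1; ring)
  exact ⟨B, fun x hx => by simpa using hB (x - ρ) (by linarith)⟩

/-- A decaying Floquet solution and a growing one on a half line where the potential is periodic. -/
theorem exists_floquet_solutions {Q φ φ' ψ ψ' : ℝ → ℝ} {ρ : ℝ} (hQ : Continuous Q)
    (hper : ∀ x, ρ < x → Q (x + 1) = Q x) (hφ : IsSolOn Set.univ Q φ φ')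
    (hψ : IsSolOn Set.univ Q ψ ψ') (hW : ∀ x, φ x * ψ' x - φ' x * ψ x = 1)
    (hi : IntegrableOn (fun x => φ x ^ 2) (Set.Ioi ρ)) :
    ∃ l d : ℝ, l ≠ 0 ∧ |l| < 1 ∧ ∀ x, ρ < x → φ (x + 1) = l * φ x ∧ φ' (x + 1) = l * φ' x ∧
      ψ (x + 1) + d * φ (x + 1) = l⁻¹ * (ψ x + d * φ x) ∧
      ψ' (x + 1) + d * φ' (x + 1) = l⁻¹ * (ψ' x + d * φ' x) := by
  obtain ⟨B, hB'⟩ := exists_abs_le_of_eventually_periodic hQ hper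
  have hφI : IsSolOn (Set.Ioi ρ) Q φ φ' := hφ.mono (Set.subset_univ _)
  have hψI : IsSolOn (Set.Ioi ρ) Q ψ ψ' := hψ.mono (Set.subset_univ _)
  have hφ1 : IsSolOn (Set.Ioi ρ) Q (fun x => φ (x + 1)) (fun x => φ' (x + 1)) :=
    hφ.comp_add_const 1 fun x hx => ⟨trivial, hper x hx⟩
  have hψ1 : IsSolOn (Set.Ioi ρ) Q (fun x => ψ (x + 1)) (fun x => ψ' (x + 1)) :=
    hψ.comp_add_const 1 fun x hx => ⟨trivial, hper x hx⟩
  have hi1 := integrableOn_Ioi_comp_add_one hi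
  have hW0 : ∀ x, ρ < x → φ x * φ' (x + 1) - φ' x * φ (x + 1) = 0 := fun x hx =>
    wronskian_eq_zero_of_sq_integrable hQ hB' hφI hφ1 hi hi1 hx
  have hx₀ : ρ < ρ + 1 := by linarith
  -- The translate of `φ` is collinear with `φ`; its Wronskian with `ψ` is the proportionality
  -- factor.
  set l := φ (ρ + 1 + 1) * ψ' (ρ + 1) - φ' (ρ + 1 + 1) * ψ (ρ + 1) with hl
  have hlx : ∀ x, ρ < x → φ (x + 1) * ψ' x - φ' (x + 1) * ψ x = l := fun x hx =>
    hφ1.wronskian_eq hψI isOpen_Ioi isPreconnected_Ioi hx hx₀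
  have e1 : ∀ x, ρ < x → φ (x + 1) = l * φ x := fun x hx => by
    linear_combination -φ (x + 1) * hW x + φ x * hlx x hx + ψ x * hW0 x hx
  have e2 : ∀ x, ρ < x → φ' (x + 1) = l * φ' x := fun x hx => by
    linear_combination -φ' (x + 1) * hW x + φ' x * hlx x hx + ψ' x * hW0 x hx
  have hl0 : l ≠ 0 := by
    intro h0
    have h1 := hW (ρ + 1 + 1)
    rw [e1 _ hx₀, e2 _ hx₀, h0] at h1
    simp at h1
  have hl1 : |l| < 1 := by
    -- Translation multiplies the mass of `φ` on the half line by `l ^ 2`, and the first period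
    -- carries positive mass.
    set I := ∫ x in Set.Ioi ρ, φ x ^ 2 with hI
    have hshift : ∫ x in Set.Ioi (ρ + 1), φ x ^ 2 = l ^ 2 * I := by
      have h1 := (measurePreserving_add_right volume (1 : ℝ)).setIntegral_preimage_emb
        (measurableEmbedding_addRight (1 : ℝ)) (fun x => φ x ^ 2) (Set.Ioi (ρ + 1))
      rw [← h1, hI, ← integral_const_mul]
      have h2 : (fun x : ℝ => x + 1) ⁻¹' Set.Ioi (ρ + 1) = Set.Ioi ρ := by ext; simp
      rw [h2]
      exact setIntegral_congr_fun measurableSet_Ioi fun x hx => by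
        simp only [e1 x hx]; ring
    have hsplit : (∫ x in ρ..(ρ + 1), φ x ^ 2) + ∫ x in Set.Ioi (ρ + 1), φ x ^ 2 = I :=
      intervalIntegral.integral_interval_add_Ioi hi (hi.mono_set (Set.Ioi_subset_Ioi (by linarith)))
    have hnn : 0 ≤ I := integral_nonneg fun x => sq_nonneg _
    have hJ : 0 < ∫ x in ρ..(ρ + 1), φ x ^ 2 := by
      refine intervalIntegral.integral_pos (by linarith)
        ((hφ.continuous.1.pow 2).continuousOn) (fun x _ => sq_nonneg _) ?_
      by_contra! hcon
      have hz : ∀ x ∈ Set.Icc ρ (ρ + 1), φ x = 0 := fun x hx =>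
        pow_eq_zero_iff (two_ne_zero) |>.1 (le_antisymm (hcon x hx) (sq_nonneg _))
      have hm : ρ + 1 / 2 ∈ Set.Icc ρ (ρ + 1) := ⟨by linarith, by linarith⟩
      have hev : φ =ᶠ[nhds (ρ + 1 / 2)] fun _ => 0 := by
        filter_upwards [Icc_mem_nhds (show ρ < ρ + 1 / 2 by linarith)
          (show ρ + 1 / 2 < ρ + 1 by linarith)] with x hx using hz x hx
      have hd0 : φ' (ρ + 1 / 2) = 0 :=
        ((hφ _ trivial).1.congr_of_eventuallyEq hev.symm).unique (hasDerivAt_const _ _)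
      have := hW (ρ + 1 / 2)
      rw [hz _ hm, hd0] at this
      simp at this
    rw [hshift] at hsplit
    by_contra! hge
    have : 1 ≤ l ^ 2 := by rw [← sq_abs]; nlinarith
    nlinarith
  set c := ψ (ρ + 1 + 1) * ψ' (ρ + 1) - ψ' (ρ + 1 + 1) * ψ (ρ + 1) with hc
  have hcx : ∀ x, ρ < x → ψ (x + 1) * ψ' x - ψ' (x + 1) * ψ x = c := fun x hx =>
    hψ1.wronskian_eq hψI isOpen_Ioi isPreconnected_Ioi hx hx₀
  have hwx : ∀ x, ρ < x → φ x * ψ' (x + 1) - φ' x * ψ (x + 1) = l⁻¹ := fun x hx => by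
    have := hW (x + 1)
    rw [e1 x hx, e2 x hx] at this
    field_simp
    linear_combination this
  have hll : l⁻¹ - l ≠ 0 := by
    intro h
    have : l * l = 1 := by field_simp at h; linarith
    have h2 : |l| * |l| < 1 := by nlinarith [abs_nonneg l]
    rw [← abs_mul, this, abs_one] at h2
    exact lt_irrefl _ h2
  -- Translation sends `ψ` to `l⁻¹ ψ + c φ`; this `d` makes `ψ + d φ` an eigenvector for `l⁻¹`.
  set d := c / (l⁻¹ - l) with hd
  have hdc : c = d * (l⁻¹ - l) := (div_mul_cancel₀ c hll).symm
  refine ⟨l, d, hl0, hl1, fun x hx => ⟨e1 x hx, e2 x hx, ?_, ?_⟩⟩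
  · rw [e1 x hx]
    linear_combination -ψ (x + 1) * hW x + φ x * hcx x hx + ψ x * hwx x hx + φ x * hdc
  · rw [e2 x hx]
    linear_combination -ψ' (x + 1) * hW x + φ' x * hcx x hx + ψ' x * hwx x hx + φ' x * hdc

theorem ivp_isSolOn {V : ℝ → ℝ} (hV : Continuous V) (z a b : ℂ) :
    IsSolOn Set.univ (fun x => (V x : ℂ) - z) (ivp V z a b) (deriv (ivp V z a b)) ∧
      ivp V z a b 0 = a ∧ deriv (ivp V z a b) 0 = b := by
  have hex : ∃ f : ℝ → ℂ, IsSolution V z f ∧ f 0 = a ∧ deriv f 0 = b := by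
    obtain ⟨u, v, h, ha, hb⟩ := exists_isSolOn (Q := fun x => (V x : ℂ) - z) (by fun_prop) 0 a b
    exact ⟨u, (h.isSolution hV).1, ha, by rw [(h.isSolution hV).2, hb]⟩
  obtain ⟨h1, h2⟩ := Classical.epsilon_spec hex
  exact ⟨h1.isSolOn, h2⟩

/-- A solution on a half line with quasiperiodic behaviour extends to a Floquet solution of the
periodic equation. -/
theorem exists_floquet_extension {Q Qper f f' : ℝ → ℝ} {ρ μ : ℝ} (hQ : Continuous Qper)
    (hper : ∀ x, Qper (x + 1) = Qper x) (hQQ : ∀ x, ρ < x → Q x = Qper x)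
    (hf : IsSolOn (Set.Ioi ρ) Q f f')
    (hμ : ∀ x, ρ < x → f (x + 1) = μ * f x ∧ f' (x + 1) = μ * f' x) :
    ∃ F F' : ℝ → ℝ, IsSolOn Set.univ Qper F F' ∧
      (∀ x, F (x + 1) = μ * F x ∧ F' (x + 1) = μ * F' x) ∧ ∀ x, ρ < x → F x = f x ∧ F' x = f' x := by
  obtain ⟨F, F', hF, h1, h2⟩ := exists_isSolOn_real hQ (ρ + 1) (f (ρ + 1)) (f' (ρ + 1))
  have hx₀ : ρ < ρ + 1 := by linarith
  have hf' : IsSolOn (Set.Ioi ρ) Qper f f' := fun x hx => by rw [← hQQ x hx]; exact hf x hx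
  have heq : ∀ x, ρ < x → F x = f x ∧ F' x = f' x := fun x hx =>
    (hF.mono (Set.subset_univ (Set.Ioi ρ))).eq_of_eq_real hQ hf' isOpen_Ioi isPreconnected_Ioi
      hx₀ hx h1 h2
  have hF1 : IsSolOn Set.univ Qper (fun x => F (x + 1)) (fun x => F' (x + 1)) :=
    hF.comp_add_const 1 fun x _ => ⟨trivial, hper x⟩
  refine ⟨F, F', hF, fun x => ?_, heq⟩
  have hx₁ : ρ < ρ + 1 + 1 := by linarith
  exact hF1.eq_of_eq_real hQ (hF.const_mul μ) isOpen_univ isPreconnected_univ (x₀ := ρ + 1) trivial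
    trivial (by rw [(heq _ hx₁).1, h1, (hμ _ hx₀).1]) (by rw [(heq _ hx₁).2, h2, (hμ _ hx₀).2])

/-- Translation by the period multiplies the Wronskian of `F` and `G` by `μ ν`, yet the Wronskian is
constant. So it vanishes, and `F` and `G` are proportional. -/
theorem multiplier_eq_of_mul_ne_one {Q F F' G G' : ℝ → ℝ} {μ ν : ℝ}
    (hF : IsSolOn Set.univ Q F F') (hG : IsSolOn Set.univ Q G G') {x₀ : ℝ}
    (hF0 : F x₀ ≠ 0 ∨ F' x₀ ≠ 0) (hG0 : G x₀ ≠ 0 ∨ G' x₀ ≠ 0)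
    (hμ : ∀ x, F (x + 1) = μ * F x ∧ F' (x + 1) = μ * F' x)
    (hν : ∀ x, G (x + 1) = ν * G x ∧ G' (x + 1) = ν * G' x) (hne : μ * ν ≠ 1)
    (hQ : Continuous Q) : μ = ν := by
  have hW : F x₀ * G' x₀ - F' x₀ * G x₀ = 0 := by
    have := hF.wronskian_eq hG isOpen_univ isPreconnected_univ (x := x₀) (y := x₀ + 1) trivial
      trivial
    rw [(hμ x₀).1, (hμ x₀).2, (hν x₀).1, (hν x₀).2] at this
    have h2 : (F x₀ * G' x₀ - F' x₀ * G x₀) * (μ * ν - 1) = 0 := by linear_combination -this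
    exact (mul_eq_zero.1 h2).resolve_right (sub_ne_zero.2 hne)
  obtain ⟨t, ht1, ht2⟩ : ∃ t, G x₀ = t * F x₀ ∧ G' x₀ = t * F' x₀ := by
    rcases hF0 with h | h
    · exact ⟨G x₀ / F x₀, by field_simp, by field_simp; linarith⟩
    · exact ⟨G' x₀ / F' x₀, by field_simp; linarith, by field_simp⟩
  obtain ⟨h1, h2⟩ := hG.eq_of_eq_real hQ (hF.const_mul t) isOpen_univ isPreconnected_univ
    (x₀ := x₀) (x := x₀ + 1) trivial trivial ht1 ht2
  rw [(hμ x₀).1, (hν x₀).1] at h1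
  rw [(hμ x₀).2, (hν x₀).2] at h2
  rcases hG0 with h | h
  · exact mul_right_cancel₀ h (by rw [h1, ht1]; ring)
  · exact mul_right_cancel₀ h (by rw [h2, ht2]; ring)

/-! ### Exponential dichotomies. -/

/-- A fundamental system of `u'' = Q u` with Wronskian `1`, whose first member decays like
`e^{-κ x}` and whose second member grows at most like `e^{κ x}` on `[0, ∞)`. -/
structure IsDichotomy (Q φ φ' ψ ψ' : ℝ → ℝ) (κ C : ℝ) : Prop where
  fst : IsSolOn Set.univ Q φ φ'
  snd : IsSolOn Set.univ Q ψ ψ'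
  wronskian : ∀ x, φ x * ψ' x - φ' x * ψ x = 1
  pos : 0 < C
  bound : ∀ x, 0 ≤ x → |φ x| ≤ C * Real.exp (-(κ * x)) ∧ |φ' x| ≤ C * Real.exp (-(κ * x)) ∧
    |ψ x| ≤ C * Real.exp (κ * x) ∧ |ψ' x| ≤ C * Real.exp (κ * x)

theorem IsDichotomy.mono {Q φ φ' ψ ψ' : ℝ → ℝ} {κ C D : ℝ} (h : IsDichotomy Q φ φ' ψ ψ' κ C)
    (hCD : C ≤ D) : IsDichotomy Q φ φ' ψ ψ' κ D where
  fst := h.fst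
  snd := h.snd
  wronskian := h.wronskian
  pos := h.pos.trans_le hCD
  bound x hx := by
    obtain ⟨h1, h2, h3, h4⟩ := h.bound x hx
    have e1 : C * Real.exp (-(κ * x)) ≤ D * Real.exp (-(κ * x)) := by gcongr
    have e2 : C * Real.exp (κ * x) ≤ D * Real.exp (κ * x) := by gcongr
    exact ⟨h1.trans e1, h2.trans e1, h3.trans e2, h4.trans e2⟩

/-- The pure Floquet solution is `ψ + d φ`. Subtracting the decaying `d φ` does not spoil the growth
bound, so `ψ` itself can be kept together with its prescribed data at 0. -/
theorem exists_isDichotomy {Q φ φ' ψ ψ' : ℝ → ℝ} {ρ l d : ℝ} (hφ : IsSolOn Set.univ Q φ φ')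
    (hψ : IsSolOn Set.univ Q ψ ψ') (hW : ∀ x, φ x * ψ' x - φ' x * ψ x = 1) (hl0 : l ≠ 0)
    (hl1 : |l| < 1) (h : ∀ x, ρ < x → φ (x + 1) = l * φ x ∧ φ' (x + 1) = l * φ' x ∧
      ψ (x + 1) + d * φ (x + 1) = l⁻¹ * (ψ x + d * φ x) ∧
      ψ' (x + 1) + d * φ' (x + 1) = l⁻¹ * (ψ' x + d * φ' x)) :
    ∃ C, IsDichotomy Q φ φ' ψ ψ' (-Real.log |l|) C := by
  have c1 := hφ.continuous
  have c2 := hψ.continuous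
  have cf := c1.1
  have cf' := c1.2
  have cg := c2.1
  have cg' := c2.2
  obtain ⟨C₁, p1, h1⟩ := exists_bound_of_eventually_quasiperiodic cf hl0 fun x hx => (h x hx).1
  obtain ⟨C₂, p2, h2⟩ := exists_bound_of_eventually_quasiperiodic cf' hl0 fun x hx => (h x hx).2.1
  obtain ⟨C₃, p3, h3⟩ := exists_bound_of_eventually_quasiperiodic
    (f := fun x => ψ x + d * φ x) (by fun_prop) (inv_ne_zero hl0) fun x hx => (h x hx).2.2.1
  obtain ⟨C₄, p4, h4⟩ := exists_bound_of_eventually_quasiperiodic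
    (f := fun x => ψ' x + d * φ' x) (by fun_prop) (inv_ne_zero hl0) fun x hx => (h x hx).2.2.2
  have hlog : Real.log |l| < 0 := Real.log_neg (abs_pos.2 hl0) hl1
  have hmon : ∀ x, 0 ≤ x → Real.exp (x * Real.log |l|) ≤ Real.exp (-Real.log |l| * x) := fun x hx =>
    Real.exp_le_exp.2 (by nlinarith)
  have hinv : ∀ x, Real.exp (x * Real.log |l⁻¹|) = Real.exp (-Real.log |l| * x) := fun x => by
    rw [abs_inv, Real.log_inv]; congr 1; ring
  have hexp : ∀ x, Real.exp (x * Real.log |l|) = Real.exp (-(-Real.log |l| * x)) := fun x => by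
    congr 1; ring
  have hgrow : ∀ (a b A B x : ℝ), 0 ≤ x → 0 ≤ B → |b + d * a| ≤ A * Real.exp (x * Real.log |l⁻¹|) →
      |a| ≤ B * Real.exp (x * Real.log |l|) → |b| ≤ (A + |d| * B) * Real.exp (-Real.log |l| * x) := by
    intro a b A B x hx hB hA hb
    have e : b = (b + d * a) - d * a := by ring
    rw [hinv] at hA
    calc |b| ≤ |b + d * a| + |d| * |a| := by
          rw [← abs_mul]; nth_rewrite 1 [e]; exact abs_sub _ _
      _ ≤ A * Real.exp (-Real.log |l| * x) + |d| * (B * Real.exp (-Real.log |l| * x)) := by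
          gcongr
          exact hb.trans (by gcongr B * ?_; exact hmon x hx)
      _ = _ := by ring
  refine ⟨C₁ + C₂ + (C₃ + |d| * C₁) + (C₄ + |d| * C₂), hφ, hψ, hW, by positivity, fun x hx => ?_⟩
  have := mul_nonneg (abs_nonneg d) p1.le
  have := mul_nonneg (abs_nonneg d) p2.le
  rw [← hexp]
  refine ⟨(h1 x hx).trans ?_, (h2 x hx).trans ?_, (hgrow _ _ _ _ x hx p1.le (h3 x hx) (h1 x hx)).trans ?_,
    (hgrow _ _ _ _ x hx p2.le (h4 x hx) (h2 x hx)).trans ?_⟩ <;>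
    exact mul_le_mul_of_nonneg_right (by linarith) (Real.exp_pos _).le

theorem IsSolOn.ne_zero_of_ne_zero {Q u v : ℝ → ℝ} (hQ : Continuous Q)
    (h : IsSolOn Set.univ Q u v) {x₀ : ℝ} (h0 : u x₀ ≠ 0 ∨ v x₀ ≠ 0) (x : ℝ) :
    u x ≠ 0 ∨ v x ≠ 0 := by
  by_contra! hcon
  have := h.eq_of_eq_real hQ (h.const_mul 0) isOpen_univ isPreconnected_univ (x₀ := x) (x := x₀)
    trivial trivial (by simp [hcon.1]) (by simp [hcon.2])
  simp only [zero_mul] at this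
  exact h0.elim (· this.1) (· this.2)

/-! ### The bound state and its two-sided dichotomy. -/

section Potential

variable {V Vper Vdef : ℝ → ℝ} {ρ : ℝ}

theorem IsEventuallyPeriodic.continuous (hV : IsEventuallyPeriodic V Vper Vdef ρ) :
    Continuous V := hV.smooth.continuous

theorem IsEventuallyPeriodic.eq_per (hV : IsEventuallyPeriodic V Vper Vdef ρ) {x : ℝ}
    (hx : ρ < |x|) : V x = Vper x := by rw [hV.decomp, hV.supp x hx, add_zero]

/-- Only `V` is assumed smooth. Far to the right `Vper` agrees with `V`, and periodicity carries
continuity back to every point. -/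
theorem IsEventuallyPeriodic.continuous_per (hV : IsEventuallyPeriodic V Vper Vdef ρ) :
    Continuous Vper := by
  refine continuous_iff_continuousAt.2 fun x => ?_
  obtain ⟨n, hn⟩ := exists_nat_gt (ρ + 1 - x)
  have hp : Function.Periodic Vper 1 := hV.periodic
  have heq : (fun y => V (y + n)) =ᶠ[nhds x] Vper := by
    filter_upwards [Ioi_mem_nhds (show x - 1 < x by linarith)] with y hy
    have hy' : x - 1 < y := hy
    rw [hV.eq_per ((show ρ < y + n by linarith).trans_le (le_abs_self _))]
    simpa using hp.nat_mul n y
  have hc := hV.continuous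
  exact ContinuousAt.congr (by fun_prop) heq

theorem IsEventuallyPeriodic.reflect (hV : IsEventuallyPeriodic V Vper Vdef ρ) :
    IsEventuallyPeriodic (fun x => V (-x)) (fun x => Vper (-x)) (fun x => Vdef (-x)) ρ where
  smooth := hV.smooth.comp contDiff_neg
  decomp x := hV.decomp _
  periodic x := by rw [← hV.periodic (-(x + 1))]; congr 1; ring
  supp x hx := hV.supp _ (by rwa [abs_neg])

theorem IsEventuallyPeriodic.periodic_right (hV : IsEventuallyPeriodic V Vper Vdef ρ) {x : ℝ}
    (hρ : 0 ≤ ρ) (hx : ρ < x) : V (x + 1) = V x := by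
  rw [hV.eq_per (x := x) (by rwa [abs_of_pos (by linarith)]),
    hV.eq_per (by rw [abs_of_pos] <;> linarith), hV.periodic]

theorem IsBoundState.integrable_sq {E : ℝ} {Φ : ℝ → ℂ} (hΦ : IsBoundState V E Φ) :
    Integrable (fun x => ‖Φ x‖ ^ 2) :=
  (memLp_two_iff_integrable_sq_norm hΦ.memLp.1).1 hΦ.memLp

theorem IsBoundState.isSolOn {E : ℝ} {Φ : ℝ → ℂ} (hΦ : IsBoundState V E Φ) :
    IsSolOn Set.univ (fun x => ((V x - E : ℝ) : ℂ)) Φ (deriv Φ) := by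
  simpa using hΦ.sol.isSolOn

/-- The initial data of a bound state are collinear with real ones. -/
theorem IsBoundState.re_mul_im_sub (hρ : 0 ≤ ρ) (hV : IsEventuallyPeriodic V Vper Vdef ρ) {E : ℝ}
    {Φ : ℝ → ℂ} (hΦ : IsBoundState V E Φ) :
    (Φ 0).re * (deriv Φ 0).im - (deriv Φ 0).re * (Φ 0).im = 0 := by
  have hc := hV.continuous
  have hQ : Continuous fun x => V x - E := by fun_prop
  obtain ⟨B, hB⟩ := exists_abs_le_of_eventually_periodic hQ (ρ := ρ) fun x hx => by
    rw [hV.periodic_right hρ hx]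
  have h1 := hΦ.isSolOn.re
  have h2 := hΦ.isSolOn.im
  have hcΦ := hΦ.isSolOn.continuous.1
  have i1 : Integrable (fun x => (Φ x).re ^ 2) := hΦ.integrable_sq.mono'
    (by fun_prop) (Filter.Eventually.of_forall fun x => by
      rw [Real.norm_of_nonneg (sq_nonneg _), ← sq_abs]; gcongr; exact Complex.abs_re_le_norm _)
  have i2 : Integrable (fun x => (Φ x).im ^ 2) := hΦ.integrable_sq.mono'
    (by fun_prop) (Filter.Eventually.of_forall fun x => by
      rw [Real.norm_of_nonneg (sq_nonneg _), ← sq_abs]; gcongr; exact Complex.abs_im_le_norm _)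
  rw [h1.wronskian_eq h2 isOpen_univ isPreconnected_univ (x := 0) (y := ρ + 1) trivial trivial]
  exact wronskian_eq_zero_of_sq_integrable hQ hB (h1.mono (Set.subset_univ _))
    (h2.mono (Set.subset_univ _)) i1.integrableOn i2.integrableOn (by linarith)

theorem IsBoundState.initial_ne_zero (hV : IsEventuallyPeriodic V Vper Vdef ρ) {E : ℝ}
    {Φ : ℝ → ℂ} (hΦ : IsBoundState V E Φ) (h0 : Φ 0 = 0) : deriv Φ 0 ≠ 0 := by
  intro h1
  have hc := hV.continuous
  refine hΦ.ne_zero (funext fun x => ?_)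
  have := (hΦ.isSolOn.eq_of_eq (by fun_prop) (hΦ.isSolOn.const_mul 0) isOpen_univ
    isPreconnected_univ (x₀ := 0) (x := x) trivial trivial (by simp [h0]) (by simp [h1])).1
  simpa using this

theorem IsBoundState.integrable_real_sq (hV : IsEventuallyPeriodic V Vper Vdef ρ) {E : ℝ}
    {Φ : ℝ → ℂ} (hΦ : IsBoundState V E Φ) {φ φ' : ℝ → ℝ} {c : ℂ} (hc : c ≠ 0)
    (hφ : IsSolOn Set.univ (fun x => V x - E) φ φ') (h0 : Φ 0 = c * φ 0)
    (h1 : deriv Φ 0 = c * φ' 0) : Integrable (fun x => φ x ^ 2) := by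
  have hcV := hV.continuous
  have heq : ∀ x, φ x ^ 2 = (‖c‖ ^ 2)⁻¹ * ‖Φ x‖ ^ 2 := fun x => by
    have := (hΦ.isSolOn.eq_of_eq (by fun_prop) (hφ.ofReal.const_mul c) isOpen_univ
      isPreconnected_univ (x₀ := 0) (x := x) trivial trivial h0 h1).1
    rw [this, norm_mul, mul_pow, Complex.norm_real, Real.norm_eq_abs, sq_abs]
    have := norm_ne_zero_iff.2 hc
    field_simp
  simp_rw [heq]
  exact hΦ.integrable_sq.const_mul _

/-- Real fundamental system adapted to the bound state and to the parametrization `uSol`. -/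
theorem IsBoundState.exists_real_basis (hρ : 0 ≤ ρ) (hV : IsEventuallyPeriodic V Vper Vdef ρ)
    {E : ℝ} {Φ : ℝ → ℂ} (hΦ : IsBoundState V E Φ) :
    ∃ φ φ' ψ ψ' : ℝ → ℝ, IsSolOn Set.univ (fun x => V x - E) φ φ' ∧
      IsSolOn Set.univ (fun x => V x - E) ψ ψ' ∧ (∀ x, φ x * ψ' x - φ' x * ψ x = 1) ∧
      Integrable (fun x => φ x ^ 2) ∧
      ∀ ζ : C2, uSol V Φ ζ = ivp V (ζ 1) (φ 0 + (ζ 0 - eta Φ E 0) * ψ 0)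
        (φ' 0 + (ζ 0 - eta Φ E 0) * ψ' 0) := by
  have hcV := hV.continuous
  have hQ : Continuous fun x => V x - E := by fun_prop
  by_cases h0 : Φ 0 = 0
  · obtain ⟨φ, φ', hφ, a1, a2⟩ := exists_isSolOn_real hQ 0 0 1
    obtain ⟨ψ, ψ', hψ, b1, b2⟩ := exists_isSolOn_real hQ 0 (-1) 0
    refine ⟨φ, φ', ψ, ψ', hφ, hψ, fun x => ?_, ?_, fun ζ => ?_⟩
    · rw [hφ.wronskian_eq hψ isOpen_univ isPreconnected_univ (y := 0) trivial trivial, a1, a2, b1, b2]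
      norm_num
    · exact hΦ.integrable_real_sq hV (hΦ.initial_ne_zero hV h0) hφ (by simp [h0, a1]) (by simp [a2])
    · simp [uSol, eta, h0, a1, a2, b1, b2]
  · obtain ⟨φ, φ', hφ, a1, a2⟩ := exists_isSolOn_real hQ 0 1 (deriv Φ 0 / Φ 0).re
    obtain ⟨ψ, ψ', hψ, b1, b2⟩ := exists_isSolOn_real hQ 0 0 1
    have hreal : (((deriv Φ 0 / Φ 0).re : ℝ) : ℂ) = deriv Φ 0 / Φ 0 := by
      apply Complex.ext
      · simp
      · have := hΦ.re_mul_im_sub hρ hV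
        simp only [Complex.ofReal_im, Complex.div_im]
        rw [← sub_div]
        rw [eq_comm, div_eq_zero_iff]
        left; linarith
    refine ⟨φ, φ', ψ, ψ', hφ, hψ, fun x => ?_, ?_, fun ζ => ?_⟩
    · rw [hφ.wronskian_eq hψ isOpen_univ isPreconnected_univ (y := 0) trivial trivial, a1, a2, b1, b2]
      norm_num
    · exact hΦ.integrable_real_sq hV h0 hφ (by simp [a1]) (by rw [a2, hreal]; field_simp)
    · simp only [uSol, eta, ne_eq, h0, not_false_eq_true, if_true, a1, a2, b1, b2, hreal]
      simp

theorem isCharacteristicMultiplier_of_real (hV : IsEventuallyPeriodic V Vper Vdef ρ)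
    {E μ : ℝ} {F F' : ℝ → ℝ} (hF : IsSolOn Set.univ (fun x => Vper x - E) F F') {x₀ : ℝ}
    (h0 : F x₀ ≠ 0 ∨ F' x₀ ≠ 0) (hμ : ∀ x, F (x + 1) = μ * F x) :
    IsCharacteristicMultiplier Vper E μ := by
  have hF' : IsSolOn Set.univ (fun x => (Vper x : ℂ) - (E : ℂ)) (fun x => (F x : ℂ))
      (fun x => (F' x : ℂ)) := by simpa using hF.ofReal
  refine ⟨fun x => F x, (hF'.isSolution hV.continuous_per).1, fun hz => ?_,
    fun x => by simp [hμ x]⟩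
  have hz' : ∀ x, F x = 0 := fun x => by simpa using congrFun hz x
  rcases h0 with h | h
  · exact h (hz' x₀)
  · refine h (((hF x₀ trivial).1.congr_of_eventuallyEq (f₁ := fun _ => 0) ?_).unique
      (hasDerivAt_const _ _))
    exact Filter.Eventually.of_forall fun x => (hz' x).symm

/-- The half line analysis is applied to `V` and to its reflection. To see that the two rates agree,
the growing solution on the right and the bound state on the left are extended to Floquet solutions
of the one equation with potential `Vper`. Their multipliers `l⁻¹` and `m⁻¹` both exceed 1 in
modulus, so their product is not 1 and they coincide. -/
theorem IsBoundState.exists_dichotomy (hρ : 0 ≤ ρ) (hV : IsEventuallyPeriodic V Vper Vdef ρ)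
    {E : ℝ} {Φ : ℝ → ℂ} (hΦ : IsBoundState V E Φ) :
    ∃ (φ φ' ψ ψ' : ℝ → ℝ) (κ C : ℝ), IsFloquetExponent Vper E κ ∧
      IsDichotomy (fun x => V x - E) φ φ' ψ ψ' κ C ∧
      IsDichotomy (fun x => V (-x) - E) (fun x => φ (-x)) (fun x => -φ' (-x)) (fun x => -ψ (-x))
        (fun x => ψ' (-x)) κ C ∧
      ∀ ζ : C2, uSol V Φ ζ = ivp V (ζ 1) (φ 0 + (ζ 0 - eta Φ E 0) * ψ 0)
        (φ' 0 + (ζ 0 - eta Φ E 0) * ψ' 0) := by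
  obtain ⟨φ, φ', ψ, ψ', hφ, hψ, hW, hi, hu⟩ := hΦ.exists_real_basis hρ hV
  have hcV := hV.continuous
  have hcp := hV.continuous_per
  have hV' := hV.reflect
  have hφn : IsSolOn Set.univ (fun x => V (-x) - E) (fun x => φ (-x)) (fun x => -φ' (-x)) :=
    hφ.comp_neg fun x _ => ⟨trivial, rfl⟩
  -- The minus sign keeps the Wronskian of the reflected pair equal to 1.
  have hψn : IsSolOn Set.univ (fun x => V (-x) - E) (fun x => -ψ (-x)) (fun x => ψ' (-x)) := by
    have h1 : IsSolOn Set.univ (fun x => V (-x) - E) (fun x => ψ (-x)) (fun x => -ψ' (-x)) :=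
      hψ.comp_neg fun x _ => ⟨trivial, rfl⟩
    simpa using h1.const_mul (-1)
  have hWn : ∀ x, φ (-x) * ψ' (-x) - -φ' (-x) * -ψ (-x) = 1 := fun x => by
    linear_combination hW (-x)
  obtain ⟨l, d, hl0, hl1, hl⟩ := exists_floquet_solutions (Q := fun x => V x - E) (by fun_prop)
    (fun x hx => by rw [hV.periodic_right hρ hx]) hφ hψ hW hi.integrableOn
  obtain ⟨m, e, hm0, hm1, hm⟩ := exists_floquet_solutions (Q := fun x => V (-x) - E) (by fun_prop)
    (fun x hx => by rw [hV'.periodic_right hρ hx]) hφn hψn hWn hi.comp_neg.integrableOn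
  have hx₀ : ρ < ρ + 1 := by linarith
  obtain ⟨F, F', hF, hF1, hF2⟩ := exists_floquet_extension (Q := fun x => V x - E)
    (Qper := fun x => Vper x - E) (f := fun x => ψ x + d * φ x) (f' := fun x => ψ' x + d * φ' x)
    (ρ := ρ) (μ := l⁻¹) (by fun_prop) (fun x => by rw [hV.periodic])
    (fun x hx => by rw [hV.eq_per (hx.trans_le (le_abs_self x))])
    (by simpa using (hψ.linearCombination hφ 1 d).mono (Set.subset_univ _))
    fun x hx => (hl x hx).2.2
  have hF0 : ∀ x, F x ≠ 0 ∨ F' x ≠ 0 := by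
    refine hF.ne_zero_of_ne_zero (by fun_prop) (x₀ := ρ + 1) ?_
    by_contra! hcon
    rw [(hF2 _ hx₀).1, (hF2 _ hx₀).2] at hcon
    have : (1 : ℝ) = 0 := by
      linear_combination -hW (ρ + 1) + φ (ρ + 1) * hcon.2 - φ' (ρ + 1) * hcon.1
    exact one_ne_zero this
  obtain ⟨G, G', hG, hG1, hG2⟩ := exists_floquet_extension (Q := fun x => V (-x) - E)
    (Qper := fun x => Vper (-x) - E) (f := fun x => φ (-x)) (f' := fun x => -φ' (-x))
    (ρ := ρ) (μ := m) (by fun_prop) (fun x => by rw [hV'.periodic])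
    (fun x hx => by rw [hV'.eq_per (hx.trans_le (le_abs_self x))])
    (hφn.mono (Set.subset_univ _)) fun x hx => ⟨(hm x hx).1, (hm x hx).2.1⟩
  have hH : IsSolOn Set.univ (fun x => Vper x - E) (fun x => G (-x)) (fun x => -G' (-x)) :=
    hG.comp_neg fun x _ => ⟨trivial, by simp⟩
  have hH0 : ∀ x, G (-x) ≠ 0 ∨ -G' (-x) ≠ 0 := by
    refine hH.ne_zero_of_ne_zero (by fun_prop) (x₀ := -(ρ + 1)) ?_
    by_contra! hcon
    rw [neg_neg, (hG2 _ hx₀).1, (hG2 _ hx₀).2] at hcon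
    have : (1 : ℝ) = 0 := by
      linear_combination -hW (-(ρ + 1)) + ψ' (-(ρ + 1)) * hcon.1 - ψ (-(ρ + 1)) * hcon.2
    exact one_ne_zero this
  have hH1 : ∀ x, G (-(x + 1)) = m⁻¹ * G (-x) ∧ -G' (-(x + 1)) = m⁻¹ * -G' (-x) := fun x => by
    have := hG1 (-(x + 1))
    rw [show -(x + 1) + 1 = -x by ring] at this
    rw [this.1, this.2]
    constructor <;> field_simp
  have hlm : l⁻¹ = m⁻¹ := by
    refine multiplier_eq_of_mul_ne_one hF hH (x₀ := 0) (hF0 0) (hH0 0) hF1 hH1 ?_ (by fun_prop)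
    intro h
    have h1 : |l| * |m| = 1 := by
      rw [← abs_mul, show l * m = 1 by field_simp at h; linarith, abs_one]
    nlinarith [abs_nonneg l, abs_nonneg m]
  obtain ⟨C₁, h1⟩ := exists_isDichotomy hφ hψ hW hl0 hl1 hl
  obtain ⟨C₂, h2⟩ := exists_isDichotomy hφn hψn hWn hm0 hm1 hm
  rw [← inv_injective hlm] at h2
  refine ⟨φ, φ', ψ, ψ', _, max C₁ C₂, ⟨?_, l⁻¹, ?_, ?_⟩, h1.mono (le_max_left _ _),
    h2.mono (le_max_right _ _), hu⟩
  · have := Real.log_neg (abs_pos.2 hl0) hl1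
    linarith
  · exact isCharacteristicMultiplier_of_real hV hF (hF0 0) fun x => (hF1 x).1
  · rw [Real.exp_neg, Real.exp_log (abs_pos.2 hl0), abs_inv]

end Potential

theorem hasDerivAt_tsum_pow_mul {c : ℕ → ℂ} {u : ℕ → ℝ} {r : ℝ} (hr : 0 < r) (hu : Summable u)
    (hc : ∀ n, r ^ n * ‖c n‖ ≤ u n) : HasDerivAt (fun ε : ℂ => ∑' n, ε ^ n * c n) (c 1) 0 := by
  have hmem : Metric.ball (0 : ℂ) r ∈ nhds 0 := Metric.ball_mem_nhds _ hr
  have hb : ∀ ε ∈ Metric.ball (0 : ℂ) r, ∀ n, ‖ε ^ n * c n‖ ≤ u n := fun ε hε n => by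
    have : ‖ε‖ ≤ r := by simpa using (Metric.mem_ball.1 hε).le
    rw [norm_mul, norm_pow]
    exact le_trans (by gcongr) (hc n)
  have hb' : ∀ n, ∀ ε ∈ Metric.ball (0 : ℂ) r, ‖ε ^ n * c (n + 1)‖ ≤ u (n + 1) / r := by
    intro n ε hε
    have : ‖ε‖ ≤ r := by simpa using (Metric.mem_ball.1 hε).le
    rw [norm_mul, norm_pow, le_div_iff₀ hr]
    calc _ ≤ r ^ n * ‖c (n + 1)‖ * r := by gcongr
      _ = r ^ (n + 1) * ‖c (n + 1)‖ := by ring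
      _ ≤ _ := hc (n + 1)
  have hd : DifferentiableAt ℂ (fun ε : ℂ => ∑' n, ε ^ n * c (n + 1)) 0 :=
    (Complex.differentiableOn_tsum_of_summable_norm (((summable_nat_add_iff 1).2 hu).div_const r)
      (fun n => by fun_prop) Metric.isOpen_ball hb').differentiableAt hmem
  have h0 : ∑' n, (0 : ℂ) ^ n * c (n + 1) = c 1 := by
    rw [tsum_eq_single 0 fun n hn => by simp [hn]]; simp
  have hder : HasDerivAt (fun ε : ℂ => c 0 + ε * ∑' n, ε ^ n * c (n + 1)) (c 1) 0 :=
    (((hasDerivAt_id (0 : ℂ)).mul hd.hasDerivAt).const_add (c 0)).congr_deriv (by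
      simp only [id, h0]; simp)
  refine hder.congr_of_eventuallyEq ?_
  filter_upwards [hmem] with ε hε
  have hs : Summable fun n => ε ^ n * c n := Summable.of_norm_bounded hu (hb ε hε)
  rw [hs.tsum_eq_zero_add, ← tsum_mul_left]
  simp only [pow_zero, one_mul]
  congr 2
  ext n; ring

theorem hasDerivAt_volterra_zero {p q r s : ℝ → ℂ} (hp : Continuous p) (hq : Continuous q)
    (hr : Continuous r) (hs : Continuous s) (a₀ b₀ : ℂ) (x : ℝ) :
    HasDerivAt (fun ε => volterraFst p q r s a₀ b₀ ε x) ((volterraIter p q r s a₀ b₀ 1).1 x) 0 ∧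
    HasDerivAt (fun ε => volterraSnd p q r s a₀ b₀ ε x) ((volterraIter p q r s a₀ b₀ 1).2 x) 0 := by
  obtain ⟨u, hu, h⟩ := exists_summable_bound hp hq hr hs a₀ b₀ |x| 1 zero_le_one
  exact ⟨hasDerivAt_tsum_pow_mul one_pos hu fun n => by simpa using (h n x le_rfl 1 (by simp)).1,
    hasDerivAt_tsum_pow_mul one_pos hu fun n => by simpa using (h n x le_rfl 1 (by simp)).2⟩

/-! ### Variation of parameters in the spectral parameter, uniformly in `M`. -/

section Dichotomy

variable {Q φ φ' ψ ψ' : ℝ → ℝ} {κ C : ℝ}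

/-- Iterates for the variation of parameters `u = a φ + b ψ` in `u'' = (Q - ε) u`. -/
def paramIter (φ ψ : ℝ → ℝ) (a₀ b₀ : ℂ) : ℕ → (ℝ → ℂ) × (ℝ → ℂ) :=
  volterraIter (fun x => (φ x * ψ x : ℂ)) (fun x => (ψ x * ψ x : ℂ)) (fun x => -(φ x * φ x : ℂ))
    (fun x => -(φ x * ψ x : ℂ)) a₀ b₀

/-- The coefficient `a` in the variation of parameters `u = a φ + b ψ`. -/
def paramFst (φ ψ : ℝ → ℝ) (a₀ b₀ ε : ℂ) (x : ℝ) : ℂ :=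
  volterraFst (fun x => (φ x * ψ x : ℂ)) (fun x => (ψ x * ψ x : ℂ)) (fun x => -(φ x * φ x : ℂ))
    (fun x => -(φ x * ψ x : ℂ)) a₀ b₀ ε x

/-- The coefficient `b` in the variation of parameters `u = a φ + b ψ`. -/
def paramSnd (φ ψ : ℝ → ℝ) (a₀ b₀ ε : ℂ) (x : ℝ) : ℂ :=
  volterraSnd (fun x => (φ x * ψ x : ℂ)) (fun x => (ψ x * ψ x : ℂ)) (fun x => -(φ x * φ x : ℂ))
    (fun x => -(φ x * ψ x : ℂ)) a₀ b₀ ε x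

theorem IsDichotomy.continuous (h : IsDichotomy Q φ φ' ψ ψ' κ C) :
    Continuous (fun x => (φ x * ψ x : ℂ)) ∧ Continuous (fun x => (ψ x * ψ x : ℂ)) ∧
    Continuous (fun x => -(φ x * φ x : ℂ)) ∧ Continuous (fun x => -(φ x * ψ x : ℂ)) := by
  have h1 := h.fst.continuous.1
  have h2 := h.snd.continuous.1
  refine ⟨?_, ?_, ?_, ?_⟩ <;> fun_prop

/-- The system reads `a' = ε ψ u`, `b' = -ε φ u`. Thus `a' φ + b' ψ = 0`, and by the Wronskian `a'
φ' + b' ψ' = -ε u`. -/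
theorem IsDichotomy.isSolOn_param (h : IsDichotomy Q φ φ' ψ ψ' κ C) (a₀ b₀ ε : ℂ) :
    IsSolOn Set.univ (fun x => (Q x : ℂ) - ε)
      (fun x => paramFst φ ψ a₀ b₀ ε x * φ x + paramSnd φ ψ a₀ b₀ ε x * ψ x)
      (fun x => paramFst φ ψ a₀ b₀ ε x * φ' x + paramSnd φ ψ a₀ b₀ ε x * ψ' x) := fun x _ => by
  obtain ⟨c1, c2, c3, c4⟩ := h.continuous
  obtain ⟨ha, hb⟩ := hasDerivAt_volterra c1 c2 c3 c4 a₀ b₀ ε x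
  obtain ⟨hφ1, hφ2⟩ := h.fst.ofReal x trivial
  obtain ⟨hψ1, hψ2⟩ := h.snd.ofReal x trivial
  have hW : (φ x * ψ' x - φ' x * ψ x : ℂ) = 1 := by exact_mod_cast h.wronskian x
  refine ⟨((ha.mul hφ1).add (hb.mul hψ1)).congr_deriv ?_,
    ((ha.mul hφ2).add (hb.mul hψ2)).congr_deriv ?_⟩ <;> simp only [paramFst, paramSnd]
  · ring
  · linear_combination -ε * (volterraFst (fun x => (φ x * ψ x : ℂ)) (fun x => (ψ x * ψ x : ℂ))
      (fun x => -(φ x * φ x : ℂ)) (fun x => -(φ x * ψ x : ℂ)) a₀ b₀ ε x * φ x +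
      volterraSnd (fun x => (φ x * ψ x : ℂ)) (fun x => (ψ x * ψ x : ℂ)) (fun x => -(φ x * φ x : ℂ))
        (fun x => -(φ x * ψ x : ℂ)) a₀ b₀ ε x * ψ x) * hW

theorem IsDichotomy.coeff_bound (h : IsDichotomy Q φ φ' ψ ψ' κ C) {t : ℝ} (ht : 0 ≤ t) :
    ‖(φ t * ψ t : ℂ)‖ ≤ C ^ 2 ∧ ‖(ψ t * ψ t : ℂ)‖ ≤ C ^ 2 * Real.exp (2 * κ * t) ∧
    ‖-(φ t * φ t : ℂ)‖ ≤ C ^ 2 * Real.exp (-(2 * κ * t)) ∧ ‖-(φ t * ψ t : ℂ)‖ ≤ C ^ 2 := by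
  obtain ⟨h1, -, h2, -⟩ := h.bound t ht
  have hC := h.pos
  have e0 : Real.exp (-(κ * t)) * Real.exp (κ * t) = 1 := by rw [← Real.exp_add]; simp
  have e1 : Real.exp (κ * t) * Real.exp (κ * t) = Real.exp (2 * κ * t) := by
    rw [← Real.exp_add]; ring_nf
  have e2 : Real.exp (-(κ * t)) * Real.exp (-(κ * t)) = Real.exp (-(2 * κ * t)) := by
    rw [← Real.exp_add]; ring_nf
  have k1 : |φ t| * |ψ t| ≤ C ^ 2 := by
    calc _ ≤ (C * Real.exp (-(κ * t))) * (C * Real.exp (κ * t)) := by gcongr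
      _ = C ^ 2 * (Real.exp (-(κ * t)) * Real.exp (κ * t)) := by ring
      _ = _ := by rw [e0, mul_one]
  have k2 : |ψ t| * |ψ t| ≤ C ^ 2 * Real.exp (2 * κ * t) := by
    calc _ ≤ (C * Real.exp (κ * t)) * (C * Real.exp (κ * t)) := by gcongr
      _ = C ^ 2 * (Real.exp (κ * t) * Real.exp (κ * t)) := by ring
      _ = _ := by rw [e1]
  have k3 : |φ t| * |φ t| ≤ C ^ 2 * Real.exp (-(2 * κ * t)) := by
    calc _ ≤ (C * Real.exp (-(κ * t))) * (C * Real.exp (-(κ * t))) := by gcongr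
      _ = C ^ 2 * (Real.exp (-(κ * t)) * Real.exp (-(κ * t))) := by ring
      _ = _ := by rw [e2]
  simp only [norm_neg, norm_mul, Complex.norm_real, Real.norm_eq_abs]
  exact ⟨k1, k2, k3, k1⟩

theorem norm_primitive_le {f : ℝ → ℂ} {K x M : ℝ} (hx : 0 ≤ x) (hM : x ≤ M) (hK : 0 ≤ K)
    (h : ∀ t, 0 ≤ t → t ≤ x → ‖f t‖ ≤ K) : ‖∫ t in (0 : ℝ)..x, f t‖ ≤ K * M := by
  have := intervalIntegral.norm_integral_le_of_norm_le_const (a := 0) (b := x) (f := f) (C := K)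
    fun t ht => by
      rw [Set.uIoc_of_le hx] at ht
      exact h t ht.1.le ht.2
  rw [sub_zero, abs_of_nonneg hx] at this
  exact this.trans (by gcongr)

theorem norm_mul_add_mul_le {a b c d : ℂ} {A B C D : ℝ} (ha : ‖a‖ ≤ A) (hb : ‖b‖ ≤ B)
    (hc : ‖c‖ ≤ C) (hd : ‖d‖ ≤ D) : ‖a * b + c * d‖ ≤ A * B + C * D := by
  have hA := (norm_nonneg _).trans ha
  have hC := (norm_nonneg _).trans hc
  refine (norm_add_le _ _).trans ?_
  rw [norm_mul, norm_mul]
  gcongr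

/-- The weights `e^{2κx}` for `a` and `1` for `b` are matched to the sizes of `φψ`, `ψ²` and `φ²`,
so one iteration costs only the factor `2C²M` and no new exponential. -/
theorem IsDichotomy.paramIter_step (h : IsDichotomy Q φ φ' ψ ψ' κ C) (hκ : 0 < κ) {a₀ b₀ : ℂ}
    {n : ℕ} {P M : ℝ} (hP : 0 ≤ P)
    (hn : ∀ x, 0 ≤ x → x ≤ M → ‖(paramIter φ ψ a₀ b₀ n).1 x‖ ≤ P * Real.exp (2 * κ * x) ∧
      ‖(paramIter φ ψ a₀ b₀ n).2 x‖ ≤ P) {x : ℝ} (hx : 0 ≤ x) (hxM : x ≤ M) :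
    ‖(paramIter φ ψ a₀ b₀ (n + 1)).1 x‖ ≤ P * (2 * C ^ 2 * M) * Real.exp (2 * κ * x) ∧
      ‖(paramIter φ ψ a₀ b₀ (n + 1)).2 x‖ ≤ P * (2 * C ^ 2 * M) := by
  constructor
  · have e : P * (2 * C ^ 2 * M) * Real.exp (2 * κ * x) =
        (P * (2 * C ^ 2) * Real.exp (2 * κ * x)) * M := by ring
    rw [e]
    refine norm_primitive_le hx hxM (by positivity) fun t h0 ht => ?_
    obtain ⟨i1, i2⟩ := hn t h0 (ht.trans hxM)
    obtain ⟨k1, k2, -, -⟩ := h.coeff_bound h0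
    have hexp : Real.exp (2 * κ * t) ≤ Real.exp (2 * κ * x) := Real.exp_le_exp.2 (by gcongr)
    calc _ ≤ C ^ 2 * (P * Real.exp (2 * κ * t)) + C ^ 2 * Real.exp (2 * κ * t) * P :=
          norm_mul_add_mul_le k1 i1 k2 i2
      _ = P * (2 * C ^ 2) * Real.exp (2 * κ * t) := by ring
      _ ≤ _ := by gcongr
  · rw [← mul_assoc]
    refine norm_primitive_le hx hxM (by positivity) fun t h0 ht => ?_
    obtain ⟨i1, i2⟩ := hn t h0 (ht.trans hxM)
    obtain ⟨-, -, k3, k4⟩ := h.coeff_bound h0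
    calc _ ≤ C ^ 2 * Real.exp (-(2 * κ * t)) * (P * Real.exp (2 * κ * t)) + C ^ 2 * P :=
          norm_mul_add_mul_le k3 i1 k4 i2
      _ = C ^ 2 * P * (Real.exp (-(2 * κ * t)) * Real.exp (2 * κ * t)) + C ^ 2 * P := by ring
      _ = P * (2 * C ^ 2) := by rw [← Real.exp_add]; simp; ring

theorem IsDichotomy.paramIter_bound_snd (h : IsDichotomy Q φ φ' ψ ψ' κ C) (hκ : 0 < κ) {M : ℝ}
    (hM : 0 ≤ M) (n : ℕ) {x : ℝ} (hx : 0 ≤ x) (hxM : x ≤ M) :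
    ‖(paramIter φ ψ 0 1 n).1 x‖ ≤ (2 * C ^ 2 * M) ^ n * Real.exp (2 * κ * x) ∧
      ‖(paramIter φ ψ 0 1 n).2 x‖ ≤ (2 * C ^ 2 * M) ^ n := by
  induction n generalizing x with
  | zero => simpa [paramIter, volterraIter] using (Real.exp_pos _).le
  | succ n ih => exact h.paramIter_step hκ (by positivity) (fun x => ih) hx hxM

theorem IsDichotomy.norm_integral_le (h : IsDichotomy Q φ φ' ψ ψ' κ C) (hκ : 0 < κ) {x : ℝ}
    (hx : 0 ≤ x) : ‖∫ t in (0 : ℝ)..x, -(φ t * φ t : ℂ)‖ ≤ C ^ 2 / (2 * κ) := by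
  have hder : ∀ t ∈ Set.uIcc 0 x, HasDerivAt
      (fun t => -(C ^ 2 / (2 * κ)) * Real.exp (-(2 * κ * t)))
      (C ^ 2 * Real.exp (-(2 * κ * t))) t := fun t _ => by
    have h0 : HasDerivAt (fun t => -(2 * κ * t)) (-(2 * κ)) t :=
      ((hasDerivAt_id t).const_mul (2 * κ)).neg.congr_deriv (by simp)
    refine (h0.exp.const_mul (-(C ^ 2 / (2 * κ)))).congr_deriv ?_
    field_simp
  have hint : IntervalIntegrable (fun t => C ^ 2 * Real.exp (-(2 * κ * t))) volume 0 x :=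
    Continuous.intervalIntegrable (by fun_prop) _ _
  refine (intervalIntegral.norm_integral_le_of_norm_le hx
    (Filter.Eventually.of_forall fun t ht => (h.coeff_bound ht.1.le).2.2.1) hint).trans ?_
  rw [intervalIntegral.integral_eq_sub_of_hasDerivAt hder hint]
  have : 0 ≤ C ^ 2 / (2 * κ) * Real.exp (-(2 * κ * x)) := by positivity
  simp only [mul_zero, neg_zero, Real.exp_zero]
  linarith

theorem IsDichotomy.paramIter_one (h : IsDichotomy Q φ φ' ψ ψ' κ C) {M : ℝ} (hM : 0 ≤ M) :
    ‖(paramIter φ ψ 1 0 1).1 M‖ ≤ C ^ 2 * M ∧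
      (paramIter φ ψ 1 0 1).2 M = -((∫ t in (0 : ℝ)..M, φ t ^ 2 : ℝ) : ℂ) := by
  constructor
  · refine norm_primitive_le hM le_rfl (by positivity) fun t h0 ht => ?_
    simpa [volterraIter] using (h.coeff_bound h0).1
  · rw [← intervalIntegral.integral_ofReal, ← intervalIntegral.integral_neg]
    simp [paramIter, volterraIter, sq]

/-- From the data `(1, 0)` the first iteration integrates the decaying `φ²` and costs no factor `M`.
This saved factor is what makes the variation of `g₀` on the disc of radius `δ/M` of order `1/M`. -/
theorem IsDichotomy.paramIter_bound_fst (h : IsDichotomy Q φ φ' ψ ψ' κ C) (hκ : 0 < κ) {M : ℝ}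
    (hM : 0 ≤ M) (n : ℕ) {x : ℝ} (hx : 0 ≤ x) (hxM : x ≤ M) :
    ‖(paramIter φ ψ 1 0 (n + 1)).1 x‖ ≤
        C ^ 2 / (2 * κ) * (2 * C ^ 2 * M) ^ n * Real.exp (2 * κ * x) ∧
      ‖(paramIter φ ψ 1 0 (n + 1)).2 x‖ ≤ C ^ 2 / (2 * κ) * (2 * C ^ 2 * M) ^ n := by
  induction n generalizing x with
  | zero =>
    rw [zero_add, pow_zero, mul_one]
    constructor
    · refine (h.paramIter_one hx).1.trans ?_
      have : 2 * κ * x ≤ Real.exp (2 * κ * x) := by linarith [Real.add_one_le_exp (2 * κ * x)]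
      calc C ^ 2 * x = C ^ 2 / (2 * κ) * (2 * κ * x) := by field_simp
        _ ≤ _ := by gcongr
    · simpa [paramIter, volterraIter] using h.norm_integral_le hκ hx
  | succ n ih =>
    rw [pow_succ (2 * C ^ 2 * M), ← mul_assoc]
    exact h.paramIter_step hκ (by positivity) (fun x => ih) hx hxM

theorem norm_tsum_pow_mul_le {c : ℕ → ℂ} {ε : ℂ} {P b : ℝ} (hP : 0 ≤ P) (hb : 0 ≤ b)
    (hc : ∀ n, ‖c n‖ ≤ P * b ^ n) (hε : ‖ε‖ * b ≤ 1 / 2) : ‖∑' n, ε ^ n * c n‖ ≤ 2 * P := by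
  have hs : HasSum (fun n : ℕ => P * (1 / 2 : ℝ) ^ n) (2 * P) := by
    simpa [mul_comm] using hasSum_geometric_two.mul_left P
  refine tsum_of_norm_bounded hs fun n => ?_
  rw [norm_mul, norm_pow]
  calc ‖ε‖ ^ n * ‖c n‖ ≤ ‖ε‖ ^ n * (P * b ^ n) := by gcongr; exact hc n
    _ = P * (‖ε‖ * b) ^ n := by rw [mul_pow]; ring
    _ ≤ _ := by gcongr

/-- The iterates are dominated by a geometric series of ratio at most 1/2. The factor `e^{2κM}` in
the first component is harmless: it later multiplies the boundary value of `φ`, which is smaller by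
`e^{-2κM}` than that of `ψ`. -/
theorem IsDichotomy.param_bound (h : IsDichotomy Q φ φ' ψ ψ' κ C) (hκ : 0 < κ) {M : ℝ}
    (hM : 0 ≤ M) {ε : ℂ} (hε : ‖ε‖ * (2 * C ^ 2 * M) ≤ 1 / 2) :
    ‖paramFst φ ψ 1 0 ε M - 1‖ ≤ ‖ε‖ * (C ^ 2 / κ) * Real.exp (2 * κ * M) ∧
    ‖paramSnd φ ψ 1 0 ε M‖ ≤ ‖ε‖ * (C ^ 2 / κ) ∧
    ‖paramFst φ ψ 0 1 ε M‖ ≤ 2 * Real.exp (2 * κ * M) ∧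
    ‖paramSnd φ ψ 0 1 ε M‖ ≤ 2 := by
  obtain ⟨c1, c2, c3, c4⟩ := h.continuous
  have hb : 0 ≤ 2 * C ^ 2 * M := by positivity
  have hs := summable_volterra c1 c2 c3 c4 1 0 ε M
  refine ⟨?_, ?_, ?_, ?_⟩
  · have e : paramFst φ ψ 1 0 ε M - 1 = ε * ∑' n, ε ^ n * (paramIter φ ψ 1 0 (n + 1)).1 M := by
      rw [paramFst, volterraFst, hs.1.tsum_eq_zero_add, ← tsum_mul_left]
      simp only [pow_zero, volterraIter, paramIter, one_mul, add_sub_cancel_left]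
      congr 1; ext n; ring
    rw [e, norm_mul]
    have := norm_tsum_pow_mul_le (P := C ^ 2 / (2 * κ) * Real.exp (2 * κ * M)) (by positivity) hb
      (fun n => ((h.paramIter_bound_fst hκ hM n hM le_rfl).1.trans_eq (by ring))) hε
    calc _ ≤ ‖ε‖ * (2 * (C ^ 2 / (2 * κ) * Real.exp (2 * κ * M))) := by gcongr
      _ = _ := by field_simp
  · have e : paramSnd φ ψ 1 0 ε M = ε * ∑' n, ε ^ n * (paramIter φ ψ 1 0 (n + 1)).2 M := by
      rw [paramSnd, volterraSnd, hs.2.tsum_eq_zero_add, ← tsum_mul_left]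
      simp only [pow_zero, volterraIter, paramIter, one_mul, zero_add]
      congr 1; ext n; ring
    rw [e, norm_mul]
    have := norm_tsum_pow_mul_le (P := C ^ 2 / (2 * κ)) (by positivity) hb
      (fun n => (h.paramIter_bound_fst hκ hM n hM le_rfl).2) hε
    calc _ ≤ ‖ε‖ * (2 * (C ^ 2 / (2 * κ))) := by gcongr
      _ = _ := by field_simp
  · exact norm_tsum_pow_mul_le (P := Real.exp (2 * κ * M)) (by positivity) hb
      (fun n => ((h.paramIter_bound_snd hκ hM n hM le_rfl).1.trans_eq (by ring))) hε
  · have := norm_tsum_pow_mul_le (P := 1) zero_le_one hb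
      (fun n => ((h.paramIter_bound_snd hκ hM n hM le_rfl).2.trans_eq (one_mul _).symm)) hε
    rwa [mul_one] at this

end Dichotomy

/-! ### The principal square root and the expansion of the boundary functionals. -/

theorem sqrt_sq (z : ℂ) : Complex.sqrt z ^ 2 = z := by
  rw [Complex.sqrt, ← Complex.cpow_nat_mul]; norm_num

theorem norm_sqrt_sq (z : ℂ) : ‖Complex.sqrt z‖ ^ 2 = ‖z‖ := by rw [← norm_pow, sqrt_sq]

theorem sqrt_ofReal {E : ℝ} (hE : 0 ≤ E) : Complex.sqrt (E : ℂ) = (Real.sqrt E : ℂ) := by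
  rw [Complex.sqrt, Real.sqrt_eq_rpow, Complex.ofReal_cpow hE]; norm_num

theorem differentiableAt_sqrt {z : ℂ} (hz : 0 < z.re) : DifferentiableAt ℂ Complex.sqrt z := by
  unfold Complex.sqrt
  exact DifferentiableAt.cpow_const (by fun_prop) (Or.inl hz)

theorem sqrt_re_pos {z : ℂ} (hz : 0 < z.re) : 0 < (Complex.sqrt z).re := by
  have hz0 : z ≠ 0 := fun h => by simp [h] at hz
  have harg := Complex.abs_arg_lt_pi_div_two_iff.2 (Or.inl hz)
  rw [Complex.sqrt, Complex.cpow_def_of_ne_zero hz0, Complex.exp_re]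
  refine mul_pos (Real.exp_pos _) (Real.cos_pos_of_mem_Ioo ?_)
  have : (Complex.log z * 2⁻¹).im = z.arg / 2 := by
    simp [Complex.mul_im, Complex.log_im]; ring
  rw [this]
  rw [abs_lt] at harg
  constructor <;> linarith [harg.1, harg.2, Real.pi_pos]

theorem re_pos_of_mem_ball {E : ℝ} {ε : ℂ} (hε : ‖ε‖ < E) : 0 < ((E : ℂ) + ε).re := by
  have := (abs_le.1 ((Complex.abs_re_le_norm ε).trans hε.le)).1
  have h2 : |ε.re| < E := (Complex.abs_re_le_norm ε).trans_lt hε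
  simp only [Complex.add_re, Complex.ofReal_re]
  linarith [(abs_lt.1 h2).1]

/-- Asymptotic description, for large `M`, of `s, ε ↦ g₀ ε + s g₁ ε`, a boundary functional
normalized by its value on the growing solution; `P` is the mass of the decaying solution. -/
structure IsExpansion (δ K κ M P : ℝ) (g₀ g₁ : ℂ → ℂ) : Prop where
  diff₀ : DifferentiableOn ℂ g₀ (Metric.ball 0 (δ / M))
  diff₁ : DifferentiableOn ℂ g₁ (Metric.ball 0 (δ / M))
  bound₀ : ∀ ε ∈ Metric.ball (0 : ℂ) (δ / M), ‖g₀ ε - g₀ 0‖ ≤ K / M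
  bound₁ : ∀ ε ∈ Metric.ball (0 : ℂ) (δ / M), ‖g₁ ε‖ ≤ K
  zero₀ : ‖g₀ 0‖ ≤ K * Real.exp (-(2 * κ * M))
  zero₁ : g₁ 0 = 1
  deriv₀ : ‖deriv g₀ 0 + P‖ ≤ K * M * Real.exp (-(2 * κ * M))

section Expansion

variable {Q φ φ' ψ ψ' : ℝ → ℝ} {κ C E : ℝ}

/-- The outgoing boundary functional at `x` with spectral parameter `E + ε`. -/
def outgoing (f f' : ℝ → ℝ) (E x : ℝ) (ε : ℂ) : ℂ :=
  f' x - Complex.I * Complex.sqrt (E + ε) * f x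

/-- At `ε = 0` everything is real except the factor `i`, so the functional controls `ψ'(M)` and
`ψ(M)` separately. The Wronskian 1 together with the decay of `φ` and `φ'` prevents both from being
small. -/
theorem IsDichotomy.outgoing_ge (h : IsDichotomy Q φ φ' ψ ψ' κ C) (hE : 0 < E) {M : ℝ}
    (hM : 0 ≤ M) : Real.exp (κ * M) ≤ C * (1 + 1 / Real.sqrt E) * ‖outgoing ψ ψ' E M 0‖ := by
  have hs := Real.sqrt_pos.2 hE
  have hC := h.pos
  have hre : |ψ' M| ≤ ‖outgoing ψ ψ' E M 0‖ := by
    have := Complex.abs_re_le_norm (outgoing ψ ψ' E M 0)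
    simpa [outgoing, sqrt_ofReal hE.le] using this
  have him : Real.sqrt E * |ψ M| ≤ ‖outgoing ψ ψ' E M 0‖ := by
    have := Complex.abs_im_le_norm (outgoing ψ ψ' E M 0)
    simpa [outgoing, sqrt_ofReal hE.le, abs_mul, abs_of_pos hs] using this
  set t := ‖outgoing ψ ψ' E M 0‖
  have him' : |ψ M| ≤ 1 / Real.sqrt E * t := by
    rw [one_div, inv_mul_eq_div, le_div_iff₀ hs]; linarith
  obtain ⟨h1, h2, -, -⟩ := h.bound M hM
  have hW := h.wronskian M
  have : 1 ≤ C * Real.exp (-(κ * M)) * t + C * Real.exp (-(κ * M)) * (1 / Real.sqrt E * t) := by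
    calc (1 : ℝ) = |φ M * ψ' M - φ' M * ψ M| := by rw [hW, abs_one]
      _ ≤ |φ M| * |ψ' M| + |φ' M| * |ψ M| := by rw [← abs_mul, ← abs_mul]; exact abs_sub _ _
      _ ≤ _ := by gcongr
  have e : Real.exp (-(κ * M)) * Real.exp (κ * M) = 1 := by rw [← Real.exp_add]; simp
  calc Real.exp (κ * M) = 1 * Real.exp (κ * M) := (one_mul _).symm
    _ ≤ (C * Real.exp (-(κ * M)) * t + C * Real.exp (-(κ * M)) * (1 / Real.sqrt E * t)) *
        Real.exp (κ * M) := by gcongr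
    _ = C * (1 + 1 / Real.sqrt E) * t * (Real.exp (-(κ * M)) * Real.exp (κ * M)) := by ring
    _ = _ := by rw [e, mul_one]

theorem norm_outgoing_le {f f' : ℝ → ℝ} {x B : ℝ} {ε : ℂ} (hE : 0 < E) (hε : ‖ε‖ ≤ E)
    (h1 : |f x| ≤ B) (h2 : |f' x| ≤ B) :
    ‖outgoing f f' E x ε‖ ≤ B * (1 + Real.sqrt (2 * E)) := by
  have hB : 0 ≤ B := (abs_nonneg _).trans h1
  have hs : ‖Complex.sqrt (E + ε)‖ ≤ Real.sqrt (2 * E) := by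
    refine Real.le_sqrt_of_sq_le ?_
    rw [norm_sqrt_sq]
    refine (norm_add_le _ _).trans ?_
    rw [Complex.norm_real, Real.norm_of_nonneg hE.le]; linarith
  calc _ ≤ ‖(f' x : ℂ)‖ + ‖Complex.I * Complex.sqrt (E + ε) * f x‖ := norm_sub_le _ _
    _ = |f' x| + ‖Complex.sqrt (E + ε)‖ * |f x| := by simp
    _ ≤ B + Real.sqrt (2 * E) * B := by gcongr
    _ = _ := by ring

theorem hasDerivAt_outgoing (f f' : ℝ → ℝ) (x : ℝ) {ε : ℂ} (hε : ‖ε‖ < E) :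
    HasDerivAt (outgoing f f' E x)
      (-(Complex.I * deriv (fun ε : ℂ => Complex.sqrt (E + ε)) ε * f x)) ε := by
  have hd : DifferentiableAt ℂ (fun ε : ℂ => Complex.sqrt (E + ε)) ε :=
    (differentiableAt_sqrt (re_pos_of_mem_ball hε)).comp ε (by fun_prop)
  exact (((hd.hasDerivAt.const_mul Complex.I).mul_const (f x : ℂ)).const_sub (f' x : ℂ))

theorem mul_exp_neg_le {a M : ℝ} (ha : 0 < a) : M * Real.exp (-(a * M)) ≤ 1 / a := by
  rw [Real.exp_neg, ← div_eq_mul_inv, div_le_div_iff₀ (Real.exp_pos _) ha]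
  linarith [Real.add_one_le_exp (a * M)]

theorem IsDichotomy.exists_expansion (h : IsDichotomy Q φ φ' ψ ψ' κ C) (hQ : Continuous Q)
    (hκ : 0 < κ) (hE : 0 < E) :
    ∃ δ K : ℝ, 0 < δ ∧ δ < E ∧ 0 < K ∧ ∀ M : ℝ, 1 ≤ M → ∃ (θ : ℂ) (g₀ g₁ : ℂ → ℂ), θ ≠ 0 ∧
      IsExpansion δ K κ M (∫ t in (0 : ℝ)..M, φ t ^ 2) g₀ g₁ ∧
      ∀ (ε s : ℂ) (u v : ℝ → ℂ), ‖ε‖ < δ / M → IsSolOn Set.univ (fun x => (Q x : ℂ) - ε) u v →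
        u 0 = φ 0 + s * ψ 0 → v 0 = φ' 0 + s * ψ' 0 →
        v M - Complex.I * Complex.sqrt (E + ε) * u M = θ * (g₀ ε + s * g₁ ε) := by
  have hC := h.pos
  have hsE := Real.sqrt_pos.2 hE
  obtain ⟨c1, c2, c3, c4⟩ := h.continuous
  set Θ₀ := C * (1 + 1 / Real.sqrt E) with hΘ₀
  have hΘ₀pos : 0 < Θ₀ := by positivity
  set K₁ := C * (1 + Real.sqrt (2 * E)) * Θ₀ with hK₁
  have hK₁pos : 0 < K₁ := by positivity
  set σ := ‖deriv (fun ε : ℂ => Complex.sqrt (E + ε)) 0‖ with hσ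
  have hσ0 : 0 ≤ σ := norm_nonneg _
  -- The first entry keeps `E + ε` in the right half plane, where the root is analytic; the second
  -- makes `‖ε‖ * (2 * C ^ 2 * M) ≤ 1 / 2` on the disc of radius `δ / M`.
  set δ := min (E / 2) (1 / (4 * C ^ 2)) with hδ
  have hδpos : 0 < δ := by positivity
  have hδE : δ < E := (min_le_left _ _).trans_lt (by linarith)
  -- The first two terms serve `bound₀`, the term `4 * K₁` serves `bound₁` and `zero₀`, the last two
  -- serve `deriv₀`.
  set K := 2 * (δ * (C ^ 2 / κ) * K₁) + 2 * K₁ * (1 / (2 * κ)) + 4 * K₁ + C ^ 2 * K₁ + σ * C * Θ₀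
    with hK
  have hKpos : 0 < K := by positivity
  refine ⟨δ, K, hδpos, hδE, hKpos, fun M hM1 => ?_⟩
  have hM0 : 0 < M := by linarith
  have hδM : δ / M ≤ δ := div_le_self hδpos.le hM1
  set w := Real.exp (-(2 * κ * M)) with hw
  have hwpos : 0 < w := Real.exp_pos _
  set θ := outgoing ψ ψ' E M 0 with hθ
  have hge : Real.exp (κ * M) ≤ Θ₀ * ‖θ‖ := h.outgoing_ge hE hM0.le
  have hθ0 : θ ≠ 0 := fun h0 => by
    rw [h0, norm_zero, mul_zero] at hge
    exact absurd (Real.exp_pos (κ * M)) (not_lt.2 hge)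
  have hθpos : 0 < ‖θ‖ := norm_pos_iff.2 hθ0
  obtain ⟨b1, b2, b3, b4⟩ := h.bound M hM0.le
  have ee : Real.exp (-(κ * M)) = w * Real.exp (κ * M) := by
    rw [hw, ← Real.exp_add]; ring_nf
  have hTφ : ∀ ε : ℂ, ‖ε‖ ≤ E → ‖outgoing φ φ' E M ε / θ‖ ≤ K₁ * w := fun ε hε => by
    rw [norm_div, div_le_iff₀ hθpos]
    calc _ ≤ C * Real.exp (-(κ * M)) * (1 + Real.sqrt (2 * E)) := norm_outgoing_le hE hε b1 b2
      _ = C * (1 + Real.sqrt (2 * E)) * w * Real.exp (κ * M) := by rw [ee]; ring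
      _ ≤ C * (1 + Real.sqrt (2 * E)) * w * (Θ₀ * ‖θ‖) := by gcongr
      _ = _ := by rw [hK₁]; ring
  have hTψ : ∀ ε : ℂ, ‖ε‖ ≤ E → ‖outgoing ψ ψ' E M ε / θ‖ ≤ K₁ := fun ε hε => by
    rw [norm_div, div_le_iff₀ hθpos]
    calc _ ≤ C * Real.exp (κ * M) * (1 + Real.sqrt (2 * E)) := norm_outgoing_le hE hε b3 b4
      _ = C * (1 + Real.sqrt (2 * E)) * Real.exp (κ * M) := by ring
      _ ≤ C * (1 + Real.sqrt (2 * E)) * (Θ₀ * ‖θ‖) := by gcongr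
      _ = _ := by rw [hK₁]; ring
  have hφθ : ‖(φ M : ℂ) / θ‖ ≤ C * Θ₀ * w := by
    rw [norm_div, div_le_iff₀ hθpos, Complex.norm_real, Real.norm_eq_abs]
    calc _ ≤ C * Real.exp (-(κ * M)) := b1
      _ = C * w * Real.exp (κ * M) := by rw [ee]; ring
      _ ≤ C * w * (Θ₀ * ‖θ‖) := by gcongr
      _ = _ := by ring
  have hsmall : ∀ ε ∈ Metric.ball (0 : ℂ) (δ / M), ‖ε‖ < E ∧ ‖ε‖ ≤ δ / M ∧
      ‖ε‖ * (2 * C ^ 2 * M) ≤ 1 / 2 := fun ε hε => by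
    have h1 : ‖ε‖ < δ / M := by simpa using hε
    refine ⟨h1.trans_le (hδM.trans hδE.le), h1.le, ?_⟩
    calc _ ≤ δ / M * (2 * C ^ 2 * M) := by gcongr
      _ = δ * (2 * C ^ 2) := by field_simp
      _ ≤ 1 / (4 * C ^ 2) * (2 * C ^ 2) := by gcongr; exact min_le_right _ _
      _ = 1 / 2 := by field_simp; norm_num
  set g₀ : ℂ → ℂ := fun ε => paramFst φ ψ 1 0 ε M * (outgoing φ φ' E M ε / θ) +
    paramSnd φ ψ 1 0 ε M * (outgoing ψ ψ' E M ε / θ) with hg₀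
  set g₁ : ℂ → ℂ := fun ε => paramFst φ ψ 0 1 ε M * (outgoing φ φ' E M ε / θ) +
    paramSnd φ ψ 0 1 ε M * (outgoing ψ ψ' E M ε / θ) with hg₁
  have hdiff : ∀ a₀ b₀ : ℂ, DifferentiableOn ℂ (fun ε =>
      paramFst φ ψ a₀ b₀ ε M * (outgoing φ φ' E M ε / θ) +
      paramSnd φ ψ a₀ b₀ ε M * (outgoing ψ ψ' E M ε / θ)) (Metric.ball 0 (δ / M)) := by
    intro a₀ b₀ ε hε
    obtain ⟨d1, d2⟩ := differentiable_volterra c1 c2 c3 c4 a₀ b₀ M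
    have o1 := (hasDerivAt_outgoing φ φ' M (hsmall ε hε).1).differentiableAt
    have o2 := (hasDerivAt_outgoing ψ ψ' M (hsmall ε hε).1).differentiableAt
    exact (((d1 ε).mul (o1.div_const θ)).add ((d2 ε).mul (o2.div_const θ))).differentiableWithinAt
  have hmem0 : (0 : ℂ) ∈ Metric.ball (0 : ℂ) (δ / M) := Metric.mem_ball_self (by positivity)
  have hz1 := h.param_bound hκ hM0.le (hsmall 0 hmem0).2.2
  simp only [norm_zero, zero_mul, norm_le_zero_iff, sub_eq_zero] at hz1
  have hA0 : paramFst φ ψ 0 1 0 M = 0 ∧ paramSnd φ ψ 0 1 0 M = 1 := by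
    constructor
    · rw [paramFst, volterraFst, tsum_eq_single 0 fun n hn => by simp [hn]]; simp [volterraIter]
    · rw [paramSnd, volterraSnd, tsum_eq_single 0 fun n hn => by simp [hn]]; simp [volterraIter]
  have hg0 : g₀ 0 = outgoing φ φ' E M 0 / θ := by simp [hg₀, hz1.1, hz1.2.1]
  have hMw : M * w ≤ 1 / (2 * κ) := mul_exp_neg_le (by positivity)
  have hwM : w ≤ 1 / (2 * κ) / M := by rw [le_div_iff₀ hM0]; linarith
  have hwexp : w * Real.exp (2 * κ * M) = 1 := by rw [hw, ← Real.exp_add]; simp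
  refine ⟨θ, g₀, g₁, hθ0, ⟨hdiff 1 0, hdiff 0 1, fun ε hε => ?_, fun ε hε => ?_, ?_, ?_, ?_⟩, ?_⟩
  · obtain ⟨s1, s2, s3⟩ := hsmall ε hε
    obtain ⟨p1, p2, -, -⟩ := h.param_bound hκ hM0.le s3
    have e : g₀ ε - g₀ 0 = (paramFst φ ψ 1 0 ε M - 1) * (outgoing φ φ' E M ε / θ) +
        paramSnd φ ψ 1 0 ε M * (outgoing ψ ψ' E M ε / θ) +
        (outgoing φ φ' E M ε / θ - outgoing φ φ' E M 0 / θ) := by rw [hg0]; simp only [hg₀]; ring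
    rw [e]
    calc _ ≤ (‖ε‖ * (C ^ 2 / κ) * Real.exp (2 * κ * M) * (K₁ * w) + ‖ε‖ * (C ^ 2 / κ) * K₁) +
          (K₁ * w + K₁ * w) :=
          (norm_add_le _ _).trans (add_le_add
            (norm_mul_add_mul_le p1 (hTφ ε s1.le) p2 (hTψ ε s1.le))
            ((norm_sub_le _ _).trans (add_le_add (hTφ ε s1.le) (hTφ 0 (by simpa using hE.le)))))
      _ = ‖ε‖ * (C ^ 2 / κ) * K₁ * (w * Real.exp (2 * κ * M)) + ‖ε‖ * (C ^ 2 / κ) * K₁ +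
          2 * K₁ * w := by ring
      _ = 2 * (‖ε‖ * (C ^ 2 / κ) * K₁) + 2 * K₁ * w := by rw [hwexp]; ring
      _ ≤ 2 * (δ / M * (C ^ 2 / κ) * K₁) + 2 * K₁ * (1 / (2 * κ) / M) := by gcongr
      _ = (2 * (δ * (C ^ 2 / κ) * K₁) + 2 * K₁ * (1 / (2 * κ))) / M := by field_simp
      _ ≤ K / M := by
          gcongr
          have : 0 ≤ 4 * K₁ + C ^ 2 * K₁ + σ * C * Θ₀ := by positivity
          rw [hK]; linarith
  · obtain ⟨s1, s2, s3⟩ := hsmall ε hε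
    obtain ⟨-, -, p3, p4⟩ := h.param_bound hκ hM0.le s3
    calc _ ≤ 2 * Real.exp (2 * κ * M) * (K₁ * w) + 2 * K₁ :=
          norm_mul_add_mul_le p3 (hTφ ε s1.le) p4 (hTψ ε s1.le)
      _ = 2 * K₁ * (w * Real.exp (2 * κ * M)) + 2 * K₁ := by ring
      _ = 4 * K₁ := by rw [hwexp]; ring
      _ ≤ K := by
          have : 0 ≤ 2 * (δ * (C ^ 2 / κ) * K₁) + 2 * K₁ * (1 / (2 * κ)) + C ^ 2 * K₁ +
            σ * C * Θ₀ := by positivity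
          rw [hK]; linarith
  · rw [hg0]
    refine (hTφ 0 (by simpa using hE.le)).trans ?_
    gcongr
    have : 0 ≤ 2 * (δ * (C ^ 2 / κ) * K₁) + 2 * K₁ * (1 / (2 * κ)) + 3 * K₁ + C ^ 2 * K₁ +
      σ * C * Θ₀ := by positivity
    rw [hK]; linarith
  · simp only [hg₁, hA0.1, hA0.2, zero_mul, one_mul, zero_add]
    exact div_self hθ0
  · obtain ⟨d1, d2⟩ := hasDerivAt_volterra_zero c1 c2 c3 c4 1 0 M
    obtain ⟨i1, i2⟩ := h.paramIter_one hM0.le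
    have hE0 : ‖(0 : ℂ)‖ < E := by simpa using hE
    have o1 := (hasDerivAt_outgoing φ φ' M hE0).div_const θ
    have o2 := (hasDerivAt_outgoing ψ ψ' M hE0).div_const θ
    have hder := ((d1.mul o1).add (d2.mul o2)).deriv
    -- At `ε = 0` the coefficients are `(1, 0)`, and the derivative of the second is `-∫ φ²`,
    -- multiplied by the normalized value 1 of the functional on `ψ`. What remains contains a
    -- boundary value of `φ` and is exponentially small.
    have e : deriv g₀ 0 + ((∫ t in (0 : ℝ)..M, φ t ^ 2 : ℝ) : ℂ) =
        (paramIter φ ψ 1 0 1).1 M * (outgoing φ φ' E M 0 / θ) +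
        -(Complex.I * deriv (fun ε : ℂ => Complex.sqrt (E + ε)) 0) * (φ M / θ) := by
      have hθθ : outgoing ψ ψ' E M 0 / θ = 1 := div_self hθ0
      have i2' : (volterraIter (fun x => (φ x * ψ x : ℂ)) (fun x => (ψ x * ψ x : ℂ))
        (fun x => -(φ x * φ x : ℂ)) (fun x => -(φ x * ψ x : ℂ)) 1 0 1).2 M =
          -((∫ t in (0 : ℝ)..M, φ t ^ 2 : ℝ) : ℂ) := i2
      refine (congrArg (· + _) hder).trans ?_
      have z1 : volterraFst (fun x => (φ x * ψ x : ℂ)) (fun x => (ψ x * ψ x : ℂ))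
        (fun x => -(φ x * φ x : ℂ)) (fun x => -(φ x * ψ x : ℂ)) 1 0 0 M = 1 := hz1.1
      have z2 : volterraSnd (fun x => (φ x * ψ x : ℂ)) (fun x => (ψ x * ψ x : ℂ))
        (fun x => -(φ x * φ x : ℂ)) (fun x => -(φ x * ψ x : ℂ)) 1 0 0 M = 0 := hz1.2.1
      rw [z1, z2, hθθ, i2', paramIter]
      ring
    rw [e]
    calc _ ≤ C ^ 2 * M * (K₁ * w) + σ * (C * Θ₀ * w) :=
          norm_mul_add_mul_le i1 (hTφ 0 (by simpa using hE.le)) (by simp [hσ]) hφθ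
      _ ≤ C ^ 2 * M * (K₁ * w) + σ * (C * Θ₀ * w) * M := by
          have : σ * (C * Θ₀ * w) ≤ σ * (C * Θ₀ * w) * M :=
            le_mul_of_one_le_right (by positivity) hM1
          linarith
      _ = (C ^ 2 * K₁ + σ * C * Θ₀) * M * w := by ring
      _ ≤ K * M * w := by
          gcongr
          have : 0 ≤ 2 * (δ * (C ^ 2 / κ) * K₁) + 2 * K₁ * (1 / (2 * κ)) + 4 * K₁ := by positivity
          rw [hK]; linarith
  · intro ε s u v hε hu hu0 hv0
    have hp := (h.isSolOn_param 1 0 ε).linearCombination (h.isSolOn_param 0 1 ε) 1 s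
    have z1 := volterra_zero (p := fun x => (φ x * ψ x : ℂ)) (q := fun x => (ψ x * ψ x : ℂ))
      (r := fun x => -(φ x * φ x : ℂ)) (s := fun x => -(φ x * ψ x : ℂ)) 1 0 ε
    have z2 := volterra_zero (p := fun x => (φ x * ψ x : ℂ)) (q := fun x => (ψ x * ψ x : ℂ))
      (r := fun x => -(φ x * φ x : ℂ)) (s := fun x => -(φ x * ψ x : ℂ)) 0 1 ε
    obtain ⟨e1, e2⟩ := hu.eq_of_eq (by fun_prop) hp isOpen_univ isPreconnected_univ (x₀ := 0) (x := M)
      trivial trivial (by rw [hu0]; simp only [paramFst, paramSnd, z1, z2]; ring)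
      (by rw [hv0]; simp only [paramFst, paramSnd, z1, z2]; ring)
    rw [e1, e2]
    simp only [hg₀, hg₁, outgoing]
    field_simp
    ring

end Expansion

/-! ### Quadratic contractions and Cauchy estimates. -/

/-- A quadratic perturbation of a constant map has a unique small fixed point. -/
theorem exists_unique_fixedPoint {X : Type*} [NormedAddCommGroup X] [CompleteSpace X]
    {N : X} {P : X → X} {L r : ℝ} (hL : 0 ≤ L) (hr : 0 ≤ r) (hP0 : P 0 = 0)
    (hP : ∀ x y, ‖x‖ ≤ r → ‖y‖ ≤ r → ‖P x - P y‖ ≤ L * max ‖x‖ ‖y‖ * ‖x - y‖)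
    (hLr : L * r ≤ 1 / 2) (hN : ‖N‖ ≤ r / 2) :
    ∃ x, ‖x‖ ≤ r ∧ x = N + P x ∧ (∀ y, ‖y‖ ≤ r → y = N + P y → y = x) ∧
      ‖x - N‖ ≤ 4 * L * ‖N‖ ^ 2 := by
  have hlip : ∀ x y, ‖x‖ ≤ r → ‖y‖ ≤ r → ‖P x - P y‖ ≤ 1 / 2 * ‖x - y‖ := fun x y hx hy =>
    (hP x y hx hy).trans (by
      gcongr
      exact (mul_le_mul_of_nonneg_left (max_le hx hy) hL).trans hLr)
  have hquad : ∀ x, ‖x‖ ≤ r → ‖P x‖ ≤ L * ‖x‖ * ‖x‖ := fun x hx => by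
    simpa [hP0] using hP x 0 hx (by simpa using hr)
  have hhalf : ∀ x, ‖x‖ ≤ r → ‖P x‖ ≤ 1 / 2 * ‖x‖ := fun x hx => by
    simpa [hP0] using hlip x 0 hx (by simpa using hr)
  have hmaps : Set.MapsTo (fun x => N + P x) (Metric.closedBall 0 r) (Metric.closedBall 0 r) := by
    intro x hx
    rw [mem_closedBall_zero_iff] at hx ⊢
    linarith [norm_add_le N (P x), hhalf x hx]
  have hcontr : ContractingWith (1 / 2) (hmaps.restrict _ _ _) := by
    refine ⟨by norm_num, LipschitzWith.of_dist_le_mul fun x y => ?_⟩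
    have hx := mem_closedBall_zero_iff.1 x.2
    have hy := mem_closedBall_zero_iff.1 y.2
    have := hlip x y hx hy
    simpa [Subtype.dist_eq, dist_eq_norm] using this
  obtain ⟨x, hx, hfix, -⟩ := hcontr.exists_fixedPoint' Metric.isClosed_closedBall.isComplete hmaps
    (Metric.mem_closedBall_self hr) (edist_ne_top _ _)
  rw [mem_closedBall_zero_iff] at hx
  have hfix' : x = N + P x := hfix.symm
  refine ⟨x, hx, hfix', fun y hy hyf => ?_, ?_⟩
  · have h1 := hlip y x hy hx
    have h2 : y - x = P y - P x := by
      nth_rewrite 1 [hyf]; nth_rewrite 1 [hfix']; abel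
    rw [← h2] at h1
    exact sub_eq_zero.1 (norm_le_zero_iff.1 (by linarith))
  · have h1 : x - N = P x := by nth_rewrite 1 [hfix']; abel
    have h2 : ‖x‖ ≤ 2 * ‖N‖ := by
      have := norm_add_le N (P x)
      rw [← hfix'] at this
      linarith [hhalf x hx]
    rw [h1]
    calc _ ≤ L * ‖x‖ * ‖x‖ := hquad x hx
      _ ≤ L * (2 * ‖N‖) * (2 * ‖N‖) := by gcongr
      _ = _ := by ring

section Cauchy

variable {g : ℂ → ℂ} {R B : ℝ} {c : ℂ}

/-- Cauchy's estimate on the circle of radius `R / 4` about `ε`, which stays inside the ball.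
Subtracting a constant `c` lets the small oscillation of `g₀` be used in place of its size. -/
theorem norm_deriv_le_of_ball (hR : 0 < R) (hg : DifferentiableOn ℂ g (Metric.ball 0 R))
    (hB : ∀ ε ∈ Metric.ball (0 : ℂ) R, ‖g ε - c‖ ≤ B) {ε : ℂ} (hε : ‖ε‖ < R / 2) :
    ‖deriv g ε‖ ≤ 4 * B / R := by
  have hsub : Metric.closedBall ε (R / 4) ⊆ Metric.ball 0 R := fun z hz => by
    rw [mem_closedBall_iff_norm] at hz
    rw [mem_ball_zero_iff]
    have := norm_add_le (z - ε) ε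
    rw [sub_add_cancel] at this
    linarith
  have hd : DifferentiableOn ℂ (fun ε => g ε - c) (Metric.closedBall ε (R / 4)) :=
    (hg.sub_const c).mono hsub
  have := Complex.norm_deriv_le_of_forall_mem_sphere_norm_le (by positivity : 0 < R / 4)
    (hd.diffContOnCl_ball subset_rfl) fun z hz => hB z (hsub (Metric.sphere_subset_closedBall hz))
  rw [deriv_sub_const] at this
  exact this.trans_eq (by field_simp)

theorem norm_sub_le_of_ball (hR : 0 < R) (hg : DifferentiableOn ℂ g (Metric.ball 0 R))
    (hB : ∀ ε ∈ Metric.ball (0 : ℂ) R, ‖g ε - c‖ ≤ B) {x y : ℂ} (hx : ‖x‖ < R / 2)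
    (hy : ‖y‖ < R / 2) : ‖g x - g y‖ ≤ 4 * B / R * ‖x - y‖ := by
  have hsub : Metric.ball (0 : ℂ) (R / 2) ⊆ Metric.ball 0 R := Metric.ball_subset_ball (by linarith)
  refine (convex_ball (0 : ℂ) (R / 2)).norm_image_sub_le_of_norm_deriv_le
    (fun z hz => hg.differentiableAt (Metric.isOpen_ball.mem_nhds (hsub hz)))
    (fun z hz => norm_deriv_le_of_ball hR hg hB (by simpa using hz)) ?_ ?_ <;> simpa

/-- The mean value inequality for `g z - g'(0) z`. Applying the previous estimate to `g'` on the
ball of radius `R / 2` gives the Lipschitz constant `4 (4B/R) / (R/2) = 32 B / R²`. -/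
theorem norm_sub_sub_deriv_mul_le (hR : 0 < R) (hg : DifferentiableOn ℂ g (Metric.ball 0 R))
    (hB : ∀ ε ∈ Metric.ball (0 : ℂ) R, ‖g ε - c‖ ≤ B) {x y : ℂ} {m : ℝ} (hx : ‖x‖ ≤ m)
    (hy : ‖y‖ ≤ m) (hm : m < R / 4) :
    ‖g x - g y - deriv g 0 * (x - y)‖ ≤ 32 * B / R ^ 2 * m * ‖x - y‖ := by
  have hR2 : 0 < R / 2 := by positivity
  have hsub : Metric.ball (0 : ℂ) (R / 2) ⊆ Metric.ball 0 R := Metric.ball_subset_ball (by linarith)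
  have hg' : DifferentiableOn ℂ (deriv g) (Metric.ball 0 (R / 2)) :=
    (hg.mono hsub).deriv Metric.isOpen_ball
  have hB0 : 0 ≤ B := (norm_nonneg _).trans (hB 0 (Metric.mem_ball_self hR))
  have hderiv : ∀ z ∈ Metric.closedBall (0 : ℂ) m, ‖deriv g z - deriv g 0‖ ≤ 32 * B / R ^ 2 * m := by
    intro z hz
    have hz' : ‖z‖ ≤ m := by simpa using hz
    have h1 := norm_sub_le_of_ball hR2 hg' (c := 0) (B := 4 * B / R) (fun ε hε => by
      rw [sub_zero]; exact norm_deriv_le_of_ball hR hg hB (by simpa using hε)) (x := z) (y := 0)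
      (by linarith) (by simpa using by linarith)
    rw [sub_zero] at h1
    calc _ ≤ 4 * (4 * B / R) / (R / 2) * ‖z‖ := h1
      _ = 32 * B / R ^ 2 * ‖z‖ := by field_simp; ring
      _ ≤ _ := by gcongr
  have hd : ∀ z ∈ Metric.closedBall (0 : ℂ) m,
      HasDerivWithinAt (fun z => g z - deriv g 0 * z) (deriv g z - deriv g 0)
        (Metric.closedBall 0 m) z := fun z hz => by
    have hz' : ‖z‖ ≤ m := by simpa using hz
    have h1 : HasDerivAt g (deriv g z) z := (hg.differentiableAt
      (Metric.isOpen_ball.mem_nhds (by rw [mem_ball_zero_iff]; linarith))).hasDerivAt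
    exact ((h1.sub ((hasDerivAt_id z).const_mul (deriv g 0))).congr_deriv (by simp)).hasDerivWithinAt
  have := (convex_closedBall (0 : ℂ) m).norm_image_sub_le_of_norm_hasDerivWithin_le hd hderiv
    (x := y) (y := x) (by simpa) (by simpa)
  refine le_of_eq_of_le (congrArg norm ?_) this
  ring

end Cauchy

/-! ### Newton's method for the normalized pair of equations. -/

theorem C2.norm_le (x : C2) : ‖x‖ ≤ ‖x 0‖ + ‖x 1‖ := by
  rw [EuclideanSpace.norm_eq, Fin.sum_univ_two]
  refine Real.sqrt_le_iff.2 ⟨by positivity, ?_⟩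
  nlinarith [norm_nonneg (x 0), norm_nonneg (x 1)]

/-- The value at `ζ = (s, ε)` of `s, ε ↦ g₀ ε + s g₁ ε` minus its affine approximation at `0`. -/
def remainder (g₀ g₁ : ℂ → ℂ) (ζ : C2) : ℂ :=
  g₀ (ζ 1) - g₀ 0 - deriv g₀ 0 * ζ 1 + ζ 0 * (g₁ (ζ 1) - 1)

theorem IsExpansion.norm_deriv_le {δ K κ M P : ℝ} {g₀ g₁ : ℂ → ℂ}
    (h : IsExpansion δ K κ M P g₀ g₁) (hδ : 0 < δ) (hM : 0 < M) : ‖deriv g₀ 0‖ ≤ 4 * K / δ := by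
  have := norm_deriv_le_of_ball (by positivity) h.diff₀ h.bound₀ (ε := 0)
    (by simpa using by positivity)
  exact this.trans_eq (by field_simp)

/-- With radius `δ / M`, the Taylor remainder of `g₀` costs `(K/M) / (δ/M)²` and the mixed term `s
(g₁ - 1)` costs `K / (δ/M)`; both are of order `M`. -/
theorem IsExpansion.remainder_sub_le {δ K κ M P r : ℝ} {g₀ g₁ : ℂ → ℂ}
    (h : IsExpansion δ K κ M P g₀ g₁) (hδ : 0 < δ) (hM : 0 < M) (hr : r < δ / M / 4) {x y : C2}
    (hx : ‖x‖ ≤ r) (hy : ‖y‖ ≤ r) :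
    ‖remainder g₀ g₁ x - remainder g₀ g₁ y‖ ≤
      (32 * K / δ ^ 2 + 8 * K / δ) * M * max ‖x‖ ‖y‖ * ‖x - y‖ := by
  have hR : 0 < δ / M := by positivity
  set m := max ‖x‖ ‖y‖ with hm
  have hx0 := (PiLp.norm_apply_le x 0).trans (le_max_left ‖x‖ ‖y‖)
  have hx1 := (PiLp.norm_apply_le x 1).trans (le_max_left ‖x‖ ‖y‖)
  have hy0 := (PiLp.norm_apply_le y 0).trans (le_max_right ‖x‖ ‖y‖)
  have hy1 := (PiLp.norm_apply_le y 1).trans (le_max_right ‖x‖ ‖y‖)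
  have hd0 : ‖x 0 - y 0‖ ≤ ‖x - y‖ := PiLp.norm_apply_le (x - y) 0
  have hd1 : ‖x 1 - y 1‖ ≤ ‖x - y‖ := PiLp.norm_apply_le (x - y) 1
  have hmr : m ≤ r := max_le hx hy
  have hm0 : 0 ≤ m := (norm_nonneg _).trans (le_max_left _ _)
  have hK : 0 ≤ K := (norm_nonneg _).trans (h.bound₁ 0 (Metric.mem_ball_self hR))
  rw [← hm] at hx0 hx1 hy0 hy1
  have e1 := norm_sub_sub_deriv_mul_le hR h.diff₀ h.bound₀ hx1 hy1 (by linarith)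
  have hb1 : ∀ ε ∈ Metric.ball (0 : ℂ) (δ / M), ‖g₁ ε - 0‖ ≤ K := by simpa using h.bound₁
  have e2 := norm_sub_le_of_ball hR h.diff₁ hb1 (x := x 1) (y := 0) (by linarith)
    (by simpa using by positivity)
  have e3 := norm_sub_le_of_ball hR h.diff₁ hb1 (x := x 1) (y := y 1) (by linarith) (by linarith)
  rw [h.zero₁, sub_zero] at e2
  have e : remainder g₀ g₁ x - remainder g₀ g₁ y =
      (g₀ (x 1) - g₀ (y 1) - deriv g₀ 0 * (x 1 - y 1)) +
      ((x 0 - y 0) * (g₁ (x 1) - 1) + y 0 * (g₁ (x 1) - g₁ (y 1))) := by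
    simp only [remainder]; ring
  rw [e]
  calc _ ≤ 32 * (K / M) / (δ / M) ^ 2 * m * ‖x - y‖ + (‖x - y‖ * (4 * K / (δ / M) * m) +
        m * (4 * K / (δ / M) * ‖x - y‖)) :=
        (norm_add_le _ _).trans (add_le_add (e1.trans (by gcongr))
          (norm_mul_add_mul_le hd0 (e2.trans (by gcongr)) hy0 (e3.trans (by gcongr))))
    _ = _ := by field_simp; ring

/-- Solution of `a + p b = y₁`, `a + q b = y₂`. -/
def solveLinear (p q y₁ y₂ : ℂ) : C2 := !₂[(q - p)⁻¹ * (q * y₁ - p * y₂), (q - p)⁻¹ * (y₂ - y₁)]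

theorem norm_solveLinear_le {p q y₁ y₂ : ℂ} {c H : ℝ} (hc : 0 < c) (hpq : c ≤ ‖q - p‖)
    (hp : ‖p‖ ≤ H) (hq : ‖q‖ ≤ H) :
    ‖solveLinear p q y₁ y₂‖ ≤ (H + 1) / c * (‖y₁‖ + ‖y₂‖) := by
  have hH : 0 ≤ H := (norm_nonneg _).trans hp
  have hinv : ‖(q - p)⁻¹‖ ≤ 1 / c := by rw [norm_inv, ← one_div]; gcongr
  have h0 : ‖q * y₁ - p * y₂‖ ≤ H * ‖y₁‖ + H * ‖y₂‖ := by
    refine (norm_sub_le _ _).trans ?_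
    rw [norm_mul, norm_mul]; gcongr
  have h1 : ‖y₂ - y₁‖ ≤ ‖y₂‖ + ‖y₁‖ := norm_sub_le _ _
  refine (C2.norm_le _).trans ?_
  simp only [solveLinear, PiLp.toLp_apply, Matrix.cons_val_zero, Matrix.cons_val_one, norm_mul]
  calc _ ≤ 1 / c * (H * ‖y₁‖ + H * ‖y₂‖) + 1 / c * (‖y₂‖ + ‖y₁‖) := by gcongr
    _ = _ := by ring

theorem eq_solveLinear_iff {p q y₁ y₂ : ℂ} (hpq : q - p ≠ 0) (x : C2) :
    x = solveLinear p q y₁ y₂ ↔ x 0 + p * x 1 = y₁ ∧ x 0 + q * x 1 = y₂ := by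
  constructor
  · rintro rfl
    simp only [solveLinear, PiLp.toLp_apply, Matrix.cons_val_zero, Matrix.cons_val_one]
    constructor <;> field_simp <;> ring
  · rintro ⟨rfl, rfl⟩
    ext i
    fin_cases i <;>
    simp only [solveLinear, PiLp.toLp_apply, Matrix.cons_val_zero, Matrix.cons_val_one, Fin.zero_eta,
      Fin.mk_one] <;> field_simp <;> ring

theorem solveLinear_add (p q y₁ y₂ z₁ z₂ : ℂ) :
    solveLinear p q y₁ y₂ + solveLinear p q z₁ z₂ = solveLinear p q (y₁ + z₁) (y₂ + z₂) := by
  ext i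
  fin_cases i <;> simp [solveLinear] <;> ring

theorem solveLinear_sub (p q y₁ y₂ z₁ z₂ : ℂ) :
    solveLinear p q y₁ y₂ - solveLinear p q z₁ z₂ = solveLinear p q (y₁ - z₁) (y₂ - z₂) := by
  ext i
  fin_cases i <;> simp [solveLinear] <;> ring

theorem IsExpansion.neg_fst {δ K κ M P : ℝ} {g₀ g₁ : ℂ → ℂ} (h : IsExpansion δ K κ M P g₀ g₁) :
    IsExpansion δ K κ M (-P) (fun ε => -g₀ ε) g₁ where
  diff₀ := h.diff₀.neg
  diff₁ := h.diff₁
  bound₀ ε hε := by rw [← neg_sub', norm_neg]; exact h.bound₀ ε hε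
  bound₁ := h.bound₁
  zero₀ := by rw [norm_neg]; exact h.zero₀
  zero₁ := h.zero₁
  deriv₀ := by
    rw [deriv.fun_neg, Complex.ofReal_neg, ← neg_add, norm_neg]; exact h.deriv₀

/-- Newton's approximation for the pair of equations `g₀ ε + s g₁ ε = 0`, `h₀ ε + s h₁ ε = 0`. -/
theorem IsExpansion.exists_root {δ K κ M P P' r c : ℝ} {g₀ g₁ h₀ h₁ : ℂ → ℂ}
    (hg : IsExpansion δ K κ M P g₀ g₁) (hh : IsExpansion δ K κ M P' h₀ h₁) (hδ : 0 < δ)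
    (hM : 0 < M) (hc : 0 < c) (hP : 2 * c ≤ P - P')
    (hcM : 2 * K * M * Real.exp (-(2 * κ * M)) ≤ c) (hr : 0 ≤ r) (hrδ : r < δ / M / 4)
    (hrM : (4 * K / δ + 1) / c * 2 * (32 * K / δ ^ 2 + 8 * K / δ) * M * r ≤ 1 / 2)
    (hrK : (4 * K / δ + 1) / c * 2 * K * Real.exp (-(2 * κ * M)) ≤ r / 2) :
    deriv h₀ 0 - deriv g₀ 0 ≠ 0 ∧ ∃ x : C2, ‖x‖ ≤ r ∧
      (g₀ (x 1) + x 0 * g₁ (x 1) = 0 ∧ h₀ (x 1) + x 0 * h₁ (x 1) = 0) ∧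
      (∀ y : C2, ‖y‖ ≤ r → g₀ (y 1) + y 0 * g₁ (y 1) = 0 → h₀ (y 1) + y 0 * h₁ (y 1) = 0 → y = x) ∧
      ‖x - solveLinear (deriv g₀ 0) (deriv h₀ 0) (-g₀ 0) (-h₀ 0)‖ ≤
        4 * ((4 * K / δ + 1) / c * 2 * (32 * K / δ ^ 2 + 8 * K / δ) * M) *
          ((4 * K / δ + 1) / c * 2 * K * Real.exp (-(2 * κ * M))) ^ 2 := by
  have hR : 0 < δ / M := by positivity
  have hK : 0 ≤ K := (norm_nonneg _).trans (hg.bound₁ 0 (Metric.mem_ball_self hR))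
  set p := deriv g₀ 0 with hp
  set q := deriv h₀ 0 with hq
  have hpH : ‖p‖ ≤ 4 * K / δ := hg.norm_deriv_le hδ hM
  have hqH : ‖q‖ ≤ 4 * K / δ := hh.norm_deriv_le hδ hM
  -- The determinant is `P - P' ≥ 2 * c` up to two exponentially small errors, which together
  -- consume at most `c`.
  have hpq : c ≤ ‖q - p‖ := by
    have e : ((P - P' : ℝ) : ℂ) = (q - p) + ((p + P) - (q + P')) := by push_cast; ring
    have h1 : P - P' ≤ ‖q - p‖ + (K * M * Real.exp (-(2 * κ * M)) +
        K * M * Real.exp (-(2 * κ * M))) := by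
      calc P - P' ≤ ‖((P - P' : ℝ) : ℂ)‖ := by rw [Complex.norm_real]; exact le_abs_self _
        _ ≤ ‖q - p‖ + (‖p + P‖ + ‖q + P'‖) := by
          rw [e]
          refine (norm_add_le _ _).trans ?_
          gcongr
          exact norm_sub_le _ _
        _ ≤ _ := by gcongr; exacts [hg.deriv₀, hh.deriv₀]
    linarith
  have hpq0 : q - p ≠ 0 := norm_pos_iff.1 (hc.trans_le hpq)
  refine ⟨hpq0, ?_⟩
  set Γ := (4 * K / δ + 1) / c with hΓ
  have hΓ0 : 0 ≤ Γ := by positivity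
  set Λ := 32 * K / δ ^ 2 + 8 * K / δ with hΛ
  have hΛ0 : 0 ≤ Λ := by positivity
  set N := solveLinear p q (-g₀ 0) (-h₀ 0) with hN
  set w := Real.exp (-(2 * κ * M)) with hw
  have hNnorm : ‖N‖ ≤ Γ * 2 * K * w := by
    refine (norm_solveLinear_le hc hpq hpH hqH).trans ?_
    rw [norm_neg, norm_neg]
    calc _ ≤ Γ * (K * w + K * w) := by gcongr; exacts [hg.zero₀, hh.zero₀]
      _ = _ := by ring
  -- The linear part has rows `(1, p)` and `(1, q)`. Inverting it turns the two equations into a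
  -- fixed point equation whose constant term `N` is the Newton step.
  have hsolve : ∀ x : C2, x = N + solveLinear p q (-remainder g₀ g₁ x) (-remainder h₀ h₁ x) ↔
      g₀ (x 1) + x 0 * g₁ (x 1) = 0 ∧ h₀ (x 1) + x 0 * h₁ (x 1) = 0 := fun x => by
    rw [hN, solveLinear_add, eq_solveLinear_iff hpq0]
    simp only [remainder, ← hp, ← hq]
    constructor <;> rintro ⟨h1, h2⟩ <;> constructor
    · linear_combination h1
    · linear_combination h2
    · linear_combination h1
    · linear_combination h2
  obtain ⟨x, hx, hfix, huniq, herr⟩ := exists_unique_fixedPoint (N := N)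
    (P := fun x => solveLinear p q (-remainder g₀ g₁ x) (-remainder h₀ h₁ x))
    (L := Γ * 2 * Λ * M) (r := r) (by positivity) hr (by
      ext i; fin_cases i <;> simp [solveLinear, remainder]) (fun x y hx hy => by
      rw [solveLinear_sub]
      refine (norm_solveLinear_le hc hpq hpH hqH).trans ?_
      have e1 := hg.remainder_sub_le hδ hM hrδ hx hy
      have e2 := hh.remainder_sub_le hδ hM hrδ hx hy
      rw [neg_sub_neg, neg_sub_neg, norm_sub_rev, norm_sub_rev (remainder h₀ h₁ y)]
      calc _ ≤ Γ * (Λ * M * max ‖x‖ ‖y‖ * ‖x - y‖ + Λ * M * max ‖x‖ ‖y‖ * ‖x - y‖) := by gcongr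
        _ = _ := by ring) hrM (hNnorm.trans hrK)
  refine ⟨x, hx, (hsolve x).1 hfix, fun y hy h1 h2 => huniq y hy ((hsolve y).2 ⟨h1, h2⟩), ?_⟩
  refine herr.trans ?_
  gcongr

theorem IsExpansion.mono {δ δ' K K' κ M P : ℝ} {g₀ g₁ : ℂ → ℂ} (h : IsExpansion δ K κ M P g₀ g₁)
    (hδ : δ' ≤ δ) (hK : K ≤ K') (hM : 0 < M) : IsExpansion δ' K' κ M P g₀ g₁ := by
  have hsub : Metric.ball (0 : ℂ) (δ' / M) ⊆ Metric.ball 0 (δ / M) :=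
    Metric.ball_subset_ball (by gcongr)
  exact ⟨h.diff₀.mono hsub, h.diff₁.mono hsub, fun ε hε => (h.bound₀ ε (hsub hε)).trans (by gcongr),
    fun ε hε => (h.bound₁ ε (hsub hε)).trans hK, h.zero₀.trans (by gcongr), h.zero₁,
    h.deriv₀.trans (by gcongr)⟩

/-- This mass bounds the determinant from below for all `M ≥ 1`. If `φ` vanished on `[0, 1]`, so
would `φ'` inside, against the Wronskian 1. -/
theorem IsDichotomy.integral_pos {Q φ φ' ψ ψ' : ℝ → ℝ} {κ C : ℝ}
    (h : IsDichotomy Q φ φ' ψ ψ' κ C) : 0 < ∫ t in (0 : ℝ)..1, φ t ^ 2 := by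
  refine intervalIntegral.integral_pos one_pos ((h.fst.continuous.1.pow 2).continuousOn)
    (fun x _ => sq_nonneg _) ?_
  by_contra! hcon
  have hz : ∀ x ∈ Set.Icc (0 : ℝ) 1, φ x = 0 := fun x hx =>
    pow_eq_zero_iff (two_ne_zero) |>.1 (le_antisymm (hcon x hx) (sq_nonneg _))
  have hm : (1 / 2 : ℝ) ∈ Set.Icc (0 : ℝ) 1 := by norm_num
  have hev : φ =ᶠ[nhds (1 / 2)] fun _ => 0 := by
    filter_upwards [Icc_mem_nhds (show (0 : ℝ) < 1 / 2 by norm_num)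
      (show (1 / 2 : ℝ) < 1 by norm_num)] with x hx using hz x hx
  have hd0 : φ' (1 / 2) = 0 :=
    ((h.fst _ trivial).1.congr_of_eventuallyEq hev.symm).unique (hasDerivAt_const _ _)
  have := h.wronskian (1 / 2)
  rw [hz _ hm, hd0] at this
  simp at this

/-- The functional at `M` of the reflected solution is `-Θ⁻`, and the coefficient of the reflected
`ψ` is `-s`. The two signs leave `h₁` alone and negate `h₀`, so `P - P'` is the sum of the masses of
`φ` on the two sides. -/
theorem IsBoundState.exists_theta_expansion {V Vper Vdef : ℝ → ℝ} {ρ E : ℝ} {Φ : ℝ → ℂ}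
    (hρ : 0 ≤ ρ) (hV : IsEventuallyPeriodic V Vper Vdef ρ) (hE : 0 < E)
    (hΦ : IsBoundState V E Φ) :
    ∃ κ : ℝ, IsFloquetExponent Vper E κ ∧ ∃ δ K c : ℝ, 0 < δ ∧ δ < E ∧ 0 < K ∧ 0 < c ∧
      ∀ M : ℝ, 1 ≤ M → ∃ (θ θ' : ℂ) (g₀ g₁ h₀ h₁ : ℂ → ℂ) (P P' : ℝ), θ ≠ 0 ∧ θ' ≠ 0 ∧
        IsExpansion δ K κ M P g₀ g₁ ∧ IsExpansion δ K κ M P' h₀ h₁ ∧ 2 * c ≤ P - P' ∧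
        ∀ ζ : C2, ‖ζ 1 - eta Φ E 1‖ < δ / M →
          ThetaPlus V Φ M ζ =
            θ * (g₀ (ζ 1 - eta Φ E 1) + (ζ 0 - eta Φ E 0) * g₁ (ζ 1 - eta Φ E 1)) ∧
          ThetaMinus V Φ M ζ =
            θ' * (h₀ (ζ 1 - eta Φ E 1) + (ζ 0 - eta Φ E 0) * h₁ (ζ 1 - eta Φ E 1)) := by
  have hcV := hV.continuous
  obtain ⟨φ, φ', ψ, ψ', κ, C, hκ, hR, hL, hu⟩ := hΦ.exists_dichotomy hρ hV
  obtain ⟨δ₁, K₁, hδ₁, hδE₁, hK₁, H₁⟩ := hR.exists_expansion (by fun_prop) hκ.1 hE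
  obtain ⟨δ₂, K₂, hδ₂, hδE₂, hK₂, H₂⟩ := hL.exists_expansion (by fun_prop) hκ.1 hE
  have hpos := hR.integral_pos
  refine ⟨κ, hκ, min δ₁ δ₂, max K₁ K₂, (∫ t in (0 : ℝ)..1, φ t ^ 2) / 2, by positivity,
    (min_le_left _ _).trans_lt hδE₁, by positivity, by positivity, fun M hM => ?_⟩
  have hM0 : 0 < M := by linarith
  obtain ⟨θ, g₀, g₁, hθ, hg, hgu⟩ := H₁ M hM
  obtain ⟨θ', h₀, h₁, hθ', hh, hhu⟩ := H₂ M hM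
  have hcφ := hR.fst.continuous.1
  refine ⟨θ, θ', g₀, g₁, fun ε => -h₀ ε, h₁, _, _, hθ, hθ',
    hg.mono (min_le_left _ _) (le_max_left _ _) hM0,
    hh.neg_fst.mono (min_le_right _ _) (le_max_right _ _) hM0, ?_, fun ζ hζ => ?_⟩
  · have h1 : ∫ t in (0 : ℝ)..1, φ t ^ 2 ≤ ∫ t in (0 : ℝ)..M, φ t ^ 2 :=
      intervalIntegral.integral_mono_interval le_rfl zero_le_one hM
        (Filter.Eventually.of_forall fun t => sq_nonneg _)
        (Continuous.intervalIntegrable (by fun_prop) _ _)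
    have h2 : 0 ≤ ∫ t in (0 : ℝ)..M, φ (-t) ^ 2 :=
      intervalIntegral.integral_nonneg hM0.le fun t _ => sq_nonneg _
    linarith
  · obtain ⟨s1, s2, s3⟩ := ivp_isSolOn hcV (ζ 1) (φ 0 + (ζ 0 - eta Φ E 0) * ψ 0)
      (φ' 0 + (ζ 0 - eta Φ E 0) * ψ' 0)
    rw [← hu ζ] at s1 s2 s3
    have hη : eta Φ E 1 = (E : ℂ) := by simp [eta]
    have hsum : (E : ℂ) + (ζ 1 - E) = ζ 1 := by ring
    have hM1 : min δ₁ δ₂ / M ≤ δ₁ / M := by gcongr; exact min_le_left _ _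
    have hM2 : min δ₁ δ₂ / M ≤ δ₂ / M := by gcongr; exact min_le_right _ _
    rw [hη] at hζ ⊢
    constructor
    · have := hgu (ζ 1 - E) (ζ 0 - eta Φ E 0) _ _ (hζ.trans_le hM1) (by
        convert s1 using 2; push_cast; ring) s2 s3
      rw [hsum] at this
      exact this
    · have s1' : IsSolOn Set.univ (fun x => ((V (-x) - E : ℝ) : ℂ) - (ζ 1 - E))
          (fun x => uSol V Φ ζ (-x)) (fun x => -deriv (uSol V Φ ζ) (-x)) :=
        s1.comp_neg fun x _ => ⟨trivial, by push_cast; ring⟩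
      have := hhu (ζ 1 - E) (-(ζ 0 - eta Φ E 0)) _ _ (hζ.trans_le hM2) s1'
        (by simp only [neg_zero, s2]; push_cast; ring) (by simp only [neg_zero, s3]; push_cast; ring)
      rw [hsum] at this
      rw [ThetaMinus]
      linear_combination -this

/-! ### The Jacobian and the Newton point of `Θ`. -/

section Jacobian

variable {F : C2 → ℂ} {η : C2} {θ : ℂ} {a b : ℂ → ℂ} {R : ℝ}

theorem dw_eq (hR : 0 < R) (hF : ∀ ζ : C2, ‖ζ 1 - η 1‖ < R →
    F ζ = θ * (a (ζ 1 - η 1) + (ζ 0 - η 0) * b (ζ 1 - η 1))) : dw F η = θ * b 0 := by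
  have e : (fun w : ℂ => F !₂[w, η 1]) = fun w => θ * (a 0 + (w - η 0) * b 0) := by
    ext w
    rw [hF _ (by simpa using hR)]
    simp
  rw [dw, e]
  have h1 : HasDerivAt (fun w : ℂ => θ * (a 0 + (w - η 0) * b 0)) (θ * (1 * b 0)) (η 0) :=
    ((((hasDerivAt_id (η 0)).sub_const (η 0)).mul_const (b 0)).const_add (a 0)).const_mul θ
  rw [h1.deriv, one_mul]

theorem dz_eq (hR : 0 < R) (hF : ∀ ζ : C2, ‖ζ 1 - η 1‖ < R →
    F ζ = θ * (a (ζ 1 - η 1) + (ζ 0 - η 0) * b (ζ 1 - η 1)))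
    (ha : DifferentiableAt ℂ a 0) : dz F η = θ * deriv a 0 := by
  have e : (fun z : ℂ => F !₂[η 0, z]) =ᶠ[nhds (η 1)] fun z => θ * a (z - η 1) := by
    filter_upwards [Metric.ball_mem_nhds (η 1) hR] with z hz
    rw [hF _ (by simpa [dist_eq_norm] using hz)]
    simp
  rw [dz, e.deriv_eq]
  have h1 : HasDerivAt a (deriv a 0) (η 1 - η 1) := by rw [sub_self]; exact ha.hasDerivAt
  exact ((h1.comp_sub_const (η 1) (η 1)).const_mul θ).deriv

theorem differentiableAt_of_expansion (hR : 0 < R) (hF : ∀ ζ : C2, ‖ζ 1 - η 1‖ < R →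
    F ζ = θ * (a (ζ 1 - η 1) + (ζ 0 - η 0) * b (ζ 1 - η 1)))
    (ha : DifferentiableAt ℂ a 0) (hb : DifferentiableAt ℂ b 0) : DifferentiableAt ℂ F η := by
  have hcoord : ∀ i, DifferentiableAt ℂ (fun ζ : C2 => ζ i - η i) η := fun i => by fun_prop
  have e : F =ᶠ[nhds η] fun ζ => θ * (a (ζ 1 - η 1) + (ζ 0 - η 0) * b (ζ 1 - η 1)) := by
    filter_upwards [Metric.ball_mem_nhds η hR] with ζ hζ
    refine hF ζ ((PiLp.norm_apply_le (ζ - η) 1).trans_lt ?_)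
    simpa [dist_eq_norm] using hζ
  refine DifferentiableAt.congr_of_eventuallyEq ?_ e
  have ha' : DifferentiableAt ℂ (fun ζ : C2 => a (ζ 1 - η 1)) η :=
    DifferentiableAt.comp η (by simpa using ha) (hcoord 1)
  have hb' : DifferentiableAt ℂ (fun ζ : C2 => b (ζ 1 - η 1)) η :=
    DifferentiableAt.comp η (by simpa using hb) (hcoord 1)
  exact (ha'.add ((hcoord 0).mul hb')).const_mul θ

end Jacobian

/-- The row factors `θ` and `θ'` cancel between `Xi` and `Theta`, leaving the Newton step of the
normalized system. -/
theorem newtonPoint_eq {V : ℝ → ℝ} {Φ : ℝ → ℂ} {M : ℝ} {η : C2} {θ θ' p q a b : ℂ} (hθ : θ ≠ 0)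
    (hθ' : θ' ≠ 0) (hpq : q - p ≠ 0)
    (h1 : dw (ThetaPlus V Φ M) η = θ) (h2 : dz (ThetaPlus V Φ M) η = θ * p)
    (h3 : dw (ThetaMinus V Φ M) η = θ') (h4 : dz (ThetaMinus V Φ M) η = θ' * q)
    (h5 : ThetaPlus V Φ M η = θ * a) (h6 : ThetaMinus V Φ M η = θ' * b) :
    jacDet V Φ M η ≠ 0 ∧ newtonPoint V Φ M η = η + solveLinear p q (-a) (-b) := by
  have hJ : jacDet V Φ M η = θ * θ' * (q - p) := by
    rw [jacDet, h1, h2, h3, h4]; ring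
  refine ⟨by rw [hJ]; exact mul_ne_zero (mul_ne_zero hθ hθ') hpq, ?_⟩
  rw [newtonPoint, sub_eq_add_neg]
  congr 1
  ext i
  fin_cases i
  · simp [Xi, hJ, h1, h2, h3, h4, Theta, h5, h6, solveLinear]
    field_simp
    ring
  · simp [Xi, hJ, h1, h2, h3, h4, Theta, h5, h6, solveLinear]
    field_simp

/-! ### From outgoing boundary conditions to resonant states. -/

theorem hasDerivAt_glue {f g f' g' : ℝ → ℂ} {c : ℝ} (hf : ∀ x, HasDerivAt f (f' x) x)
    (hg : ∀ x, HasDerivAt g (g' x) x) (h : f c = g c) (h' : f' c = g' c) (x : ℝ) :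
    HasDerivAt (fun x => if x ≤ c then f x else g x) (if x ≤ c then f' x else g' x) x := by
  rcases lt_trichotomy x c with hx | rfl | hx
  · rw [if_pos hx.le]
    refine (hf x).congr_of_eventuallyEq ?_
    filter_upwards [Iio_mem_nhds hx] with y hy using if_pos hy.le
  · rw [if_pos le_rfl]
    have h1 : HasDerivWithinAt (fun y => if y ≤ x then f y else g y) (f' x) (Set.Iic x) x :=
      (hf x).hasDerivWithinAt.congr (fun y hy => if_pos hy) (if_pos le_rfl)
    have h2 : HasDerivWithinAt (fun y => if y ≤ x then f y else g y) (f' x) (Set.Ici x) x := by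
      rw [h']
      refine (hg x).hasDerivWithinAt.congr (fun y hy => ?_) (by simp [h])
      rcases eq_or_lt_of_le (Set.mem_Ici.1 hy) with rfl | hy
      · simp [h]
      · exact if_neg (not_le.2 hy)
    have := h1.union h2
    rwa [Set.Iic_union_Ici, hasDerivWithinAt_univ] at this
  · rw [if_neg (not_le.2 hx)]
    refine (hg x).congr_of_eventuallyEq ?_
    filter_upwards [Ioi_mem_nhds hx] with y hy using if_neg (not_le.2 hy)

/-- The flux `Im(v ū)` has derivative `-Im z |u|²`, hence is nonincreasing if `Im z ≥ 0`. The
outgoing conditions make it positive at `M` and nonpositive at `-M`. -/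
theorem im_neg_of_outgoing {V : ℝ → ℝ} {z σ : ℂ} {u v : ℝ → ℂ} {M : ℝ}
    (hσ : 0 < σ.re) (hM : 0 < M) (hu : IsSolOn Set.univ (fun x => (V x : ℂ) - z) u v)
    (huM : u M ≠ 0) (hp : v M = Complex.I * σ * u M) (hm : v (-M) = -(Complex.I * σ * u (-M))) :
    z.im < 0 := by
  by_contra! hz
  set f : ℝ → ℝ := fun x => (v x).im * (u x).re - (v x).re * (u x).im with hf
  have hder : ∀ x, HasDerivAt f (-z.im * ((u x).re ^ 2 + (u x).im ^ 2)) x := fun x => by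
    obtain ⟨h1, h2⟩ := hu x trivial
    have ur := Complex.reCLM.hasFDerivAt.comp_hasDerivAt x h1
    have ui := Complex.imCLM.hasFDerivAt.comp_hasDerivAt x h1
    have vr := Complex.reCLM.hasFDerivAt.comp_hasDerivAt x h2
    have vi := Complex.imCLM.hasFDerivAt.comp_hasDerivAt x h2
    refine ((vi.mul ur).sub (vr.mul ui)).congr_deriv ?_
    simp
    ring
  have hanti : Antitone f := antitone_of_deriv_nonpos (fun x => (hder x).differentiableAt)
    fun x => by
      rw [(hder x).deriv]
      have : 0 ≤ z.im * ((u x).re ^ 2 + (u x).im ^ 2) := by positivity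
      linarith
  have h1 : f M = σ.re * ((u M).re ^ 2 + (u M).im ^ 2) := by
    simp only [hf, hp]; simp; ring
  have h2 : f (-M) = -(σ.re * ((u (-M)).re ^ 2 + (u (-M)).im ^ 2)) := by
    simp only [hf, hm]; simp; ring
  have h3 := hanti (show -M ≤ M by linarith)
  rw [h1, h2] at h3
  have h4 : 0 ≤ σ.re * ((u (-M)).re ^ 2 + (u (-M)).im ^ 2) := by positivity
  have h5 : 0 < (u M).re ^ 2 + (u M).im ^ 2 := by
    have := Complex.normSq_pos.2 huM
    rw [Complex.normSq_apply] at this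
    linarith
  linarith [mul_pos hσ h5]

theorem hasDerivAt_exp_affine (A c : ℂ) (d x : ℝ) :
    HasDerivAt (fun x : ℝ => A * Complex.exp (c * ((x : ℂ) - d)))
      (c * A * Complex.exp (c * ((x : ℂ) - d))) x := by
  have h1 : HasDerivAt (fun x : ℝ => c * ((x : ℂ) - d)) c x := by
    have h0 := (((hasDerivAt_id x).ofReal_comp).sub_const (d : ℂ)).const_mul c
    exact h0.congr_deriv (by simp)
  exact (h1.cexp.const_mul A).congr_deriv (by ring)

theorem intervalIntegrable_Vtrunc {V : ℝ → ℝ} (hV : Continuous V) {f : ℝ → ℂ} (hf : Continuous f)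
    (M : ℝ) (z : ℂ) (a b : ℝ) :
    IntervalIntegrable (fun t => ((Vtrunc V M t : ℂ) - z) * f t) volume a b := by
  have h1 : IntervalIntegrable (Set.indicator {t : ℝ | |t| ≤ M} fun t => (V t : ℂ) * f t)
      volume a b := by
    have h2 : IntervalIntegrable (fun t => (V t : ℂ) * f t) volume a b :=
      Continuous.intervalIntegrable (by fun_prop) a b
    rw [intervalIntegrable_iff] at h2 ⊢
    exact h2.indicator (measurableSet_le (by fun_prop) (by fun_prop))
  have h2 : IntervalIntegrable (fun t => z * f t) volume a b :=
    Continuous.intervalIntegrable (by fun_prop) a b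
  convert h1.sub h2 using 2 with t
  by_cases ht : |t| ≤ M <;> simp [Vtrunc, ht, sub_mul]

/-- The outgoing conditions say exactly that the exponential continuations match `u` to first order
at `±M`. The potential jumps only at these two points, so the integrated equation follows from the
fundamental theorem of calculus off a countable set. -/
theorem isResonance_of_outgoing {V : ℝ → ℝ} (hV : Continuous V) {z : ℂ} {u v : ℝ → ℂ} {M : ℝ}
    (hz : 0 < z.re) (hM : 0 < M) (hu : IsSolOn Set.univ (fun x => (V x : ℂ) - z) u v)
    (h0 : u 0 ≠ 0 ∨ v 0 ≠ 0) (hp : v M = Complex.I * Complex.sqrt z * u M)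
    (hm : v (-M) = -(Complex.I * Complex.sqrt z * u (-M))) : IsResonance (Vtrunc V M) z := by
  have huM : u M ≠ 0 := fun hc => by
    obtain ⟨e1, e2⟩ := hu.eq_of_eq (by fun_prop) (hu.const_mul 0) isOpen_univ isPreconnected_univ
      (x₀ := M) (x := 0) trivial trivial (by simp [hc]) (by simp [hp, hc])
    simp only [zero_mul] at e1 e2
    exact h0.elim (· e1) (· e2)
  set σ := Complex.I * Complex.sqrt z with hσ
  have hσ2 : σ * σ = -z := by
    rw [hσ]; linear_combination (Complex.sqrt z) ^ 2 * Complex.I_sq - sqrt_sq z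
  set r : ℝ → ℂ := fun x => u M * Complex.exp (σ * ((x : ℂ) - M)) with hr
  set r' : ℝ → ℂ := fun x => σ * u M * Complex.exp (σ * ((x : ℂ) - M)) with hr'
  set l : ℝ → ℂ := fun x => u (-M) * Complex.exp (-σ * ((x : ℂ) - (-M : ℝ))) with hl
  set l' : ℝ → ℂ := fun x => -σ * u (-M) * Complex.exp (-σ * ((x : ℂ) - (-M : ℝ))) with hl'
  set m : ℝ → ℂ := fun x => if x ≤ M then u x else r x with hm_def
  set m' : ℝ → ℂ := fun x => if x ≤ M then v x else r' x with hm'_def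
  set ψ : ℝ → ℂ := fun x => if x ≤ -M then l x else m x with hψ
  set ψ' : ℝ → ℂ := fun x => if x ≤ -M then l' x else m' x with hψ'
  have hMM : -M ≤ M := by linarith
  have hdm : ∀ x, HasDerivAt m (m' x) x := hasDerivAt_glue (fun x => (hu x trivial).1)
    (fun x => hasDerivAt_exp_affine _ _ _ x) (by simp [hr]) (by simp [hr', hp])
  have hdψ : ∀ x, HasDerivAt ψ (ψ' x) x := hasDerivAt_glue
    (fun x => hasDerivAt_exp_affine _ _ _ x) hdm (by simp [hl, hm_def, hMM])
    (by simp [hl', hm'_def, hMM, hm])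
  have hcv := hu.continuous.2
  have hcm' : Continuous m' := by
    refine Continuous.if_le hcv (by fun_prop) continuous_id continuous_const ?_
    rintro x rfl
    simp [hr', hp]
  have hcψ' : Continuous ψ' := by
    refine Continuous.if_le (by fun_prop) hcm' continuous_id continuous_const ?_
    rintro x rfl
    simp [hl', hm'_def, hm] at hMM ⊢
    simp [hMM]
  have hcψ : Continuous ψ := continuous_iff_continuousAt.2 fun x => (hdψ x).continuousAt
  have hderiv : deriv ψ = ψ' := funext fun x => (hdψ x).deriv
  have hsecond : ∀ x ∉ ({M, -M} : Set ℝ),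
      HasDerivAt ψ' (((Vtrunc V M x : ℂ) - z) * ψ x) x := by
    intro x hx
    simp only [Set.mem_insert_iff, Set.mem_singleton_iff, not_or] at hx
    rcases lt_or_gt_of_ne hx.2 with h1 | h1
    · have hW : Vtrunc V M x = 0 := if_neg (by rw [not_le, lt_abs]; right; linarith)
      have hψx : ψ x = l x := if_pos h1.le
      rw [hW, hψx]
      refine HasDerivAt.congr_of_eventuallyEq ?_
        (show ψ' =ᶠ[nhds x] l' by filter_upwards [Iio_mem_nhds h1] with y hy using if_pos hy.le)
      refine (hasDerivAt_exp_affine _ _ _ x).congr_deriv ?_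
      simp only [hl, Complex.ofReal_zero]
      linear_combination u (-M) * Complex.exp (-σ * ((x : ℂ) - (-M : ℝ))) * hσ2
    · have hψm : ψ x = m x := if_neg (not_le.2 h1)
      have hψm' : ψ' =ᶠ[nhds x] m' := by
        filter_upwards [Ioi_mem_nhds h1] with y hy using if_neg (not_le.2 hy)
      refine HasDerivAt.congr_of_eventuallyEq ?_ hψm'
      rw [hψm]
      rcases lt_or_gt_of_ne hx.1 with h2 | h2
      · have hW : Vtrunc V M x = V x := if_pos (abs_le.2 ⟨h1.le, h2.le⟩)
        have hmx : m x = u x := if_pos h2.le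
        rw [hW, hmx]
        exact (hu x trivial).2.congr_of_eventuallyEq
          (by filter_upwards [Iio_mem_nhds h2] with y hy using if_pos hy.le)
      · have hW : Vtrunc V M x = 0 := if_neg (by rw [not_le, lt_abs]; left; exact h2)
        have hmx : m x = r x := if_neg (not_le.2 h2)
        rw [hW, hmx]
        refine HasDerivAt.congr_of_eventuallyEq ?_ (show m' =ᶠ[nhds x] r' by
          filter_upwards [Ioi_mem_nhds h2] with y hy using if_neg (not_le.2 hy))
        refine (hasDerivAt_exp_affine _ _ _ x).congr_deriv ?_
        simp only [hr, Complex.ofReal_zero]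
        linear_combination u M * Complex.exp (σ * ((x : ℂ) - M)) * hσ2
  refine ⟨hz, im_neg_of_outgoing (sqrt_re_pos hz) hM hu huM hp hm, ψ, ?_, fun hc => ?_, fun x => ?_,
    M, u M * Complex.exp (-(σ * M)), u (-M) * Complex.exp (-(σ * M)), fun x hx => ?_,
    fun x hx => ?_⟩
  · rw [contDiff_one_iff_deriv, hderiv]
    exact ⟨fun x => (hdψ x).differentiableAt, hcψ'⟩
  · have h1 : ψ M = u M := by
      simp only [hψ, hm_def]
      rw [if_neg (by linarith), if_pos le_rfl]
    rw [hc] at h1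
    exact huM h1.symm
  · rw [hderiv, integral_eq_of_hasDerivAt_off_countable ψ' _ (s := {M, -M})
      (Set.to_countable _) hcψ'.continuousOn (fun x hx => hsecond x hx.2)
      (intervalIntegrable_Vtrunc hV hcψ M z 0 x)]
    ring
  · have h1 : ψ x = r x := by
      simp only [hψ, hm_def]
      rw [if_neg (by linarith), if_neg (by linarith)]
    rw [h1, mul_assoc, ← Complex.exp_add]
    simp only [hr]
    congr 2; ring
  · have h1 : ψ x = l x := if_pos hx.le
    rw [h1, mul_assoc, ← Complex.exp_add]
    simp only [hl]
    push_cast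
    congr 2; ring

/-! ### Large `M` and conclusion. -/

theorem tendsto_pow_mul_exp_neg_zero (n : ℕ) {a : ℝ} (ha : 0 < a) :
    Filter.Tendsto (fun M : ℝ => M ^ n * Real.exp (-(a * M))) Filter.atTop (nhds 0) := by
  have := tendsto_rpow_mul_exp_neg_mul_atTop_nhds_zero n a ha
  simpa using this

theorem eventually_pow_mul_exp_neg_le (n : ℕ) {a b c : ℝ} (ha : 0 < a) (hc : 0 < c) :
    ∀ᶠ M : ℝ in Filter.atTop, b * (M ^ n * Real.exp (-(a * M))) ≤ c := by
  have := (tendsto_pow_mul_exp_neg_zero n ha).const_mul b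
  rw [mul_zero] at this
  exact (this.eventually (gt_mem_nhds hc)).mono fun M hM => hM.le

theorem uSol_isSolOn {V : ℝ → ℝ} (hV : Continuous V) (Φ : ℝ → ℂ) (ζ : C2) :
    IsSolOn Set.univ (fun x => (V x : ℂ) - ζ 1) (uSol V Φ ζ) (deriv (uSol V Φ ζ)) ∧
      (uSol V Φ ζ 0 ≠ 0 ∨ deriv (uSol V Φ ζ) 0 ≠ 0) := by
  by_cases h : Φ 0 = 0
  · simp only [uSol, h, ne_eq, not_true_eq_false, if_false]
    obtain ⟨h1, -, h3⟩ := ivp_isSolOn hV (ζ 1) (-(ζ 0)) 1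
    exact ⟨h1, Or.inr (by rw [h3]; exact one_ne_zero)⟩
  · simp only [uSol, h, ne_eq, not_false_eq_true, if_true]
    obtain ⟨h1, h2, -⟩ := ivp_isSolOn hV (ζ 1) 1 (ζ 0)
    exact ⟨h1, Or.inl (by rw [h2]; exact one_ne_zero)⟩

theorem isResonance_of_Theta_eq_zero {V : ℝ → ℝ} (hV : Continuous V) {Φ : ℝ → ℂ} {M : ℝ}
    (hM : 0 < M) {ζ : C2} (hz : 0 < (ζ 1).re) (h1 : ThetaPlus V Φ M ζ = 0)
    (h2 : ThetaMinus V Φ M ζ = 0) : IsResonance (Vtrunc V M) (ζ 1) := by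
  obtain ⟨hu, h0⟩ := uSol_isSolOn hV Φ ζ
  rw [ThetaPlus] at h1
  rw [ThetaMinus] at h2
  exact isResonance_of_outgoing hV hz hM hu h0 (by linear_combination h1)
    (by linear_combination h2)

theorem Theta_eq_zero_iff {V : ℝ → ℝ} {Φ : ℝ → ℂ} {M : ℝ} {ζ : C2} :
    Theta V Φ M ζ = 0 ↔ ThetaPlus V Φ M ζ = 0 ∧ ThetaMinus V Φ M ζ = 0 := by
  constructor
  · intro h
    exact ⟨by simpa [Theta] using congrArg (fun x : C2 => x 0) h,
      by simpa [Theta] using congrArg (fun x : C2 => x 1) h⟩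
  · rintro ⟨h1, h2⟩
    ext i
    fin_cases i <;> simp [Theta, h1, h2]

/-- The numerical conditions under which the Newton argument applies in the ball of radius
`M⁻² e^{-k M}` hold for all large `M`. -/
theorem eventually_newton_conditions {κ k K Γ Λ δ c : ℝ} (hκ : 0 < κ) (hk : 0 < k) (hkκ : k ≤ κ)
    (hΓ : 0 ≤ Γ) (hΛ : 0 ≤ Λ) (hδ : 0 < δ) (hc : 0 < c) (ρ : ℝ) :
    ∀ᶠ M : ℝ in Filter.atTop, 1 ≤ M ∧ ρ < M ∧ 2 * K * M * Real.exp (-(2 * κ * M)) ≤ c ∧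
      1 / M ^ 2 * Real.exp (-(k * M)) < δ / M / 4 ∧
      Γ * 2 * Λ * M * (1 / M ^ 2 * Real.exp (-(k * M))) ≤ 1 / 2 ∧
      Γ * 2 * K * Real.exp (-(2 * κ * M)) ≤ 1 / M ^ 2 * Real.exp (-(k * M)) / 2 := by
  filter_upwards [Filter.eventually_ge_atTop 1, Filter.eventually_gt_atTop ρ,
    eventually_pow_mul_exp_neg_le 1 (b := 2 * K) (show 0 < 2 * κ by positivity) hc,
    Filter.eventually_gt_atTop (4 / δ), Filter.eventually_ge_atTop (4 * Γ * Λ),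
    eventually_pow_mul_exp_neg_le 2 (b := 4 * Γ * K) hκ one_pos] with M h1 h2 h3 h4 h5 h6
  have hM : 0 < M := by linarith
  have he : Real.exp (-(k * M)) ≤ 1 := Real.exp_le_one_iff.2 (by nlinarith)
  refine ⟨h1, h2, ?_, ?_, ?_, ?_⟩
  · rw [pow_one] at h3
    linarith
  · calc _ ≤ 1 / M ^ 2 * 1 := by gcongr
      _ < δ / M / 4 := by
        rw [div_lt_iff₀ hδ] at h4
        rw [mul_one, div_div, div_lt_div_iff₀ (by positivity) (by positivity)]
        nlinarith
  · calc _ ≤ Γ * 2 * Λ * M * (1 / M ^ 2 * 1) := by gcongr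
      _ = 4 * Γ * Λ / M / 2 := by field_simp; ring
      _ ≤ M / M / 2 := by gcongr
      _ = 1 / 2 := by rw [div_self hM.ne']
  -- One factor `e^{-κM}` absorbs `M²` and the constants, the other is at most `e^{-kM}`; this is
  -- why `k = κ` is still allowed.
  · have e1 : Real.exp (-(2 * κ * M)) = Real.exp (-(κ * M)) * Real.exp (-(κ * M)) := by
      rw [← Real.exp_add]; ring_nf
    have e2 : Real.exp (-(κ * M)) ≤ Real.exp (-(k * M)) := Real.exp_le_exp.2 (by nlinarith)
    calc _ = 4 * Γ * K * (M ^ 2 * Real.exp (-(κ * M))) * (1 / M ^ 2 * Real.exp (-(κ * M))) / 2 := by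
          rw [e1]; field_simp; ring
      _ ≤ 1 * (1 / M ^ 2 * Real.exp (-(k * M))) / 2 := by gcongr
      _ = _ := by rw [one_mul]

/-- The gap `κ - k` provides a spare exponential, which absorbs the factor `M`. -/
theorem error_le_of_lt {κ k C M : ℝ} (hC : 0 ≤ C) (hk : k < κ) :
    C * M * Real.exp (-(4 * κ * M)) ≤ C * (1 / (4 * (κ - k))) * Real.exp (-(4 * k * M)) := by
  have h := mul_exp_neg_le (a := 4 * (κ - k)) (M := M) (by linarith)
  have e : Real.exp (-(4 * κ * M)) = Real.exp (-(4 * (κ - k) * M)) * Real.exp (-(4 * k * M)) := by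
    rw [← Real.exp_add]; ring_nf
  calc _ = C * (M * Real.exp (-(4 * (κ - k) * M))) * Real.exp (-(4 * k * M)) := by rw [e]; ring
    _ ≤ _ := by gcongr

end TruncatedDefect
end

theorem mainTheorem4 (V Vper Vdef : ℝ → ℝ) (ρ E : ℝ) (Φ : ℝ → ℂ)
    (hρ : 0 ≤ ρ) (hV : TruncatedDefect.IsEventuallyPeriodic V Vper Vdef ρ)
    (hE : 0 < E) (hΦ : TruncatedDefect.IsBoundState V E Φ) :
    ∃ κ : ℝ, TruncatedDefect.IsFloquetExponent Vper E κ ∧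
      ∀ k : ℝ, 0 < k → k ≤ κ →
        ∃ M₀ : ℝ, ρ < M₀ ∧ ∃ C : ℝ, 0 < C ∧ ∀ M : ℝ, M₀ ≤ M →
          DifferentiableAt ℂ (TruncatedDefect.Theta V Φ M) (TruncatedDefect.eta Φ E) ∧
          TruncatedDefect.jacDet V Φ M (TruncatedDefect.eta Φ E) ≠ 0 ∧
          ∃ ζ : TruncatedDefect.C2,
            (ζ ∈ TruncatedDefect.Omega k M (TruncatedDefect.eta Φ E) ∧
              TruncatedDefect.Theta V Φ M ζ = 0) ∧
            (∀ ζ' ∈ TruncatedDefect.Omega k M (TruncatedDefect.eta Φ E),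
              TruncatedDefect.Theta V Φ M ζ' = 0 → ζ' = ζ) ∧
            (k < κ → ‖ζ - TruncatedDefect.newtonPoint V Φ M (TruncatedDefect.eta Φ E)‖
              ≤ C * Real.exp (-(4 * k * M))) ∧
            ‖ζ - TruncatedDefect.newtonPoint V Φ M (TruncatedDefect.eta Φ E)‖
              ≤ C * M * Real.exp (-(4 * κ * M)) ∧
            TruncatedDefect.IsResonance (TruncatedDefect.Vtrunc V M) (ζ 1) := by
  open TruncatedDefect in
  obtain ⟨κ, hκ, δ, K, c, hδ, hδE, hK, hc, H⟩ := hΦ.exists_theta_expansion hρ hV hE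
  refine ⟨κ, hκ, fun k hk hkκ => ?_⟩
  have hκ0 := hκ.1
  set Γ := (4 * K / δ + 1) / c with hΓ
  set Λ := 32 * K / δ ^ 2 + 8 * K / δ with hΛ
  have hΓ0 : 0 ≤ Γ := by positivity
  have hΛ0 : 0 ≤ Λ := by positivity
  obtain ⟨M₁, hM₁⟩ := Filter.eventually_atTop.1
    (eventually_newton_conditions (K := K) hκ0 hk hkκ hΓ0 hΛ0 hδ hc ρ)
  set C₁ := 4 * (Γ * 2 * Λ) * (Γ * 2 * K) ^ 2 with hC₁
  have hC₁0 : 0 ≤ C₁ := by positivity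
  have hinv : 0 ≤ C₁ * (1 / (4 * (κ - k))) :=
    mul_nonneg hC₁0 (one_div_nonneg.2 (by linarith))
  -- The first summand serves the bound for `k < κ`; for `k = κ` it is 0 by the convention `1 / 0 =
  -- 0`, and that bound is then not claimed. The second serves the bound with the factor `M`, and
  -- the 1 ensures positivity.
  refine ⟨M₁, (hM₁ M₁ le_rfl).2.1, C₁ * (1 / (4 * (κ - k))) + C₁ + 1, by positivity, fun M hM => ?_⟩
  obtain ⟨m1, -, m3, m4, m5, m6⟩ := hM₁ M hM
  have hM0 : 0 < M := by linarith
  have hR : 0 < δ / M := by positivity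
  obtain ⟨θ, θ', g₀, g₁, h₀, h₁, P, P', hθ, hθ', hg, hh, hPP, hΘ⟩ := H M m1
  set η := eta Φ E with hη
  set r := 1 / M ^ 2 * Real.exp (-(k * M)) with hr
  have hr0 : 0 ≤ r := by positivity
  obtain ⟨hpq, x, hx, hroot, huniq, herr⟩ := hg.exists_root hh hδ hM0 hc hPP m3 hr0 m4 m5 m6
  have hmem : Metric.ball (0 : ℂ) (δ / M) ∈ nhds 0 := Metric.ball_mem_nhds _ hR
  have dg₀ := hg.diff₀.differentiableAt hmem
  have dg₁ := hg.diff₁.differentiableAt hmem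
  have dh₀ := hh.diff₀.differentiableAt hmem
  have dh₁ := hh.diff₁.differentiableAt hmem
  have hplus := fun ζ hζ => (hΘ ζ hζ).1
  have hminus := fun ζ hζ => (hΘ ζ hζ).2
  have hη0 : ‖η 1 - η 1‖ < δ / M := by simpa using hR
  obtain ⟨hJ, hN⟩ := newtonPoint_eq (M := M) (V := V) (Φ := Φ) (η := η) hθ hθ' hpq
    (by rw [dw_eq hR hplus, hg.zero₁, mul_one]) (dz_eq hR hplus dg₀)
    (by rw [dw_eq hR hminus, hh.zero₁, mul_one]) (dz_eq hR hminus dh₀)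
    (by simpa using hplus η hη0) (by simpa using hminus η hη0)
  have hball : ∀ y : C2, ‖y‖ ≤ r → ‖y 1‖ < δ / M := fun y hy =>
    ((PiLp.norm_apply_le y 1).trans hy).trans_lt (by linarith)
  have hzero : ∀ y : C2, ‖y‖ ≤ r → (Theta V Φ M (η + y) = 0 ↔
      g₀ (y 1) + y 0 * g₁ (y 1) = 0 ∧ h₀ (y 1) + y 0 * h₁ (y 1) = 0) := fun y hy => by
    have h := hΘ (η + y) (by simpa using hball y hy)
    simp only [PiLp.add_apply, add_sub_cancel_left] at h
    rw [Theta_eq_zero_iff, h.1, h.2, mul_eq_zero_iff_left hθ, mul_eq_zero_iff_left hθ']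
  have hΘx := (hzero x hx).2 hroot
  have herr' : ‖η + x - newtonPoint V Φ M η‖ ≤ C₁ * M * Real.exp (-(4 * κ * M)) := by
    rw [hN, add_sub_add_left_eq_sub]
    refine herr.trans_eq ?_
    have e : Real.exp (-(4 * κ * M)) = Real.exp (-(2 * κ * M)) ^ 2 := by
      rw [sq, ← Real.exp_add]; ring_nf
    rw [e, hC₁]; ring
  refine ⟨?_, hJ, η + x, ⟨?_, hΘx⟩, fun ζ' hζ' hroot' => ?_, fun hlt => ?_, ?_, ?_⟩
  · refine differentiableAt_euclidean.2 fun i => ?_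
    fin_cases i
    · exact differentiableAt_of_expansion hR hplus dg₀ dg₁
    · exact differentiableAt_of_expansion hR hminus dh₀ dh₁
  · rw [Omega, mem_closedBall_iff_norm, add_sub_cancel_left]
    exact hx
  · have hy : ‖ζ' - η‖ ≤ r := mem_closedBall_iff_norm.1 hζ'
    have h1 := (hzero (ζ' - η) hy).1 (by rwa [add_sub_cancel])
    rw [← huniq _ hy h1.1 h1.2, add_sub_cancel]
  · refine herr'.trans ((error_le_of_lt hC₁0 hlt).trans ?_)
    gcongr
    linarith
  · refine herr'.trans ?_
    gcongr
    linarith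
  · obtain ⟨z1, z2⟩ := Theta_eq_zero_iff.1 hΘx
    refine isResonance_of_Theta_eq_zero hV.continuous hM0 ?_ z1 z2
    have h1 : η 1 = (E : ℂ) := by simp [hη, eta]
    rw [PiLp.add_apply, h1]
    exact re_pos_of_mem_ball ((hball x hx).trans_le ((div_le_self hδ.le m1).trans hδE.le))
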